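/- Let $\hat K=(0,1)^2$, and for integers $m,n\ge 0$ let $\mathcal P_{m,n}$ be the real polynomials of degree at most $m$ in $\hat x_1$ and at most $n$ in $\hat x_2$; put $\mathcal Q_r=\mathcal P_{r,r}$ and $\mathcal{RT}_r=\mathcal P_{r+1,r}\times\mathcal P_{r,r+1}$. For a nondegenerate convex quadrilateral $K\subset\mathbb R^2$ let $F_K:\hat K\to K$ be the bilinear diffeomorphism mapping the corners of $\hat K$ to the vertices of $K$, let $J_K=DF_K$, and let $h_K$ be the diameter of $K$. Define $$S_r(K)=\{\hat v\circ F_K^{-1}:\hat v\in\mathcal Q_r\},\quad \boldsymbol S_r(K)=S_r(K)^2,\quad \boldsymbol V_r(K)=\Big\{\Big(\frac{J_K}{\det J_K}\,\hat q\Big)\circ F_K^{-1}:\hat q\in\mathcal{RT}_r\Big\},$$ and let $\tilde\Gamma_r(\partial K)$ be the space of continuous functions on $\partial K$ whose restriction to each edge is a polynomial of degree at most $r$. Let $H(\mathrm{div},K)$ be the space of $q\in L_2(K)^2$ with weak divergence in $L_2(K)$, with norm $\|q\|_{H(\mathrm{div},K)}^2=\|q\|_{L_2(K)}^2+\|\nabla\cdot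 q\|_{L_2(K)}^2$. For $q\in H(\mathrm{div},K)$ and $\gamma$ the trace of some $v\in H^1(K)$, write $\langle\gamma,q\cdot n\rangle_{\partial K}=(q,\nabla v)_K+(\nabla\cdot q,v)_K$ for the duality pairing of $\gamma$ with the normal trace of $q$; it does not depend on the choice of $v$. For every integer $p\ge0$ and all $\theta>0$, $\sigma$, $L$ there is a constant $C>0$, depending only on $p,\theta,\sigma,L$, such that for every nondegenerate convex quadrilateral $K$ (in particular, every parallelogram) whose interior angles all lie in $[\theta,\pi-\theta]$, whose ratio of any two side lengths is at most $\sigma$, and with $h_K\le L$, there exists a linear operator $\pi_K:H(\mathrm{div},K)\to\boldsymbol V_{p+2}(K)$ such that, for all $q\in H(\mathrm{div},K)$, $$(q-\pi_Kq,\eta)_K=0\quad\forall\,\eta\in\boldsymbol S_p(K),$$ $$\langle\gamma,(q-\pi_Kq)\cdot n\rangle_{\partial K}=0\quad\forall\,\gamma\in\tilde\Gamma_{p+1}(\partial K),$$ $$\|\pi_Kq\|_{H(\mathrm{div},K)}\le C\,\|q\|_{H(\mathrm{div},K)}.$$ -/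

import Mathlib

noncomputable section

namespace QuadFE

open MeasureTheory

/-- The Euclidean plane. -/
abbrev Plane : Type := EuclideanSpace ℝ (Fin 2)

/-! ### The space H(div, U) -/

/-- Smooth test functions with compact support contained in `U`. -/
def IsTest (U : Set Plane) (φ : Plane → ℝ) : Prop :=
  ContDiff ℝ (⊤ : ℕ∞) φ ∧ HasCompactSupport φ ∧ tsupport φ ⊆ U

/-- `f` is the weak (distributional) divergence of the vector field `q` on `U`. -/
def IsWeakDiv (U : Set Plane) (q : Plane → Plane) (f : Plane → ℝ) : Prop :=
  ∀ φ : Plane → ℝ, IsTest U φ →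
    ∫ x in U, inner ℝ (q x) (gradient φ x) = - ∫ x in U, f x * φ x

/-- `g` is the weak (distributional) gradient of the scalar function `v` on `U`. -/
def IsWeakGrad (U : Set Plane) (v : Plane → ℝ) (g : Plane → Plane) : Prop :=
  ∀ φ : Plane → ℝ, IsTest U φ →
    ∫ x in U, v x • gradient φ x = - ∫ x in U, φ x • g x

/-- Pairs (vector field, scalar function) in `L²(U; ℝ²) × L²(U)` with the Hilbert product norm
`‖(q, f)‖² = ‖q‖² + ‖f‖²`. -/
abbrev L2Pair (U : Set Plane) : Type :=
  WithLp 2 (Lp Plane 2 (volume.restrict U) × Lp ℝ 2 (volume.restrict U))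

theorem IsTest.memLp {U : Set Plane} {φ : Plane → ℝ} (h : IsTest U φ) :
    MemLp φ 2 (volume.restrict U) :=
  (h.1.continuous.memLp_of_hasCompactSupport h.2.1).restrict U

theorem IsTest.memLp_gradient {U : Set Plane} {φ : Plane → ℝ} (h : IsTest U φ) :
    MemLp (gradient φ) 2 (volume.restrict U) := by
  have hc : Continuous (fderiv ℝ φ) := h.1.continuous_fderiv (by simp)
  have hg : Continuous (gradient φ) :=
    (InnerProductSpace.toDual ℝ Plane).symm.continuous.comp hc
  have hs : HasCompactSupport (gradient φ) :=
    (h.2.1.fderiv (𝕜 := ℝ)).comp_left (g := (InnerProductSpace.toDual ℝ Plane).symm) (by simp)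
  exact (hg.memLp_of_hasCompactSupport hs).restrict U

theorem integrable_inner_memLp {U : Set Plane} {f g : Plane → Plane}
    (hf : MemLp f 2 (volume.restrict U)) (hg : MemLp g 2 (volume.restrict U)) :
    Integrable (fun x => inner ℝ (f x) (g x)) (volume.restrict U) := by
  refine (L2.integrable_inner (𝕜 := ℝ) (hf.toLp f) (hg.toLp g)).congr ?_
  filter_upwards [hf.coeFn_toLp, hg.coeFn_toLp] with x h1 h2
  rw [h1, h2]

/-- `H(div, U)`: the square integrable vector fields with square integrable weak divergence.
An element is the field together with its (uniquely determined) divergence, so the norm inherited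
from `L2Pair U` is the graph norm `(‖q‖² + ‖div q‖²)^{1/2}`. -/
def HDiv (U : Set Plane) : Submodule ℝ (L2Pair U) where
  carrier := {z | IsWeakDiv U z.fst z.snd}
  zero_mem' := by
    intro φ _
    have h1 : ∫ x in U, inner ℝ (((0 : L2Pair U).fst) x) (gradient φ x) = 0 := by
      refine integral_eq_zero_of_ae ?_
      filter_upwards [Lp.coeFn_zero Plane 2 (volume.restrict U)] with x hx
      rw [WithLp.zero_fst, hx]; simp
    have h2 : ∫ x in U, ((0 : L2Pair U).snd) x * φ x = 0 := by
      refine integral_eq_zero_of_ae ?_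
      filter_upwards [Lp.coeFn_zero ℝ 2 (volume.restrict U)] with x hx
      rw [WithLp.zero_snd, hx]; simp
    rw [h1, h2, neg_zero]
  add_mem' := by
    intro a b ha hb φ hφ
    have h1 : ∫ x in U, inner ℝ ((a + b).fst x) (gradient φ x)
        = (∫ x in U, inner ℝ (a.fst x) (gradient φ x))
          + ∫ x in U, inner ℝ (b.fst x) (gradient φ x) := by
      rw [← integral_add (integrable_inner_memLp (Lp.memLp a.fst) hφ.memLp_gradient)
        (integrable_inner_memLp (Lp.memLp b.fst) hφ.memLp_gradient)]
      refine integral_congr_ae ?_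
      filter_upwards [Lp.coeFn_add a.fst b.fst] with x hx
      rw [WithLp.add_fst, hx, Pi.add_apply, inner_add_left]
    have h2 : ∫ x in U, (a + b).snd x * φ x
        = (∫ x in U, a.snd x * φ x) + ∫ x in U, b.snd x * φ x := by
      have ia : Integrable (fun x => a.snd x * φ x) (volume.restrict U) :=
        (Lp.memLp a.snd).integrable_mul hφ.memLp
      have ib : Integrable (fun x => b.snd x * φ x) (volume.restrict U) :=
        (Lp.memLp b.snd).integrable_mul hφ.memLp
      rw [← integral_add ia ib]
      refine integral_congr_ae ?_
      filter_upwards [Lp.coeFn_add a.snd b.snd] with x hx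
      rw [WithLp.add_snd, hx, Pi.add_apply, add_mul]
    rw [h1, h2, ha φ hφ, hb φ hφ, neg_add]
  smul_mem' := by
    intro c a ha φ hφ
    have h1 : ∫ x in U, inner ℝ ((c • a).fst x) (gradient φ x)
        = c * ∫ x in U, inner ℝ (a.fst x) (gradient φ x) := by
      rw [← integral_const_mul]
      refine integral_congr_ae ?_
      filter_upwards [Lp.coeFn_smul c a.fst] with x hx
      rw [WithLp.smul_fst, hx, Pi.smul_apply, real_inner_smul_left]
    have h2 : ∫ x in U, (c • a).snd x * φ x = c * ∫ x in U, a.snd x * φ x := by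
      rw [← integral_const_mul]
      refine integral_congr_ae ?_
      filter_upwards [Lp.coeFn_smul c a.snd] with x hx
      rw [WithLp.smul_snd, hx, Pi.smul_apply, smul_eq_mul, mul_assoc]
    rw [h1, h2, ha φ hφ, mul_neg]

/-- The vector field of an element of `H(div, U)`. -/
def vecField {U : Set Plane} (q : HDiv U) : Lp Plane 2 (volume.restrict U) := q.1.fst

/-- The divergence of an element of `H(div, U)`. -/
def divField {U : Set Plane} (q : HDiv U) : Lp ℝ 2 (volume.restrict U) := q.1.snd

/-- `v ∈ H¹(U)` with weak gradient `g`. -/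
structure IsH1 (U : Set Plane) (v : Plane → ℝ) (g : Plane → Plane) : Prop where
  memLp : MemLp v 2 (volume.restrict U)
  memLp_grad : MemLp g 2 (volume.restrict U)
  weakGrad : IsWeakGrad U v g

/-! ### Polynomial spaces on the reference square -/

/-- `P_{m,n}`: polynomials of degree at most `m` in the first and `n` in the second variable. -/
def polyP (m n : ℕ) : Submodule ℝ (MvPolynomial (Fin 2) ℝ) :=
  MvPolynomial.restrictSupport ℝ {s : Fin 2 →₀ ℕ | s 0 ≤ m ∧ s 1 ≤ n}

/-- The Raviart-Thomas space `RT_r = P_{r+1,r} × P_{r,r+1}`. -/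
def polyRT (r : ℕ) : Submodule ℝ (MvPolynomial (Fin 2) ℝ × MvPolynomial (Fin 2) ℝ) :=
  (polyP (r + 1) r).prod (polyP r (r + 1))

/-- Value of a scalar polynomial at a point of the plane. -/
def polyVal (P : MvPolynomial (Fin 2) ℝ) (x : Plane) : ℝ :=
  MvPolynomial.eval (fun i => x i) P

/-- Value of a vector polynomial at a point of the plane. -/
def polyVec (Q : MvPolynomial (Fin 2) ℝ × MvPolynomial (Fin 2) ℝ) (x : Plane) : Plane :=
  !₂[polyVal Q.1 x, polyVal Q.2 x]

/-- The (open) reference element, the unit square. -/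
def refSquare : Set Plane := {x | ∀ i, 0 < x i ∧ x i < 1}

/-! ### Convex quadrilaterals -/

/-- The planar cross product. -/
def cross (a b : Plane) : ℝ := a 0 * b 1 - a 1 * b 0

/-- A nondegenerate convex quadrilateral, given by its vertices in counterclockwise order:
one turns strictly to the left at every vertex. (Four left turns by angles in `(0, π)` add up to
exactly `2π`, so the closed polygon is simple and strictly convex.) -/
structure ConvexQuad where
  vertex : Fin 4 → Plane
  left_turn : ∀ i, 0 < cross (vertex (i + 1) - vertex i) (vertex (i + 2) - vertex (i + 1))

namespace ConvexQuad

variable (K : ConvexQuad)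

/-- The bilinear map `F_K` taking the corners of the unit square to the vertices of `K`. -/
def map (x : Plane) : Plane :=
  ((1 - x 0) * (1 - x 1)) • K.vertex 0 + (x 0 * (1 - x 1)) • K.vertex 1
    + (x 0 * x 1) • K.vertex 2 + ((1 - x 0) * x 1) • K.vertex 3

/-- The open element `K = F_K(K̂)`. -/
def carrier : Set Plane := K.map '' refSquare

/-- The inverse of `F_K : K̂ → K`. -/
def invMap : Plane → Plane := Function.invFunOn K.map refSquare

/-- The constant speed parametrization over `[0, 1]` of the `i`-th edge. -/
def edge (i : Fin 4) (t : ℝ) : Plane := AffineMap.lineMap (K.vertex i) (K.vertex (i + 1)) t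

/-- The boundary of `K`, the union of the four closed edges. -/
def boundary : Set Plane := ⋃ i, segment ℝ (K.vertex i) (K.vertex (i + 1))

/-- The element diameter `h_K`. -/
def diam : ℝ := Metric.diam K.carrier

/-- Shape regularity: all interior angles lie in `[θ, π - θ]` and the ratio of the lengths of any
two sides is at most `σ`. -/
def ShapeRegular (θ σ : ℝ) : Prop :=
  (∀ i, EuclideanGeometry.angle (K.vertex i) (K.vertex (i + 1)) (K.vertex (i + 2))
      ∈ Set.Icc θ (Real.pi - θ)) ∧
  ∀ i j, dist (K.vertex i) (K.vertex (i + 1)) ≤ σ * dist (K.vertex j) (K.vertex (j + 1))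

/-- The Piola transform `((det J_K)⁻¹ J_K q̂) ∘ F_K⁻¹` of a field on the reference square, where
`J_K = D F_K`. -/
def piola (q : Plane → Plane) (y : Plane) : Plane :=
  (fderiv ℝ K.map (K.invMap y)).det⁻¹ • fderiv ℝ K.map (K.invMap y) (q (K.invMap y))

/-- `S_r(K)`: the functions `v̂ ∘ F_K⁻¹` with `v̂` a polynomial of degree at most `r` in each
variable. -/
def scalarSpace (r : ℕ) : Set (Plane → ℝ) :=
  {v | ∃ P ∈ polyP r r, v =ᵐ[volume.restrict K.carrier] fun y => polyVal P (K.invMap y)}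

/-- Vector fields with both components in `S_r(K)`. -/
def vectorSpace (r : ℕ) : Set (Plane → Plane) :=
  {η | ∀ i, (fun y => η y i) ∈ K.scalarSpace r}

/-- `V_r(K)`: the Piola transforms of the Raviart-Thomas fields of index `r`. -/
def rtSpace (r : ℕ) : Submodule ℝ (HDiv K.carrier) where
  carrier := {q | ∃ Q ∈ polyRT r, vecField q =ᵐ[volume.restrict K.carrier] K.piola (polyVec Q)}
  zero_mem' := by
    refine ⟨0, Submodule.zero_mem _, ?_⟩
    filter_upwards [Lp.coeFn_zero Plane 2 (volume.restrict K.carrier)] with y hy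
    have h : polyVec 0 (K.invMap y) = 0 := by
      ext i; fin_cases i <;> simp [polyVec, polyVal]
    have h0 : vecField (0 : HDiv K.carrier) = 0 := rfl
    rw [h0, hy, piola, h]; simp
  add_mem' := by
    rintro a b ⟨P, hP, ha⟩ ⟨Q, hQ, hb⟩
    refine ⟨P + Q, Submodule.add_mem _ hP hQ, ?_⟩
    filter_upwards [ha, hb, Lp.coeFn_add (vecField a) (vecField b)] with y hya hyb hy
    have h : polyVec (P + Q) (K.invMap y)
        = polyVec P (K.invMap y) + polyVec Q (K.invMap y) := by
      ext i; fin_cases i <;> simp [polyVec, polyVal]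
    have h0 : vecField (a + b) = vecField a + vecField b := rfl
    rw [h0, hy, Pi.add_apply, hya, hyb]
    simp only [piola, h, map_add, smul_add]
  smul_mem' := by
    rintro c a ⟨P, hP, ha⟩
    refine ⟨c • P, Submodule.smul_mem _ c hP, ?_⟩
    filter_upwards [ha, Lp.coeFn_smul c (vecField a)] with y hya hy
    have h : polyVec (c • P) (K.invMap y) = c • polyVec P (K.invMap y) := by
      ext i; fin_cases i <;> simp [polyVec, polyVal, MvPolynomial.smul_eval]
    have h0 : vecField (c • a) = c • vecField a := rfl
    rw [h0, hy, Pi.smul_apply, hya]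
    simp only [piola, h, map_smul]
    exact smul_comm _ _ _

/-- Functions that are continuous on `∂K` and polynomial of degree at most `r` on each edge. -/
def contBoundaryPoly (r : ℕ) : Set (Plane → ℝ) :=
  {γ | ContinuousOn γ K.boundary ∧
    ∀ i, ∃ P : Polynomial ℝ, P.natDegree ≤ r ∧
      ∀ t ∈ Set.Icc (0 : ℝ) 1, γ (K.edge i t) = P.eval t}

/-- The function `v ∈ H¹(K)` with weak gradient `g` has the trace `γ` on `∂K`: the trace operator
is the continuous extension of the restriction `φ ↦ φ|_∂K` of `C¹` functions, from the `H¹(K)`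
norm to the `L²` norm on each edge. -/
def HasTrace (v : Plane → ℝ) (g : Plane → Plane) (γ : Plane → ℝ) : Prop :=
  ∃ φ : ℕ → Plane → ℝ, (∀ n, ContDiff ℝ 1 (φ n)) ∧
    Filter.Tendsto (fun n => eLpNorm (fun x => φ n x - v x) 2 (volume.restrict K.carrier))
      Filter.atTop (nhds 0) ∧
    Filter.Tendsto
      (fun n => eLpNorm (fun x => gradient (φ n) x - g x) 2 (volume.restrict K.carrier))
      Filter.atTop (nhds 0) ∧
    ∀ i, Filter.Tendsto
      (fun n => eLpNorm (fun t => φ n (K.edge i t) - γ (K.edge i t)) 2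
        (volume.restrict (Set.Icc (0 : ℝ) 1)))
      Filter.atTop (nhds 0)

/-- `⟨γ, q · n⟩_∂K = c`, where `q · n ∈ H^{-1/2}(∂K)` is the normal trace of `q ∈ H(div, K)` with
respect to the outward unit normal, defined by Green's formula
`⟨γ, q · n⟩_∂K = (q, ∇v)_K + (div q, v)_K` for every `v ∈ H¹(K)` with trace `γ`. -/
def NormalTracePairing (q : HDiv K.carrier) (γ : Plane → ℝ) (c : ℝ) : Prop :=
  ∀ (v : Plane → ℝ) (g : Plane → Plane), IsH1 K.carrier v g → K.HasTrace v g γ →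
    ∫ y in K.carrier, (inner ℝ (vecField q y) (g y) + divField q y * v y) = c

end ConvexQuad

end QuadFE

end

noncomputable section

namespace QuadFE

open MeasureTheory

/-! ### Polynomials on the reference square -/

/-! The Piola transform moves everything to the reference square, where the task is a finite linear
system whose solvability is decided by the kernel of its transpose.

A field q on K with divergence d pulls back to q̂ = adj(J) (q ∘ F) and d̂ = det J · (d ∘ F), and d̂
is the weak divergence of q̂ (`refHDiv_pull`). All required moments are values of one functional (v,
ζ) ↦ (q̂, ζ) + (d̂, v), for v ∈ Q_{p+1} and ζ ∈ P_{p,p+1} × P_{p+1,p}. The interior moment against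
η̂ ∘ F⁻¹ is the value at (0, Jᵀη̂); a boundary datum γ has a Coons extension V ∈ Q_{p+1}, and
Green's formula makes its moment the value at (V, ∇V). So it suffices to find Q ∈ RT_{p+1} ⊆
RT_{p+2} inducing the same functional as (q̂, d̂).

Such a Q exists if and only if the functional vanishes on every pair (v, ζ) annihilated by all of
RT_{p+1}. By parts, these pairs satisfy (ζ - ∇v, Q) + ⟨v, Q·n⟩ = 0 for all Q, which forces ζ = ∇v
and then v = 0 on the boundary (`testSpace_annihilator`). There the functional equals (q̂, ∇v) +
(d̂, v), which is zero by Green's formula. Uniqueness of Q is not needed: a fixed linear right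
inverse selects a solution (`exists_interpolation`).

Green's formula for fields that are merely in H(div) rests on `RefHDiv.green_estimate`: for every ε
the pairing with w is at most ε (1 + ‖w‖²) + B ‖w‖²_∂, in the H¹ norm and the boundary L² norm. It
comes from a cutoff near the boundary and a Hardy inequality. The same estimate passes to the limit
in the definition of the trace, so no characterization of the functions of zero trace is needed.

For the norm bound, the right inverse depends on p only, and the Jacobian bounds of
`ShapeRegular.exists_scale` transport its estimate to K. The divergence is treated separately: div Q
is the L² projection of d̂ onto Q_{p+1}, so it is controlled by div q alone, and no negative power
of h_K appears. -/

theorem polyP_mono {m m' n n' : ℕ} (hm : m ≤ m') (hn : n ≤ n') : polyP m n ≤ polyP m' n' :=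
  MvPolynomial.restrictSupport_mono ℝ fun _ h => ⟨h.1.trans hm, h.2.trans hn⟩

theorem mul_mem_polyP {m m' n n' : ℕ} {P Q : MvPolynomial (Fin 2) ℝ} (hP : P ∈ polyP m n)
    (hQ : Q ∈ polyP m' n') : P * Q ∈ polyP (m + m') (n + n') := by
  have h := Submodule.mul_mem_mul hP hQ
  rw [polyP, polyP, ← MvPolynomial.restrictSupport_add] at h
  refine MvPolynomial.restrictSupport_mono ℝ ?_ h
  rintro _ ⟨s, hs, t, ht, rfl⟩
  exact ⟨add_le_add hs.1 ht.1, add_le_add hs.2 ht.2⟩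

theorem mul_mem_polyP' {m m' n n' k l : ℕ} {P Q : MvPolynomial (Fin 2) ℝ} (hP : P ∈ polyP m n)
    (hQ : Q ∈ polyP m' n') (hk : m + m' ≤ k := by omega) (hl : n + n' ≤ l := by omega) :
    P * Q ∈ polyP k l :=
  polyP_mono hk hl (mul_mem_polyP hP hQ)

theorem C_mem_polyP (c : ℝ) (m n : ℕ) : MvPolynomial.C c ∈ polyP m n := by
  rw [polyP, ← MvPolynomial.monomial_zero', MvPolynomial.monomial_mem_restrictSupport]
  simp

theorem one_mem_polyP (m n : ℕ) : (1 : MvPolynomial (Fin 2) ℝ) ∈ polyP m n := by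
  simpa using C_mem_polyP 1 m n

theorem X_zero_mem_polyP : (MvPolynomial.X 0 : MvPolynomial (Fin 2) ℝ) ∈ polyP 1 0 := by
  rw [polyP, MvPolynomial.X, MvPolynomial.monomial_mem_restrictSupport]
  simp

theorem X_one_mem_polyP : (MvPolynomial.X 1 : MvPolynomial (Fin 2) ℝ) ∈ polyP 0 1 := by
  rw [polyP, MvPolynomial.X, MvPolynomial.monomial_mem_restrictSupport]
  simp

theorem pderiv_zero_mem_polyP {m n : ℕ} {P : MvPolynomial (Fin 2) ℝ} (hP : P ∈ polyP (m + 1) n) :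
    MvPolynomial.pderiv 0 P ∈ polyP m n := by
  rw [polyP, MvPolynomial.restrictSupport_eq_span] at hP
  induction hP using Submodule.span_induction with
  | mem x hx =>
    obtain ⟨s, hs, rfl⟩ := hx
    simp only [MvPolynomial.pderiv_monomial]
    rw [polyP, MvPolynomial.monomial_mem_restrictSupport]
    -- The exponent bound also holds when `s 0 = 0`: truncated subtraction leaves the exponent at
    -- zero, so the vanishing derivative needs no separate case.
    left
    have h1 := hs.1
    have h2 := hs.2
    constructor
    · simp; omega
    · simp; omega
  | zero => simp
  | add x y _ _ hx hy => rw [map_add]; exact add_mem hx hy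
  | smul c x _ hx => rw [Derivation.map_smul]; exact Submodule.smul_mem _ _ hx

theorem pderiv_one_mem_polyP {m n : ℕ} {P : MvPolynomial (Fin 2) ℝ} (hP : P ∈ polyP m (n + 1)) :
    MvPolynomial.pderiv 1 P ∈ polyP m n := by
  rw [polyP, MvPolynomial.restrictSupport_eq_span] at hP
  induction hP using Submodule.span_induction with
  | mem x hx =>
    obtain ⟨s, hs, rfl⟩ := hx
    simp only [MvPolynomial.pderiv_monomial]
    rw [polyP, MvPolynomial.monomial_mem_restrictSupport]
    left
    have h1 := hs.1
    have h2 := hs.2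
    constructor
    · simp; omega
    · simp; omega
  | zero => simp
  | add x y _ _ hx hy => rw [map_add]; exact add_mem hx hy
  | smul c x _ hx => rw [Derivation.map_smul]; exact Submodule.smul_mem _ _ hx

/-- Used with `u` a coordinate or one minus a coordinate, for the blends of the Coons patch. -/
theorem aeval_mem_polyP_zero {n : ℕ} {u : MvPolynomial (Fin 2) ℝ} (hu : u ∈ polyP 1 0)
    {P : Polynomial ℝ} (hP : P.natDegree ≤ n) : Polynomial.aeval u P ∈ polyP n 0 := by
  have hpow : ∀ k : ℕ, u ^ k ∈ polyP k 0 := by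
    intro k
    induction k with
    | zero => simpa using one_mem_polyP 0 0
    | succ k ih => rw [pow_succ]; exact mul_mem_polyP' ih hu
  rw [Polynomial.aeval_eq_sum_range]
  refine Submodule.sum_mem _ fun k hk => Submodule.smul_mem _ _ (polyP_mono ?_ le_rfl (hpow k))
  have := Finset.mem_range.1 hk
  omega

theorem aeval_mem_polyP_one {n : ℕ} {u : MvPolynomial (Fin 2) ℝ} (hu : u ∈ polyP 0 1)
    {P : Polynomial ℝ} (hP : P.natDegree ≤ n) : Polynomial.aeval u P ∈ polyP 0 n := by
  have hpow : ∀ k : ℕ, u ^ k ∈ polyP 0 k := by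
    intro k
    induction k with
    | zero => simpa using one_mem_polyP 0 0
    | succ k ih => rw [pow_succ]; exact mul_mem_polyP' ih hu
  rw [Polynomial.aeval_eq_sum_range]
  refine Submodule.sum_mem _ fun k hk => Submodule.smul_mem _ _ (polyP_mono le_rfl ?_ (hpow k))
  have := Finset.mem_range.1 hk
  omega

instance finite_polyP (m n : ℕ) : Module.Finite ℝ (polyP m n) := by
  have : Finite {s : Fin 2 →₀ ℕ | s 0 ≤ m ∧ s 1 ≤ n} := by
    refine Finite.of_injective
      (β := Fin (m + 1) × Fin (n + 1))
      (fun s => (⟨s.1 0, Nat.lt_succ_of_le s.2.1⟩, ⟨s.1 1, Nat.lt_succ_of_le s.2.2⟩)) ?_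
    intro s t h
    simp only [Prod.mk.injEq, Fin.mk.injEq] at h
    ext i
    fin_cases i
    exacts [h.1, h.2]
  exact Module.Finite.of_basis (MvPolynomial.basisRestrictSupport ℝ _)

/-- The divergence of a vector polynomial. -/
def polyDiv : MvPolynomial (Fin 2) ℝ × MvPolynomial (Fin 2) ℝ →ₗ[ℝ] MvPolynomial (Fin 2) ℝ :=
  (MvPolynomial.pderiv 0).toLinearMap.coprod (MvPolynomial.pderiv 1).toLinearMap

theorem polyDiv_apply (Q : MvPolynomial (Fin 2) ℝ × MvPolynomial (Fin 2) ℝ) :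
    polyDiv Q = MvPolynomial.pderiv 0 Q.1 + MvPolynomial.pderiv 1 Q.2 := rfl

theorem polyDiv_mem {r : ℕ} {Q : MvPolynomial (Fin 2) ℝ × MvPolynomial (Fin 2) ℝ}
    (hQ : Q ∈ polyRT r) : polyDiv Q ∈ polyP r r :=
  add_mem (pderiv_zero_mem_polyP hQ.1) (pderiv_one_mem_polyP hQ.2)

section polyVal

variable (P Q : MvPolynomial (Fin 2) ℝ) (x : Plane)

@[simp] theorem polyVal_add : polyVal (P + Q) x = polyVal P x + polyVal Q x := by simp [polyVal]

@[simp] theorem polyVal_sub : polyVal (P - Q) x = polyVal P x - polyVal Q x := by simp [polyVal]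

@[simp] theorem polyVal_mul : polyVal (P * Q) x = polyVal P x * polyVal Q x := by simp [polyVal]

@[simp] theorem polyVal_smul (c : ℝ) : polyVal (c • P) x = c * polyVal P x := by
  simp [polyVal, MvPolynomial.smul_eval]

@[simp] theorem polyVal_X (i : Fin 2) : polyVal (MvPolynomial.X i) x = x i := by simp [polyVal]

@[simp] theorem polyVal_C (c : ℝ) : polyVal (MvPolynomial.C c) x = c := by simp [polyVal]

@[simp] theorem polyVal_zero : polyVal 0 x = 0 := by simp [polyVal]

@[simp] theorem polyVal_one : polyVal 1 x = 1 := by simp [polyVal]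

@[simp] theorem polyVal_aeval (R : Polynomial ℝ) :
    polyVal (Polynomial.aeval P R) x = R.eval (polyVal P x) := by
  have h := Polynomial.aeval_algHom_apply (MvPolynomial.aeval (R := ℝ) fun i => x i) P R
  simpa [polyVal, MvPolynomial.aeval_eq_eval] using h.symm

theorem hasFDerivAt_polyVal :
    HasFDerivAt (polyVal P) (polyVal (MvPolynomial.pderiv 0 P) x • EuclideanSpace.proj (𝕜 := ℝ) (0 : Fin 2)
      + polyVal (MvPolynomial.pderiv 1 P) x • EuclideanSpace.proj (𝕜 := ℝ) (1 : Fin 2)) x := by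
  induction P using MvPolynomial.induction_on with
  | C a =>
    have h : polyVal (MvPolynomial.C a) = fun _ => a := by ext; simp
    rw [h]
    simpa using hasFDerivAt_const a x
  | add p q hp hq =>
    have h : polyVal (p + q) = fun y => polyVal p y + polyVal q y := by ext; simp
    rw [h]
    refine (hp.add hq).congr_fderiv ?_
    ext u
    simp
    ring
  | mul_X p i hp =>
    have h : polyVal (p * MvPolynomial.X i) = fun y => polyVal p y * y i := by ext; simp
    rw [h]
    refine (hp.mul (EuclideanSpace.proj (𝕜 := ℝ) i).hasFDerivAt).congr_fderiv ?_
    ext u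
    fin_cases i <;> simp [Derivation.leibniz, MvPolynomial.pderiv_X] <;> ring

theorem fderiv_polyVal (u : Plane) :
    fderiv ℝ (polyVal P) x u =
      polyVal (MvPolynomial.pderiv 0 P) x * u 0 + polyVal (MvPolynomial.pderiv 1 P) x * u 1 := by
  rw [(hasFDerivAt_polyVal P x).fderiv]
  simp

theorem continuous_polyVal : Continuous (polyVal P) := by
  have h : Differentiable ℝ (polyVal P) := fun x => (hasFDerivAt_polyVal P x).differentiableAt
  exact h.continuous

theorem contDiff_polyVal : ContDiff ℝ 1 (polyVal P) := by
  rw [contDiff_one_iff_hasFDerivAt]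
  refine ⟨_, ?_, hasFDerivAt_polyVal P⟩
  exact ((continuous_polyVal _).smul continuous_const).add
    ((continuous_polyVal _).smul continuous_const)

theorem continuous_polyVec (R : MvPolynomial (Fin 2) ℝ × MvPolynomial (Fin 2) ℝ) :
    Continuous (polyVec R) := by
  refine (PiLp.continuous_toLp 2 _).comp (continuous_pi fun i => ?_)
  fin_cases i
  exacts [continuous_polyVal _, continuous_polyVal _]

end polyVal

/-! ### Calculus on the reference square -/

/-- The point whose `i`-th coordinate is `s` and whose other coordinate is `t`. -/
def pt (i : Fin 2) (s t : ℝ) : Plane := WithLp.toLp 2 fun j => if j = i then s else t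

@[simp] theorem pt_self (i : Fin 2) (s t : ℝ) : pt i s t i = s := by simp [pt]

theorem pt_of_ne {i j : Fin 2} (h : j ≠ i) (s t : ℝ) : pt i s t j = t := by simp [pt, h]

theorem continuous_pt (i : Fin 2) : Continuous fun z : ℝ × ℝ => pt i z.1 z.2 := by
  refine (PiLp.continuous_toLp 2 _).comp (continuous_pi fun j => ?_)
  split_ifs
  exacts [continuous_fst, continuous_snd]

theorem hasDerivAt_pt (i : Fin 2) (s t : ℝ) :
    HasDerivAt (fun s => pt i s t) (EuclideanSpace.single i 1) s := by
  have h : (fun s => pt i s t) = fun s =>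
      pt i 0 t + s • (EuclideanSpace.single i 1 : Plane) := by
    ext s j
    by_cases h : j = i
    · subst h; simp
    · simp [pt_of_ne h, h]
  rw [h]
  simpa using ((hasDerivAt_id s).smul_const (EuclideanSpace.single i 1 : Plane)).const_add (pt i 0 t)

theorem isOpen_refSquare : IsOpen refSquare := by
  simp only [refSquare, Set.ofPred_forall]
  refine isOpen_iInter_of_finite fun i => ?_
  have h : Continuous fun x : Plane => x i := by fun_prop
  exact (isOpen_lt continuous_const h).inter (isOpen_lt h continuous_const)

/-- The closed unit square. -/
def closedSquare : Set Plane := {x | ∀ i, 0 ≤ x i ∧ x i ≤ 1}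

theorem isClosed_box (a b : ℝ) : IsClosed {x : Plane | ∀ i, a ≤ x i ∧ x i ≤ b} := by
  simp only [Set.ofPred_forall]
  refine isClosed_iInter fun i => ?_
  have h : Continuous fun x : Plane => x i := by fun_prop
  exact (isClosed_le continuous_const h).inter (isClosed_le h continuous_const)

theorem isCompact_closedSquare : IsCompact closedSquare := by
  refine Metric.isCompact_of_isClosed_isBounded (isClosed_box 0 1) ?_
  refine (Metric.isBounded_closedBall (x := (0 : Plane)) (r := 2)).subset fun x hx => ?_
  rw [mem_closedBall_zero_iff, EuclideanSpace.norm_eq]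
  refine Real.sqrt_le_iff.2 ⟨by norm_num, ?_⟩
  have h0 := hx 0
  have h1 := hx 1
  simp only [Fin.sum_univ_two, Real.norm_eq_abs, sq_abs]
  nlinarith

theorem refSquare_subset_closedSquare : refSquare ⊆ closedSquare :=
  fun _ hx i => ⟨(hx i).1.le, (hx i).2.le⟩

theorem integrableOn_refSquare {E : Type*} [NormedAddCommGroup E] {f : Plane → E}
    (hf : Continuous f) : IntegrableOn f refSquare :=
  (hf.continuousOn.integrableOn_compact isCompact_closedSquare).mono_set
    refSquare_subset_closedSquare

/-- The index `i` selects the inner variable of integration, so that one-dimensional arguments can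
be run along either axis. -/
theorem integral_refSquare {f : Plane → ℝ} (hf : Continuous f) (i : Fin 2) :
    ∫ x in refSquare, f x = ∫ t in (0 : ℝ)..1, ∫ s in (0 : ℝ)..1, f (pt i s t) := by
  have key : ∀ i, MeasurePreserving (fun z : ℝ × ℝ => pt i z.1 z.2) ∧
      MeasurableEmbedding (fun z : ℝ × ℝ => pt i z.1 z.2) := by
    have h0 : MeasurePreserving (fun z : ℝ × ℝ => pt 0 z.1 z.2) ∧
      MeasurableEmbedding (fun z : ℝ × ℝ => pt 0 z.1 z.2) := by
      have e : (fun z : ℝ × ℝ => pt 0 z.1 z.2) =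
          (MeasurableEquiv.toLp 2 (Fin 2 → ℝ)) ∘ (MeasurableEquiv.finTwoArrow (α := ℝ)).symm := by
        ext z j
        fin_cases j <;> simp [pt]
      rw [e]
      exact ⟨(PiLp.volume_preserving_toLp (Fin 2)).comp (volume_preserving_finTwoArrow ℝ).symm,
        (MeasurableEquiv.measurableEmbedding _).comp (MeasurableEquiv.measurableEmbedding _)⟩
    intro i
    fin_cases i
    · exact h0
    · have e : (fun z : ℝ × ℝ => pt 1 z.1 z.2) = (fun z : ℝ × ℝ => pt 0 z.1 z.2) ∘ Prod.swap := by
        ext z j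
        fin_cases j <;> simp [pt]
      exact e ▸ ⟨h0.1.comp Measure.measurePreserving_swap,
        h0.2.comp (MeasurableEquiv.prodComm (α := ℝ) (β := ℝ)).measurableEmbedding⟩
  have hpre : (fun z : ℝ × ℝ => pt i z.1 z.2) ⁻¹' refSquare = Set.Ioo 0 1 ×ˢ Set.Ioo 0 1 := by
    ext z
    simp only [refSquare, Set.mem_preimage, Set.mem_ofPred_eq, Set.mem_prod, Set.mem_Ioo,
      Fin.forall_fin_two]
    fin_cases i <;> simp [pt, and_comm]
  have hc : Continuous fun z : ℝ × ℝ => f (pt i z.1 z.2) := hf.comp (continuous_pt i)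
  rw [← (key i).1.setIntegral_preimage_emb (key i).2, hpre, Measure.volume_eq_prod,
    ← setIntegral_prod_swap, setIntegral_prod]
  · rw [intervalIntegral.integral_of_le zero_le_one, ← integral_Ioc_eq_integral_Ioo]
    refine integral_congr_ae (Filter.Eventually.of_forall fun t => ?_)
    simp only [Prod.swap]
    rw [intervalIntegral.integral_of_le zero_le_one, ← integral_Ioc_eq_integral_Ioo]
  · exact ((hc.comp continuous_swap).continuousOn.integrableOn_compact
      ((isCompact_Icc (a := (0 : ℝ)) (b := 1)).prod (isCompact_Icc (a := (0 : ℝ)) (b := 1)))).mono_set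
      (Set.prod_mono Set.Ioo_subset_Icc_self Set.Ioo_subset_Icc_self)

/-- The derivative along the `i`-th coordinate direction. -/
def partialD (i : Fin 2) (f : Plane → ℝ) (x : Plane) : ℝ := fderiv ℝ f x (EuclideanSpace.single i 1)

theorem hasDerivAt_comp_pt {f : Plane → ℝ} (hf : ContDiff ℝ 1 f) (i : Fin 2) (s t : ℝ) :
    HasDerivAt (fun s => f (pt i s t)) (partialD i f (pt i s t)) s :=
  (hf.differentiable one_ne_zero (pt i s t)).hasFDerivAt.comp_hasDerivAt s (hasDerivAt_pt i s t)

theorem continuous_partialD {f : Plane → ℝ} (hf : ContDiff ℝ 1 f) (i : Fin 2) :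
    Continuous (partialD i f) :=
  (hf.continuous_fderiv one_ne_zero).clm_apply continuous_const

theorem fderiv_eq_partialD (f : Plane → ℝ) (x u : Plane) :
    fderiv ℝ f x u = partialD 0 f x * u 0 + partialD 1 f x * u 1 := by
  have h : u = u 0 • EuclideanSpace.single (0 : Fin 2) (1 : ℝ)
      + u 1 • EuclideanSpace.single (1 : Fin 2) (1 : ℝ) := by
    ext j; fin_cases j <;> simp
  conv_lhs => rw [h]
  simp only [map_add, map_smul, partialD, smul_eq_mul]
  ring

theorem abs_partialD_le (f : Plane → ℝ) (i : Fin 2) (x : Plane) :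
    |partialD i f x| ≤ ‖fderiv ℝ f x‖ := by
  simpa [partialD] using (fderiv ℝ f x).le_opNorm (EuclideanSpace.single i (1 : ℝ))

theorem partialD_mul {f g : Plane → ℝ} (hf : ContDiff ℝ 1 f) (hg : ContDiff ℝ 1 g) (i : Fin 2)
    (x : Plane) :
    partialD i (fun y => f y * g y) x = partialD i f x * g x + f x * partialD i g x := by
  simp only [partialD]
  rw [fderiv_fun_mul (hf.differentiable one_ne_zero x) (hg.differentiable one_ne_zero x)]
  simp
  ring

theorem partialD_polyVal (i : Fin 2) (P : MvPolynomial (Fin 2) ℝ) (x : Plane) :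
    partialD i (polyVal P) x = polyVal (MvPolynomial.pderiv i P) x := by
  rw [partialD, fderiv_polyVal]
  fin_cases i <;> simp

/-- The divergence theorem on the unit square, one coordinate at a time. -/
theorem integral_partialD {f : Plane → ℝ} (hf : ContDiff ℝ 1 f) (i : Fin 2) :
    ∫ x in refSquare, partialD i f x = ∫ t in (0 : ℝ)..1, (f (pt i 1 t) - f (pt i 0 t)) := by
  rw [integral_refSquare (continuous_partialD hf i) i]
  refine intervalIntegral.integral_congr fun t _ => ?_
  refine intervalIntegral.integral_eq_sub_of_hasDerivAt
    (f := fun s => f (pt i s t)) (fun s _ => hasDerivAt_comp_pt hf i s t) ?_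
  exact ((continuous_partialD hf i).comp
    ((continuous_pt i).comp (continuous_id.prodMk continuous_const))).intervalIntegrable _ _

/-- The squared `L²` norm of the restriction to the boundary of the unit square. -/
def bdSq (w : Plane → ℝ) : ℝ :=
  (∫ t in (0 : ℝ)..1, (w (pt 0 0 t) ^ 2 + w (pt 0 1 t) ^ 2))
    + ∫ t in (0 : ℝ)..1, (w (pt 1 0 t) ^ 2 + w (pt 1 1 t) ^ 2)

/-- The squared `H¹` norm on the unit square. -/
def h1Sq (w : Plane → ℝ) : ℝ := ∫ x in refSquare, (w x ^ 2 + ‖fderiv ℝ w x‖ ^ 2)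

/-! ### A Hardy inequality in one variable -/

/-- Integrating the square of `g (b - a) - I`, a multiple of the deviation of `g` from its mean,
gives this form of the Cauchy-Schwarz inequality. -/
theorem sq_intervalIntegral_le {g : ℝ → ℝ} (hg : Continuous g) {a b : ℝ} (hab : a ≤ b) :
    (∫ s in a..b, g s) ^ 2 ≤ (b - a) * ∫ s in a..b, g s ^ 2 := by
  rcases hab.eq_or_lt with rfl | hlt
  · simp
  set I := ∫ s in a..b, g s
  have h0 : 0 ≤ ∫ s in a..b, (g s * (b - a) - I) ^ 2 :=
    intervalIntegral.integral_nonneg hab fun s _ => sq_nonneg _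
  have h1 : ∫ s in a..b, (g s * (b - a) - I) ^ 2
      = (b - a) ^ 2 * (∫ s in a..b, g s ^ 2) - (b - a) * I ^ 2 := by
    have e : (fun s => (g s * (b - a) - I) ^ 2)
        = fun s => ((b - a) ^ 2 * g s ^ 2 - (2 * (b - a) * I) * g s) + I ^ 2 := by
      ext s; ring
    rw [e, intervalIntegral.integral_add, intervalIntegral.integral_sub,
      intervalIntegral.integral_const_mul, intervalIntegral.integral_const_mul,
      intervalIntegral.integral_const, smul_eq_mul]
    · ring
    all_goals exact Continuous.intervalIntegrable (by fun_prop) _ _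
  rw [h1] at h0
  have hp : 0 < b - a := sub_pos.2 hlt
  have h2 : 0 ≤ (b - a) * ((b - a) * (∫ s in a..b, g s ^ 2) - I ^ 2) := by linarith
  linarith [nonneg_of_mul_nonneg_right h2 hp]

/-- Within `2 δ` of an end point, `f ^ 2` is at most twice the squared boundary value plus `4 δ ∫ f'
^ 2`. The two strips have width `2 δ` and `κ' ^ 2 ≤ M ^ 2 / δ ^ 2`, so the powers of `δ` cancel in
the derivative term: only the boundary term degenerates as `δ → 0`. -/
theorem hardy_interval {f f' κ' : ℝ → ℝ} {δ M : ℝ} (hδ : 0 < δ) (hδ' : 4 * δ ≤ 1)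
    (hf : ∀ s, HasDerivAt f (f' s) s) (hf' : Continuous f') (hκ : Continuous κ')
    (hM : ∀ s, |κ' s| ≤ M / δ) (h0 : ∀ s, 2 * δ ≤ s → s ≤ 1 - 2 * δ → κ' s = 0) :
    ∫ s in (0 : ℝ)..1, (f s * κ' s) ^ 2
      ≤ 8 * M ^ 2 / δ * (f 0 ^ 2 + f 1 ^ 2) + 16 * M ^ 2 * ∫ s in (0 : ℝ)..1, f' s ^ 2 := by
  have hfc : Continuous f := continuous_iff_continuousAt.2 fun s => (hf s).continuousAt
  set D := ∫ s in (0 : ℝ)..1, f' s ^ 2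
  have hint : ∀ a b : ℝ, IntervalIntegrable (fun s => f' s ^ 2) volume a b :=
    fun a b => (hf'.pow 2).intervalIntegrable _ _
  have hD : 0 ≤ D := intervalIntegral.integral_nonneg zero_le_one fun s _ => sq_nonneg _
  have hFTC : ∀ a b : ℝ, f b - f a = ∫ s in a..b, f' s := fun a b =>
    (intervalIntegral.integral_eq_sub_of_hasDerivAt (fun s _ => hf s)
      (hf'.intervalIntegrable _ _)).symm
  have hsub : ∀ a b : ℝ, 0 ≤ a → a ≤ b → b ≤ 1 → (f b - f a) ^ 2 ≤ (b - a) * D := by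
    intro a b ha hab hb
    rw [hFTC]
    refine (sq_intervalIntegral_le hf' hab).trans (mul_le_mul_of_nonneg_left ?_ (by linarith))
    exact intervalIntegral.integral_mono_interval ha hab hb
      (Filter.Eventually.of_forall fun s => sq_nonneg _) (hint _ _)
  -- A common bound for both strips; each of them needs only the value at its own end point.
  set B := 2 * f 0 ^ 2 + 2 * f 1 ^ 2 + 4 * δ * D
  have hB : 0 ≤ B := by positivity
  have hleft : ∀ s, 0 ≤ s → s ≤ 2 * δ → f s ^ 2 ≤ B := by
    intro s hs hs'
    have h := hsub 0 s le_rfl hs (by linarith)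
    have h' : (s - 0) * D ≤ 2 * δ * D := mul_le_mul_of_nonneg_right (by linarith) hD
    simp only [B]
    nlinarith [sq_nonneg (f s - 2 * f 0), sq_nonneg (f 1)]
  have hright : ∀ s, 1 - 2 * δ ≤ s → s ≤ 1 → f s ^ 2 ≤ B := by
    intro s hs hs'
    have h := hsub s 1 (by linarith) hs' le_rfl
    have h' : (1 - s) * D ≤ 2 * δ * D := mul_le_mul_of_nonneg_right (by linarith) hD
    simp only [B]
    nlinarith [sq_nonneg (f s - 2 * f 1), sq_nonneg (f 0)]
  have hκsq : ∀ s, κ' s ^ 2 ≤ (M / δ) ^ 2 := fun s => by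
    rw [← sq_abs]; exact pow_le_pow_left₀ (abs_nonneg _) (hM s) 2
  have hprod : ∀ s, f s ^ 2 ≤ B → (f s * κ' s) ^ 2 ≤ B * (M / δ) ^ 2 := fun s hs => by
    rw [mul_pow]; exact mul_le_mul hs (hκsq s) (sq_nonneg _) hB
  have hi : ∀ a b : ℝ, IntervalIntegrable (fun s => (f s * κ' s) ^ 2) volume a b :=
    fun a b => ((hfc.mul hκ).pow 2).intervalIntegrable _ _
  have hc : ∀ a b : ℝ, IntervalIntegrable (fun _ : ℝ => B * (M / δ) ^ 2) volume a b :=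
    fun a b => continuous_const.intervalIntegrable _ _
  rw [← intervalIntegral.integral_add_adjacent_intervals (hi 0 (2 * δ)) (hi (2 * δ) 1),
    ← intervalIntegral.integral_add_adjacent_intervals (hi (2 * δ) (1 - 2 * δ)) (hi (1 - 2 * δ) 1)]
  have i1 : ∫ s in (0 : ℝ)..(2 * δ), (f s * κ' s) ^ 2 ≤ 2 * δ * (B * (M / δ) ^ 2) := by
    refine (intervalIntegral.integral_mono_on (by linarith) (hi _ _) (hc _ _)
      fun s hs => hprod s (hleft s hs.1 hs.2)).trans_eq ?_
    rw [intervalIntegral.integral_const, smul_eq_mul]; ring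
  have i2 : ∫ s in (2 * δ)..(1 - 2 * δ), (f s * κ' s) ^ 2 = 0 := by
    rw [intervalIntegral.integral_congr (g := fun _ => (0 : ℝ)) fun s hs => ?_]
    · simp
    · rw [Set.uIcc_of_le (by linarith)] at hs
      simp [h0 s hs.1 hs.2]
  have i3 : ∫ s in (1 - 2 * δ)..1, (f s * κ' s) ^ 2 ≤ 2 * δ * (B * (M / δ) ^ 2) := by
    refine (intervalIntegral.integral_mono_on (by linarith) (hi _ _) (hc _ _)
      fun s hs => hprod s (hright s hs.1 hs.2)).trans_eq ?_
    rw [intervalIntegral.integral_const, smul_eq_mul]; ring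
  have e : 2 * δ * (B * (M / δ) ^ 2) + (0 + 2 * δ * (B * (M / δ) ^ 2))
      = 8 * M ^ 2 / δ * (f 0 ^ 2 + f 1 ^ 2) + 16 * M ^ 2 * D := by
    simp only [B]; field_simp; ring
  rw [i2]
  linarith

/-! ### Cutoff functions -/

/-- Every `s ≥ 1` is a global maximum point, so the junction `s = 1` is not special. -/
theorem deriv_smoothTransition_of_one_le {s : ℝ} (hs : 1 ≤ s) :
    deriv Real.smoothTransition s = 0 := by
  refine IsLocalMax.deriv_eq_zero (Filter.Eventually.of_forall fun t => ?_)
  rw [Real.smoothTransition.one_of_one_le hs]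
  exact Real.smoothTransition.le_one t

theorem deriv_smoothTransition_of_nonpos {s : ℝ} (hs : s ≤ 0) :
    deriv Real.smoothTransition s = 0 := by
  refine IsLocalMin.deriv_eq_zero (Filter.Eventually.of_forall fun t => ?_)
  rw [Real.smoothTransition.zero_of_nonpos hs]
  exact Real.smoothTransition.nonneg t

theorem contDiff_smoothTransition : ContDiff ℝ 1 Real.smoothTransition :=
  Real.smoothTransition.contDiff (n := 1)

theorem continuous_deriv_smoothTransition : Continuous (deriv Real.smoothTransition) :=
  contDiff_smoothTransition.continuous_deriv le_rfl

theorem exists_abs_deriv_smoothTransition_le :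
    ∃ M : ℝ, 0 < M ∧ ∀ s, |deriv Real.smoothTransition s| ≤ M := by
  obtain ⟨M, hM⟩ := (isCompact_Icc (a := (0 : ℝ)) (b := 1)).exists_bound_of_continuousOn
    continuous_deriv_smoothTransition.continuousOn
  refine ⟨|M| + 1, by positivity, fun s => ?_⟩
  by_cases h : s ∈ Set.Icc (0 : ℝ) 1
  · exact (hM s h).trans ((le_abs_self M).trans (by linarith))
  · have h0 : deriv Real.smoothTransition s = 0 := by
      rcases lt_or_ge s 0 with h1 | h1
      · exact deriv_smoothTransition_of_nonpos h1.le
      · exact deriv_smoothTransition_of_one_le (le_of_not_ge fun h2 => h ⟨h1, h2⟩)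
    rw [h0, abs_zero]
    positivity

/-- A cutoff function on `[0, 1]`, vanishing within `δ` of the end points and equal to `1` at
distance at least `2 * δ` from them. -/
def cutoff (δ t : ℝ) : ℝ :=
  Real.smoothTransition (t / δ - 1) * Real.smoothTransition ((1 - t) / δ - 1)

/-- The derivative of `cutoff`. -/
def cutoffDeriv (δ t : ℝ) : ℝ :=
  deriv Real.smoothTransition (t / δ - 1) * δ⁻¹ * Real.smoothTransition ((1 - t) / δ - 1)
    - Real.smoothTransition (t / δ - 1) * (deriv Real.smoothTransition ((1 - t) / δ - 1) * δ⁻¹)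

section cutoff

variable {δ : ℝ}

theorem contDiff_cutoff : ContDiff ℝ 1 (cutoff δ) :=
  (contDiff_smoothTransition.comp (by fun_prop)).mul (contDiff_smoothTransition.comp (by fun_prop))

theorem hasDerivAt_cutoff (t : ℝ) : HasDerivAt (cutoff δ) (cutoffDeriv δ t) t := by
  have hS : ∀ s, HasDerivAt Real.smoothTransition (deriv Real.smoothTransition s) s := fun s =>
    (contDiff_smoothTransition.differentiable one_ne_zero s).hasDerivAt
  have h1 : HasDerivAt (fun t => t / δ - 1) δ⁻¹ t := by
    simpa [div_eq_mul_inv] using ((hasDerivAt_id t).mul_const δ⁻¹).sub_const 1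
  have h2 : HasDerivAt (fun t => (1 - t) / δ - 1) (-δ⁻¹) t := by
    simpa [div_eq_mul_inv] using (((hasDerivAt_id t).const_sub 1).mul_const δ⁻¹).sub_const 1
  refine (((hS _).comp t h1).mul ((hS _).comp t h2)).congr_deriv ?_
  simp only [cutoffDeriv, Function.comp]
  ring

theorem continuous_cutoffDeriv : Continuous (cutoffDeriv δ) := by
  have h := continuous_deriv_smoothTransition
  have h' := Real.smoothTransition.continuous
  unfold cutoffDeriv
  fun_prop

theorem cutoff_nonneg (t : ℝ) : 0 ≤ cutoff δ t :=
  mul_nonneg (Real.smoothTransition.nonneg _) (Real.smoothTransition.nonneg _)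

theorem cutoff_le_one (t : ℝ) : cutoff δ t ≤ 1 :=
  mul_le_one₀ (Real.smoothTransition.le_one _) (Real.smoothTransition.nonneg _)
    (Real.smoothTransition.le_one _)

theorem cutoff_eq_zero (hδ : 0 < δ) {t : ℝ} (h : cutoff δ t ≠ 0) : δ ≤ t ∧ t ≤ 1 - δ := by
  constructor
  · by_contra! h'
    refine h (mul_eq_zero_of_left (Real.smoothTransition.zero_of_nonpos ?_) _)
    rw [sub_nonpos, div_le_one hδ]; exact h'.le
  · by_contra! h'
    refine h (mul_eq_zero_of_right _ (Real.smoothTransition.zero_of_nonpos ?_))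
    rw [sub_nonpos, div_le_one hδ]; linarith

theorem cutoff_args (hδ : 0 < δ) {t : ℝ} (h : 2 * δ ≤ t) (h' : t ≤ 1 - 2 * δ) :
    1 ≤ t / δ - 1 ∧ 1 ≤ (1 - t) / δ - 1 := by
  constructor
  · rw [le_sub_iff_add_le, le_div_iff₀ hδ]; linarith
  · rw [le_sub_iff_add_le, le_div_iff₀ hδ]; linarith

theorem cutoff_eq_one (hδ : 0 < δ) {t : ℝ} (h : 2 * δ ≤ t) (h' : t ≤ 1 - 2 * δ) :
    cutoff δ t = 1 := by
  obtain ⟨h1, h2⟩ := cutoff_args hδ h h'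
  simp [cutoff, Real.smoothTransition.one_of_one_le h1, Real.smoothTransition.one_of_one_le h2]

theorem cutoffDeriv_eq_zero (hδ : 0 < δ) {t : ℝ} (h : 2 * δ ≤ t) (h' : t ≤ 1 - 2 * δ) :
    cutoffDeriv δ t = 0 := by
  obtain ⟨h1, h2⟩ := cutoff_args hδ h h'
  simp [cutoffDeriv, deriv_smoothTransition_of_one_le h1, deriv_smoothTransition_of_one_le h2]

theorem abs_cutoffDeriv_le (hδ : 0 < δ) {M : ℝ}
    (hM : ∀ s, |deriv Real.smoothTransition s| ≤ M) (t : ℝ) :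
    |cutoffDeriv δ t| ≤ 2 * M / δ := by
  have hM0 : 0 ≤ M := (abs_nonneg _).trans (hM 0)
  have hδ' : 0 ≤ δ⁻¹ := by positivity
  have hS : ∀ s, |Real.smoothTransition s| ≤ 1 := fun s => by
    rw [abs_of_nonneg (Real.smoothTransition.nonneg s)]; exact Real.smoothTransition.le_one s
  have key : ∀ a b, |deriv Real.smoothTransition a * δ⁻¹ * Real.smoothTransition b| ≤ M / δ := by
    intro a b
    rw [abs_mul, abs_mul, abs_of_nonneg hδ', div_eq_mul_inv]
    calc _ ≤ |deriv Real.smoothTransition a| * δ⁻¹ * 1 :=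
          mul_le_mul_of_nonneg_left (hS b) (by positivity)
      _ ≤ M * δ⁻¹ := by rw [mul_one]; exact mul_le_mul_of_nonneg_right (hM a) hδ'
  refine (abs_sub _ _).trans ?_
  rw [mul_comm (Real.smoothTransition _) (_ * _)]
  refine (add_le_add (key _ _) (key _ _)).trans_eq ?_
  ring

end cutoff

/-- The cutoff function of the unit square. -/
def cutoffSq (δ : ℝ) (x : Plane) : ℝ := cutoff δ (x 0) * cutoff δ (x 1)

theorem contDiff_cutoffSq {δ : ℝ} : ContDiff ℝ 1 (cutoffSq δ) :=
  (contDiff_cutoff.comp (by fun_prop)).mul (contDiff_cutoff.comp (by fun_prop))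

theorem fderiv_cutoffSq (δ : ℝ) (x u : Plane) :
    fderiv ℝ (cutoffSq δ) x u =
      cutoffDeriv δ (x 0) * cutoff δ (x 1) * u 0 + cutoff δ (x 0) * cutoffDeriv δ (x 1) * u 1 := by
  have h : ∀ i : Fin 2, HasFDerivAt (fun x : Plane => cutoff δ (x i))
      (cutoffDeriv δ (x i) • EuclideanSpace.proj (𝕜 := ℝ) i) x := fun i =>
    HasDerivAt.comp_hasFDerivAt (h₂ := cutoff δ) (f := fun x : Plane => x i) x
      (hasDerivAt_cutoff (x i)) (EuclideanSpace.proj (𝕜 := ℝ) i).hasFDerivAt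
  have h2 : HasFDerivAt (cutoffSq δ) _ x := (h 0).mul (h 1)
  rw [h2.fderiv]
  simp
  ring

/-- The Hardy inequality on each line parallel to the `i`-th axis, integrated over the other
coordinate. The cutoff has slope at most `2 * M / δ`, which turns 8 and 16 into 32 and 64. -/
theorem integral_sq_mul_cutoffDeriv_le {w : Plane → ℝ} (hw : ContDiff ℝ 1 w) {δ M : ℝ}
    (hδ : 0 < δ) (hδ' : 4 * δ ≤ 1) (hM : ∀ s, |deriv Real.smoothTransition s| ≤ M) (i : Fin 2) :
    ∫ x in refSquare, (w x * cutoffDeriv δ (x i)) ^ 2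
      ≤ 32 * M ^ 2 / δ * (∫ t in (0 : ℝ)..1, (w (pt i 0 t) ^ 2 + w (pt i 1 t) ^ 2))
        + 64 * M ^ 2 * ∫ x in refSquare, ‖fderiv ℝ w x‖ ^ 2 := by
  have hwc := hw.continuous
  have hκ := continuous_cutoffDeriv (δ := δ)
  have hp : Continuous (partialD i w) := continuous_partialD hw i
  have hD : Continuous (fderiv ℝ w) := hw.continuous_fderiv one_ne_zero
  have hpt := continuous_pt i
  have hpt' : ∀ s : ℝ, Continuous fun t => pt i s t := fun s =>
    hpt.comp (continuous_const.prodMk continuous_id)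
  have hpts : ∀ t : ℝ, Continuous fun s => pt i s t := fun t =>
    hpt.comp (continuous_id.prodMk continuous_const)
  rw [integral_refSquare (by fun_prop) i]
  have hle : ∫ x in refSquare, partialD i w x ^ 2 ≤ ∫ x in refSquare, ‖fderiv ℝ w x‖ ^ 2 := by
    refine integral_mono (integrableOn_refSquare (by fun_prop))
      (integrableOn_refSquare (by fun_prop)) fun x => ?_
    exact sq_le_sq' (neg_le_of_abs_le (abs_partialD_le w i x))
      (le_of_abs_le (abs_partialD_le w i x))
  have hpar : ∀ F : Plane → ℝ, Continuous F →
      Continuous fun t => ∫ s in (0 : ℝ)..1, F (pt i s t) := fun F hF =>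
    intervalIntegral.continuous_parametric_intervalIntegral_of_continuous'
      (f := fun t s => F (pt i s t)) (hF.comp (hpt.comp continuous_swap)) 0 1
  have step : ∀ t : ℝ, ∫ s in (0 : ℝ)..1, (w (pt i s t) * cutoffDeriv δ (pt i s t i)) ^ 2
      ≤ 32 * M ^ 2 / δ * (w (pt i 0 t) ^ 2 + w (pt i 1 t) ^ 2)
        + 64 * M ^ 2 * ∫ s in (0 : ℝ)..1, partialD i w (pt i s t) ^ 2 := by
    intro t
    have h := hardy_interval (f := fun s => w (pt i s t)) (f' := fun s => partialD i w (pt i s t))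
      (κ' := cutoffDeriv δ) (δ := δ) (M := 2 * M) hδ hδ' (fun s => hasDerivAt_comp_pt hw i s t)
      (hp.comp (hpts t)) hκ (abs_cutoffDeriv_le hδ hM) (fun s => cutoffDeriv_eq_zero hδ)
    simp only [pt_self]
    refine h.trans_eq ?_
    ring
  have hw0 : ∀ s : ℝ, Continuous fun t => w (pt i s t) := fun s => hwc.comp (hpt' s)
  have hA : Continuous fun t => w (pt i 0 t) ^ 2 + w (pt i 1 t) ^ 2 :=
    ((hw0 0).pow 2).add ((hw0 1).pow 2)
  have hB := hpar (fun x => partialD i w x ^ 2) (by fun_prop)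
  refine (intervalIntegral.integral_mono zero_le_one
    ((hpar (fun x => (w x * cutoffDeriv δ (x i)) ^ 2) (by fun_prop)).intervalIntegrable _ _)
    (Continuous.intervalIntegrable (by fun_prop) _ _) step).trans ?_
  rw [intervalIntegral.integral_add ((hA.const_mul _).intervalIntegrable _ _)
      ((hB.const_mul _).intervalIntegrable _ _),
    intervalIntegral.integral_const_mul, intervalIntegral.integral_const_mul,
    ← integral_refSquare (f := fun x => partialD i w x ^ 2) (by fun_prop) i]
  gcongr

/-! ### Fields in H(div) on the unit square and Green's formula -/

/-- `q` is square integrable on the unit square with square integrable weak divergence `d`, tested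
against continuously differentiable functions. -/
structure RefHDiv (q : Plane → Plane) (d : Plane → ℝ) : Prop where
  memLp : MemLp q 2 (volume.restrict refSquare)
  memLp_div : MemLp d 2 (volume.restrict refSquare)
  weakDiv : ∀ ψ : Plane → ℝ, ContDiff ℝ 1 ψ → HasCompactSupport ψ → tsupport ψ ⊆ refSquare →
    ∫ x in refSquare, (fderiv ℝ ψ x (q x) + d x * ψ x) = 0

/-- The part of the unit square close to its boundary. -/
def strip (δ : ℝ) : Set Plane := refSquare \ {x | ∀ i, 2 * δ ≤ x i ∧ x i ≤ 1 - 2 * δ}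

theorem measurableSet_strip (δ : ℝ) : MeasurableSet (strip δ) :=
  isOpen_refSquare.measurableSet.diff (isClosed_box _ _).measurableSet

/-- Every point of the open square has positive distance from the boundary, so the strips decrease
to the empty set and the integrals over them tend to zero. -/
theorem exists_integral_strip_lt {H : Plane → ℝ} (hH : IntegrableOn H refSquare) {η : ℝ}
    (hη : 0 < η) : ∃ δ : ℝ, 0 < δ ∧ 4 * δ ≤ 1 ∧ ∫ x in strip δ, H x < η := by
  let s : ℕ → Set Plane := fun n => strip (1 / (4 * ((n : ℝ) + 1)))
  have hanti : Antitone s := by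
    intro m n hmn x hx
    refine ⟨hx.1, fun hx' => hx.2 fun i => ?_⟩
    have h : 1 / (4 * ((n : ℝ) + 1)) ≤ 1 / (4 * ((m : ℝ) + 1)) := by
      have : (m : ℝ) ≤ n := by exact_mod_cast hmn
      gcongr
    have := hx' i
    constructor <;> linarith
  have hinter : ⋂ n, s n = ∅ := by
    rw [Set.eq_empty_iff_forall_notMem]
    intro x hx
    rw [Set.mem_iInter] at hx
    have hxS := (hx 0).1
    obtain ⟨r, hr, hr'⟩ : ∃ r : ℝ, 0 < r ∧ ∀ i, r ≤ x i ∧ r ≤ 1 - x i := by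
      refine ⟨min (min (x 0) (1 - x 0)) (min (x 1) (1 - x 1)), ?_, ?_⟩
      · have h0 := hxS 0
        have h1 := hxS 1
        simp only [lt_min_iff]
        refine ⟨⟨?_, ?_⟩, ?_, ?_⟩ <;> linarith
      · rw [Fin.forall_fin_two]
        simp
    obtain ⟨n, hn⟩ := exists_nat_one_div_lt hr
    refine (hx n).2 fun i => ?_
    have h : 2 * (1 / (4 * ((n : ℝ) + 1))) ≤ 1 / ((n : ℝ) + 1) := by
      rw [mul_one_div, div_le_div_iff₀ (by positivity) (by positivity)]
      nlinarith
    have := hr' i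
    constructor <;> linarith
  have ht := tendsto_setIntegral_of_antitone (μ := volume) (f := H) (s := s)
    (fun n => measurableSet_strip _) hanti ⟨0, hH.mono_set fun x hx => hx.1⟩
  rw [hinter, setIntegral_empty] at ht
  obtain ⟨n, hn⟩ := (ht.eventually (gt_mem_nhds hη)).exists
  refine ⟨_, by positivity, ?_, hn⟩
  rw [mul_one_div, div_le_one (by positivity)]
  have : (0 : ℝ) ≤ n := by positivity
  linarith

theorem mul_le_young {a b c : ℝ} (hc : 0 < c) : a * b ≤ (a ^ 2 / c + c * b ^ 2) / 2 := by
  have h : 0 ≤ (a - c * b) ^ 2 / c := by positivity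
  have e : (a - c * b) ^ 2 / c = a ^ 2 / c - 2 * (a * b) + c * b ^ 2 := by field_simp; ring
  linarith

theorem aestronglyMeasurable_clm_apply {μ : Measure Plane} {A : Plane → Plane →L[ℝ] ℝ}
    (hA : Continuous A) {q : Plane → Plane} (hq : AEStronglyMeasurable q μ) :
    AEStronglyMeasurable (fun x => A x (q x)) μ :=
  isBoundedBilinearMap_apply.continuous.comp_aestronglyMeasurable
    (hA.aestronglyMeasurable.prodMk hq)

theorem integrableOn_clm_apply_add {q : Plane → Plane} {d : Plane → ℝ}
    (hq : MemLp q 2 (volume.restrict refSquare)) (hd : MemLp d 2 (volume.restrict refSquare))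
    {A : Plane → Plane →L[ℝ] ℝ} (hA : Continuous A) {w : Plane → ℝ} (hw : Continuous w) :
    IntegrableOn (fun x => A x (q x) + d x * w x) refSquare := by
  have hq2 : IntegrableOn (fun x => ‖q x‖ ^ 2) refSquare := hq.integrable_norm_pow two_ne_zero
  have hd2 : IntegrableOn (fun x => d x ^ 2) refSquare := hd.integrable_sq
  have hA2 : IntegrableOn (fun x => ‖A x‖ ^ 2) refSquare := integrableOn_refSquare (by fun_prop)
  have hw2 : IntegrableOn (fun x => w x ^ 2) refSquare := integrableOn_refSquare (by fun_prop)
  refine ((hq2.add hd2).add (hA2.add hw2)).mono'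
    ((aestronglyMeasurable_clm_apply hA hq.1).add
      (hd.1.mul hw.aestronglyMeasurable)) (Filter.Eventually.of_forall fun x => ?_)
  simp only [Pi.add_apply]
  have h1 := (A x).le_opNorm (q x)
  have h2 := norm_add_le (A x (q x)) (d x * w x)
  have h3 : ‖d x * w x‖ = |d x| * |w x| := by rw [norm_mul]; rfl
  rw [← sq_abs (d x), ← sq_abs (w x)]
  nlinarith [sq_nonneg (‖A x‖ - ‖q x‖), sq_nonneg (|d x| - |w x|), sq_nonneg (‖A x‖),
    sq_nonneg ‖q x‖, sq_nonneg |d x|, sq_nonneg |w x|]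

theorem cutoffSq_compact {δ : ℝ} (hδ : 0 < δ) (w : Plane → ℝ) :
    HasCompactSupport (fun x => cutoffSq δ x * w x) ∧
      tsupport (fun x => cutoffSq δ x * w x) ⊆ refSquare := by
  have hsub : tsupport (fun x => cutoffSq δ x * w x) ⊆ {x | ∀ i, δ ≤ x i ∧ x i ≤ 1 - δ} := by
    refine closure_minimal (fun x hx => ?_) (isClosed_box _ _)
    have hx' : cutoff δ (x 0) * cutoff δ (x 1) * w x ≠ 0 := hx
    have h0 := left_ne_zero_of_mul (left_ne_zero_of_mul hx')
    have h1 := right_ne_zero_of_mul (left_ne_zero_of_mul hx')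
    intro i
    fin_cases i
    exacts [cutoff_eq_zero hδ h0, cutoff_eq_zero hδ h1]
  refine ⟨isCompact_closedSquare.of_isClosed_subset (isClosed_tsupport _) (hsub.trans ?_),
    hsub.trans ?_⟩
  · intro x hx i
    have := hx i
    constructor <;> linarith
  · intro x hx i
    have := hx i
    constructor <;> linarith

/-- Bounds the integrand that remains once the test function `cutoffSq δ * w` has been subtracted.
Young's inequality with weight `a` collects `u` and `d` in a term to be integrated over a thin strip
only, and leaves the small factor `a / 2` on all terms containing `w`. -/
theorem green_pointwise {a δ : ℝ} (ha : 0 < a) {w : Plane → ℝ} (x u : Plane) (d : ℝ) :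
    |(1 - cutoffSq δ x) * (fderiv ℝ w x u + d * w x) - w x * fderiv ℝ (cutoffSq δ) x u|
      ≤ (‖u‖ ^ 2 + d ^ 2) / a + a / 2 * ((w x ^ 2 + ‖fderiv ℝ w x‖ ^ 2)
        + ((w x * cutoffDeriv δ (x 0)) ^ 2 + (w x * cutoffDeriv δ (x 1)) ^ 2)) := by
  have hκ0 := cutoff_nonneg (δ := δ) (x 0)
  have hκ1 := cutoff_nonneg (δ := δ) (x 1)
  have hκ0' := cutoff_le_one (δ := δ) (x 0)
  have hκ1' := cutoff_le_one (δ := δ) (x 1)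
  have hχ0 : 0 ≤ cutoffSq δ x := mul_nonneg hκ0 hκ1
  have hχ1 : cutoffSq δ x ≤ 1 := mul_le_one₀ hκ0' hκ1 hκ1'
  have hu : ‖u‖ ^ 2 = u 0 ^ 2 + u 1 ^ 2 := by
    rw [EuclideanSpace.norm_sq_eq]; simp
  have t1 : |(1 - cutoffSq δ x) * (fderiv ℝ w x u + d * w x)|
      ≤ ‖u‖ * ‖fderiv ℝ w x‖ + |d| * |w x| := by
    rw [abs_mul, abs_of_nonneg (by linarith : 0 ≤ 1 - cutoffSq δ x)]
    have h1 : |fderiv ℝ w x u + d * w x| ≤ ‖u‖ * ‖fderiv ℝ w x‖ + |d| * |w x| := by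
      refine (abs_add_le _ _).trans (add_le_add ?_ (abs_mul _ _).le)
      rw [mul_comm]; exact (fderiv ℝ w x).le_opNorm u
    exact (mul_le_of_le_one_left (abs_nonneg _) (by linarith)).trans h1
  have t2 : |w x * fderiv ℝ (cutoffSq δ) x u|
      ≤ |u 0| * |w x * cutoffDeriv δ (x 0)| + |u 1| * |w x * cutoffDeriv δ (x 1)| := by
    rw [fderiv_cutoffSq, show w x * (cutoffDeriv δ (x 0) * cutoff δ (x 1) * u 0
      + cutoff δ (x 0) * cutoffDeriv δ (x 1) * u 1) = cutoff δ (x 1) * (u 0 * (w x * cutoffDeriv δ (x 0)))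
        + cutoff δ (x 0) * (u 1 * (w x * cutoffDeriv δ (x 1))) by ring]
    refine (abs_add_le _ _).trans (add_le_add ?_ ?_)
    · rw [abs_mul, abs_of_nonneg hκ1, ← abs_mul]
      exact mul_le_of_le_one_left (abs_nonneg _) hκ1'
    · rw [abs_mul, abs_of_nonneg hκ0, ← abs_mul]
      exact mul_le_of_le_one_left (abs_nonneg _) hκ0'
  have y1 := mul_le_young (a := ‖u‖) (b := ‖fderiv ℝ w x‖) ha
  have y2 := mul_le_young (a := |d|) (b := |w x|) ha
  have y3 := mul_le_young (a := |u 0|) (b := |w x * cutoffDeriv δ (x 0)|) ha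
  have y4 := mul_le_young (a := |u 1|) (b := |w x * cutoffDeriv δ (x 1)|) ha
  simp only [sq_abs] at y2 y3 y4
  have hd : 0 ≤ d ^ 2 / a := by positivity
  -- Half of `‖u‖ ^ 2 / a` pays for the gradient of `w`; the other half, split into components, pays
  -- for the two derivatives of the cutoff.
  have e : (‖u‖ ^ 2 + d ^ 2) / a = ‖u‖ ^ 2 / a / 2 + (u 0 ^ 2 / a + u 1 ^ 2 / a) / 2 + d ^ 2 / a := by
    nth_rewrite 1 [← add_halves (‖u‖ ^ 2)]
    rw [hu]; ring
  rw [e]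
  refine (abs_sub _ _).trans ?_
  linarith

/-- Green's inequality: the boundary pairing is controlled by the `L²` norm on the boundary, up to
a small multiple of the `H¹` norm. -/
theorem RefHDiv.green_estimate {q : Plane → Plane} {d : Plane → ℝ} (h : RefHDiv q d) {ε : ℝ}
    (hε : 0 < ε) : ∃ B : ℝ, 0 ≤ B ∧ ∀ w : Plane → ℝ, ContDiff ℝ 1 w →
      |∫ x in refSquare, (fderiv ℝ w x (q x) + d x * w x)| ≤ ε * (1 + h1Sq w) + B * bdSq w := by
  obtain ⟨M, hM0, hM⟩ := exists_abs_deriv_smoothTransition_le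
  -- The `H¹` norm will occur with factor `a / 2` once directly and `64 * M ^ 2` times from the
  -- Hardy inequality in each of the two directions.
  obtain ⟨a, ha, haε⟩ : ∃ a : ℝ, 0 < a ∧ a / 2 * (1 + 128 * M ^ 2) = ε :=
    ⟨2 * ε / (1 + 128 * M ^ 2), by positivity, by field_simp⟩
  have hq2 : IntegrableOn (fun x => ‖q x‖ ^ 2) refSquare := h.memLp.integrable_norm_pow two_ne_zero
  have hd2 : IntegrableOn (fun x => d x ^ 2) refSquare := h.memLp_div.integrable_sq
  have hH : IntegrableOn (fun x => (‖q x‖ ^ 2 + d x ^ 2) / a) refSquare :=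
    (hq2.add hd2).div_const a
  -- The strip is chosen after `a`. The boundary constant then depends on `q`, `d` and `ε`, which is
  -- harmless since the field stays fixed in every application.
  obtain ⟨δ, hδ, hδ', hδε⟩ := exists_integral_strip_lt hH hε
  refine ⟨a / 2 * (32 * M ^ 2 / δ), by positivity, fun w hw => ?_⟩
  have hwc := hw.continuous
  have hD : Continuous (fderiv ℝ w) := hw.continuous_fderiv one_ne_zero
  have hκ := continuous_cutoffDeriv (δ := δ)
  have hψ : ContDiff ℝ 1 fun x => cutoffSq δ x * w x := contDiff_cutoffSq.mul hw
  have hcs := cutoffSq_compact hδ w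
  have hzero := h.weakDiv _ hψ hcs.1 hcs.2
  have hψ' : ∀ x u, fderiv ℝ (fun x => cutoffSq δ x * w x) x u
      = cutoffSq δ x * fderiv ℝ w x u + w x * fderiv ℝ (cutoffSq δ) x u := fun x u => by
    rw [fderiv_fun_mul (contDiff_cutoffSq.differentiable one_ne_zero x)
      (hw.differentiable one_ne_zero x)]
    simp
  have hi1 := integrableOn_clm_apply_add h.memLp h.memLp_div hD hwc
  have hi2 := integrableOn_clm_apply_add h.memLp h.memLp_div (hψ.continuous_fderiv one_ne_zero) hψ.continuous
  -- The product `cutoffSq δ * w` has compact support in the square, so its pairing is zero and may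
  -- be subtracted; the difference lives in the strip.
  have e : ∫ x in refSquare, (fderiv ℝ w x (q x) + d x * w x)
      = ∫ x in refSquare, ((1 - cutoffSq δ x) * (fderiv ℝ w x (q x) + d x * w x)
          - w x * fderiv ℝ (cutoffSq δ) x (q x)) := by
    rw [← sub_zero (∫ x in refSquare, (fderiv ℝ w x (q x) + d x * w x)), ← hzero,
      ← integral_sub hi1 hi2]
    refine integral_congr_ae (Filter.Eventually.of_forall fun x => ?_)
    simp only [hψ']
    ring
  have hg : Continuous fun x => a / 2 * ((w x ^ 2 + ‖fderiv ℝ w x‖ ^ 2)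
        + ((w x * cutoffDeriv δ (x 0)) ^ 2 + (w x * cutoffDeriv δ (x 1)) ^ 2)) := by fun_prop
  have hpt : ∀ x ∈ refSquare, ‖(1 - cutoffSq δ x) * (fderiv ℝ w x (q x) + d x * w x)
          - w x * fderiv ℝ (cutoffSq δ) x (q x)‖
      ≤ (strip δ).indicator (fun x => (‖q x‖ ^ 2 + d x ^ 2) / a) x
        + a / 2 * ((w x ^ 2 + ‖fderiv ℝ w x‖ ^ 2)
        + ((w x * cutoffDeriv δ (x 0)) ^ 2 + (w x * cutoffDeriv δ (x 1)) ^ 2)) := by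
    intro x hx
    by_cases hxs : x ∈ strip δ
    · rw [Set.indicator_of_mem hxs]
      exact green_pointwise ha x (q x) (d x)
    · have hx' : ∀ i, 2 * δ ≤ x i ∧ x i ≤ 1 - 2 * δ := by
        by_contra hcon
        exact hxs ⟨hx, hcon⟩
      rw [Set.indicator_of_notMem hxs, fderiv_cutoffSq, cutoffSq,
        cutoff_eq_one hδ (hx' 0).1 (hx' 0).2, cutoff_eq_one hδ (hx' 1).1 (hx' 1).2,
        cutoffDeriv_eq_zero hδ (hx' 0).1 (hx' 0).2, cutoffDeriv_eq_zero hδ (hx' 1).1 (hx' 1).2]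
      simp only [mul_one, sub_self, zero_mul, mul_zero, add_zero, zero_add, norm_zero]
      positivity
  have hind : IntegrableOn ((strip δ).indicator fun x => (‖q x‖ ^ 2 + d x ^ 2) / a) refSquare :=
    hH.indicator (measurableSet_strip δ)
  have hsub : strip δ ∩ refSquare = strip δ := Set.inter_eq_left.2 fun x hx => hx.1
  have i0 : IntegrableOn (fun x => w x ^ 2 + ‖fderiv ℝ w x‖ ^ 2) refSquare :=
    integrableOn_refSquare (by fun_prop)
  have i1 : IntegrableOn (fun x => (w x * cutoffDeriv δ (x 0)) ^ 2) refSquare :=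
    integrableOn_refSquare (by fun_prop)
  have i2 : IntegrableOn (fun x => (w x * cutoffDeriv δ (x 1)) ^ 2) refSquare :=
    integrableOn_refSquare (by fun_prop)
  have i12 : IntegrableOn (fun x => (w x * cutoffDeriv δ (x 0)) ^ 2
      + (w x * cutoffDeriv δ (x 1)) ^ 2) refSquare := i1.add i2
  have hle : ∫ x in refSquare, ‖fderiv ℝ w x‖ ^ 2 ≤ h1Sq w :=
    integral_mono (integrableOn_refSquare (by fun_prop)) i0 fun x => by
      simp only; linarith [sq_nonneg (w x)]
  have b1 := integral_sq_mul_cutoffDeriv_le hw hδ hδ' hM 0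
  have b2 := integral_sq_mul_cutoffDeriv_le hw hδ hδ' hM 1
  rw [e, ← Real.norm_eq_abs]
  refine (norm_integral_le_of_norm_le (hind.add (integrableOn_refSquare hg))
    ((ae_restrict_iff' isOpen_refSquare.measurableSet).2
      (Filter.Eventually.of_forall hpt))).trans ?_
  simp only [Pi.add_apply]
  rw [integral_add hind (integrableOn_refSquare hg), setIntegral_indicator (measurableSet_strip δ),
    Set.inter_comm, hsub, integral_const_mul, integral_add i0 i12, integral_add i1 i2]
  have hN : h1Sq w = ∫ x in refSquare, (w x ^ 2 + ‖fderiv ℝ w x‖ ^ 2) := rfl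
  rw [← hN]
  have hm : a / 2 * (h1Sq w + ((∫ x in refSquare, (w x * cutoffDeriv δ (x 0)) ^ 2)
      + ∫ x in refSquare, (w x * cutoffDeriv δ (x 1)) ^ 2))
      ≤ a / 2 * (h1Sq w + (32 * M ^ 2 / δ * bdSq w + 128 * M ^ 2 * h1Sq w)) := by
    refine mul_le_mul_of_nonneg_left ?_ (by positivity)
    have hle' : 64 * M ^ 2 * ∫ x in refSquare, ‖fderiv ℝ w x‖ ^ 2 ≤ 64 * M ^ 2 * h1Sq w :=
      mul_le_mul_of_nonneg_left hle (by positivity)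
    rw [bdSq, mul_add]
    linarith
  rw [← haε] at hδε ⊢
  linarith

/-- Green's formula for functions vanishing on the boundary. -/
theorem RefHDiv.green_eq_zero {q : Plane → Plane} {d : Plane → ℝ} (h : RefHDiv q d)
    {w : Plane → ℝ} (hw : ContDiff ℝ 1 w) (hb : bdSq w = 0) :
    ∫ x in refSquare, (fderiv ℝ w x (q x) + d x * w x) = 0 := by
  have hN : 0 ≤ h1Sq w := integral_nonneg fun x => by positivity
  refine abs_eq_zero.1 (le_antisymm (le_of_forall_pos_le_add fun ε hε => ?_) (abs_nonneg _))
  obtain ⟨B, -, hB⟩ := h.green_estimate (ε := ε / (1 + h1Sq w)) (by positivity)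
  have := hB w hw
  rw [hb, mul_zero, add_zero, div_mul_cancel₀ _ (by positivity)] at this
  linarith

/-! ### The interpolation problem on the reference square -/

/-- Integration by parts in a single variable: boundary terms arise only on the two sides where the
`i`-th coordinate is 0 or 1, so the components of a field can be treated independently. -/
theorem integral_mul_add_pderiv_mul (i : Fin 2) (Z R v : MvPolynomial (Fin 2) ℝ) :
    ∫ x in refSquare, (polyVal Z x * polyVal R x + polyVal (MvPolynomial.pderiv i R) x * polyVal v x)
      = (∫ x in refSquare, polyVal (Z - MvPolynomial.pderiv i v) x * polyVal R x)
        + ∫ t in (0 : ℝ)..1, (polyVal (R * v) (pt i 1 t) - polyVal (R * v) (pt i 0 t)) := by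
  rw [← integral_partialD (contDiff_polyVal (R * v)) i, ← integral_add]
  · refine integral_congr_ae (Filter.Eventually.of_forall fun x => ?_)
    simp only [partialD_polyVal, Derivation.leibniz, polyVal_add, polyVal_sub, smul_eq_mul,
      polyVal_mul]
    ring
  · exact integrableOn_refSquare ((continuous_polyVal _).mul (continuous_polyVal _))
  · exact integrableOn_refSquare (continuous_partialD (contDiff_polyVal _) i)

/-- The first choice of `R` kills the boundary terms and carries a weight that is positive inside,
which forces `Z = ∂ᵢ v`. Then only boundary terms survive, and the factors `xᵢ` and `1 - xᵢ` isolate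
`v ^ 2` on one side each. -/
theorem eq_pderiv_of_annihilates {i : Fin 2} {Z v : MvPolynomial (Fin 2) ℝ}
    (h : ∀ R, R = MvPolynomial.X i * (1 - MvPolynomial.X i) * (Z - MvPolynomial.pderiv i v) ∨
        R = MvPolynomial.X i * v ∨ R = (1 - MvPolynomial.X i) * v →
      ∫ x in refSquare, (polyVal Z x * polyVal R x
        + polyVal (MvPolynomial.pderiv i R) x * polyVal v x) = 0) :
    (∀ᵐ x ∂(volume.restrict refSquare), polyVal Z x = polyVal (MvPolynomial.pderiv i v) x) ∧
      ∫ t in (0 : ℝ)..1, (polyVal v (pt i 0 t) ^ 2 + polyVal v (pt i 1 t) ^ 2) = 0 := by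
  have h1 := h _ (Or.inl rfl)
  have h2 := h _ (Or.inr (Or.inl rfl))
  have h3 := h _ (Or.inr (Or.inr rfl))
  rw [integral_mul_add_pderiv_mul] at h1 h2 h3
  have hae : ∀ᵐ x ∂(volume.restrict refSquare),
      polyVal Z x = polyVal (MvPolynomial.pderiv i v) x := by
    simp only [polyVal_mul, polyVal_sub, polyVal_X, polyVal_one, pt_self, sub_self, mul_zero,
      zero_mul, intervalIntegral.integral_zero, add_zero] at h1
    have hnn : ∀ x ∈ refSquare, 0 ≤ (polyVal Z x - polyVal (MvPolynomial.pderiv i v) x)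
        * (x i * (1 - x i) * (polyVal Z x - polyVal (MvPolynomial.pderiv i v) x)) := by
      intro x hx
      have := hx i
      have h4 : 0 ≤ x i * (1 - x i) := mul_nonneg this.1.le (by linarith)
      nlinarith [mul_nonneg h4 (sq_nonneg (polyVal Z x - polyVal (MvPolynomial.pderiv i v) x))]
    have hc : Continuous fun x : Plane => (polyVal Z x - polyVal (MvPolynomial.pderiv i v) x)
        * (x i * (1 - x i) * (polyVal Z x - polyVal (MvPolynomial.pderiv i v) x)) := by
      have := continuous_polyVal Z
      have := continuous_polyVal (MvPolynomial.pderiv i v)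
      fun_prop
    rw [setIntegral_eq_zero_iff_of_nonneg_ae
      ((ae_restrict_iff' isOpen_refSquare.measurableSet).2 (Filter.Eventually.of_forall hnn))
      (integrableOn_refSquare hc)] at h1
    filter_upwards [h1, ae_restrict_mem isOpen_refSquare.measurableSet] with x hx hxS
    have hxi := hxS i
    have h5 : x i ≠ 0 := hxi.1.ne'
    have h6 : 1 - x i ≠ 0 := by linarith
    simp only [Pi.zero_apply, mul_eq_zero, h5, h6, false_or, or_self] at hx
    linarith
  have hz : ∀ R : MvPolynomial (Fin 2) ℝ,
      ∫ x in refSquare, polyVal (Z - MvPolynomial.pderiv i v) x * polyVal R x = 0 := fun R => by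
    refine integral_eq_zero_of_ae ?_
    filter_upwards [hae] with x hx
    simp [hx]
  rw [hz, zero_add] at h2 h3
  refine ⟨hae, ?_⟩
  simp only [polyVal_mul, polyVal_sub, polyVal_X, polyVal_one, pt_self, sub_self, sub_zero,
    zero_mul, one_mul, zero_sub] at h2 h3
  have hc : ∀ s : ℝ, Continuous fun t => polyVal v (pt i s t) := fun s =>
    (continuous_polyVal v).comp ((continuous_pt i).comp (continuous_const.prodMk continuous_id))
  have hadd := intervalIntegral.integral_add (μ := volume)
    (((hc 0).pow 2).intervalIntegrable 0 1) (((hc 1).pow 2).intervalIntegrable 0 1)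
  simp only [Pi.pow_apply] at hadd
  rw [hadd]
  rw [intervalIntegral.integral_neg, neg_eq_zero] at h3
  simp only [pow_two]
  rw [h2, h3, add_zero]

/-- The pairs of a scalar and a vector polynomial against which fields are tested. -/
def testSpace (p : ℕ) :
    Submodule ℝ (MvPolynomial (Fin 2) ℝ × (MvPolynomial (Fin 2) ℝ × MvPolynomial (Fin 2) ℝ)) :=
  (polyP (p + 1) (p + 1)).prod ((polyP p (p + 1)).prod (polyP (p + 1) p))

instance finite_testSpace (p : ℕ) : Module.Finite ℝ (testSpace p) :=
  Module.Finite.iff_fg.2 ((Module.Finite.iff_fg.1 (finite_polyP _ _)).prod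
    ((Module.Finite.iff_fg.1 (finite_polyP _ _)).prod (Module.Finite.iff_fg.1 (finite_polyP _ _))))

theorem polyVec_add (P Q : MvPolynomial (Fin 2) ℝ × MvPolynomial (Fin 2) ℝ) (x : Plane) :
    polyVec (P + Q) x = polyVec P x + polyVec Q x := by
  ext i; fin_cases i <;> simp [polyVec]

theorem polyVec_smul (c : ℝ) (P : MvPolynomial (Fin 2) ℝ × MvPolynomial (Fin 2) ℝ) (x : Plane) :
    polyVec (c • P) x = c • polyVec P x := by
  ext i; fin_cases i <;> simp [polyVec]

theorem polyVec_zero (x : Plane) : polyVec 0 x = 0 := by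
  ext i; fin_cases i <;> simp [polyVec]

theorem inner_polyVec (Q : MvPolynomial (Fin 2) ℝ × MvPolynomial (Fin 2) ℝ) (x u : Plane) :
    inner ℝ (polyVec Q x) u = polyVal Q.1 x * u 0 + polyVal Q.2 x * u 1 := by
  simp [polyVec, PiLp.inner_apply, mul_comm]

section refPair

variable {q : Plane → Plane} {d : Plane → ℝ} (hq : MemLp q 2 (volume.restrict refSquare))
  (hd : MemLp d 2 (volume.restrict refSquare))

include hq hd in
theorem integrableOn_refPair
    (e : MvPolynomial (Fin 2) ℝ × (MvPolynomial (Fin 2) ℝ × MvPolynomial (Fin 2) ℝ)) :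
    IntegrableOn (fun x => inner ℝ (polyVec e.2 x) (q x) + d x * polyVal e.1 x) refSquare :=
  integrableOn_clm_apply_add hq hd (A := fun x => innerSL ℝ (polyVec e.2 x))
    ((innerSL ℝ).continuous.comp (continuous_polyVec e.2)) (continuous_polyVal e.1)

/-- The functional `(v, ζ) ↦ (q, ζ) + (d, v)` on polynomials, with `L²` products on the square. -/
def refPair :
    MvPolynomial (Fin 2) ℝ × (MvPolynomial (Fin 2) ℝ × MvPolynomial (Fin 2) ℝ) →ₗ[ℝ] ℝ where
  toFun e := ∫ x in refSquare, (inner ℝ (polyVec e.2 x) (q x) + d x * polyVal e.1 x)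
  map_add' e f := by
    rw [← integral_add (integrableOn_refPair hq hd e) (integrableOn_refPair hq hd f)]
    refine integral_congr_ae (Filter.Eventually.of_forall fun x => ?_)
    simp only [Prod.snd_add, Prod.fst_add, polyVec_add, polyVal_add, inner_add_left]
    ring
  map_smul' c e := by
    rw [RingHom.id_apply, smul_eq_mul, ← integral_const_mul]
    refine integral_congr_ae (Filter.Eventually.of_forall fun x => ?_)
    simp only [Prod.smul_snd, Prod.smul_fst, polyVec_smul, polyVal_smul, real_inner_smul_left]
    ring

theorem refPair_apply
    (e : MvPolynomial (Fin 2) ℝ × (MvPolynomial (Fin 2) ℝ × MvPolynomial (Fin 2) ℝ)) :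
    refPair hq hd e = ∫ x in refSquare, (inner ℝ (polyVec e.2 x) (q x) + d x * polyVal e.1 x) := rfl

/-- A form of the Cauchy-Schwarz inequality. -/
theorem sq_refPair_le
    (e : MvPolynomial (Fin 2) ℝ × (MvPolynomial (Fin 2) ℝ × MvPolynomial (Fin 2) ℝ)) :
    refPair hq hd e ^ 2 ≤ (∫ x in refSquare, (‖q x‖ ^ 2 + d x ^ 2))
      * ((∫ x in refSquare, (‖polyVec e.2 x‖ ^ 2 + polyVal e.1 x ^ 2)) + 1) := by
  set I := refPair hq hd e
  set X := ∫ x in refSquare, (‖q x‖ ^ 2 + d x ^ 2)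
  set Y := ∫ x in refSquare, (‖polyVec e.2 x‖ ^ 2 + polyVal e.1 x ^ 2)
  have hY : 0 ≤ Y := integral_nonneg fun x => by positivity
  have hX : IntegrableOn (fun x => ‖q x‖ ^ 2 + d x ^ 2) refSquare :=
    (hq.integrable_norm_pow two_ne_zero).add hd.integrable_sq
  have hYi : IntegrableOn (fun x => ‖polyVec e.2 x‖ ^ 2 + polyVal e.1 x ^ 2) refSquare := by
    have := continuous_polyVec e.2
    have := continuous_polyVal e.1
    exact integrableOn_refSquare (by fun_prop)
  have hI := integrableOn_refPair hq hd e
  have key : ∀ s : ℝ, 0 ≤ X - 2 * s * I + s ^ 2 * Y := by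
    intro s
    have h0 : 0 ≤ ∫ x in refSquare, (‖q x - s • polyVec e.2 x‖ ^ 2
        + (d x - s * polyVal e.1 x) ^ 2) := integral_nonneg fun x => by positivity
    have e1 : ∀ x, ‖q x - s • polyVec e.2 x‖ ^ 2 + (d x - s * polyVal e.1 x) ^ 2
        = ((‖q x‖ ^ 2 + d x ^ 2)
          - 2 * s * (inner ℝ (polyVec e.2 x) (q x) + d x * polyVal e.1 x))
          + s ^ 2 * (‖polyVec e.2 x‖ ^ 2 + polyVal e.1 x ^ 2) := by
      intro x
      rw [norm_sub_sq_real, real_inner_smul_right, norm_smul, mul_pow, Real.norm_eq_abs, sq_abs,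
        real_inner_comm]
      ring
    simp only [e1] at h0
    have hXI : IntegrableOn (fun x => (‖q x‖ ^ 2 + d x ^ 2)
        - 2 * s * (inner ℝ (polyVec e.2 x) (q x) + d x * polyVal e.1 x)) refSquare :=
      hX.sub (hI.const_mul _)
    rwa [integral_add hXI (hYi.const_mul _), integral_sub hX (hI.const_mul _),
      integral_const_mul, integral_const_mul] at h0
  -- The quadratic is minimal at `I / Y`; shifting the denominator avoids the case `Y = 0` at the
  -- price of the `+ 1` in the bound.
  have h1 := key (I / (Y + 1))
  have hY1 : 0 < Y + 1 := by linarith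
  have e2 : X - 2 * (I / (Y + 1)) * I + (I / (Y + 1)) ^ 2 * Y
      = X - I ^ 2 / (Y + 1) - I ^ 2 / (Y + 1) ^ 2 := by
    field_simp; ring
  rw [e2] at h1
  have h2 : 0 ≤ I ^ 2 / (Y + 1) ^ 2 := by positivity
  have h3 : I ^ 2 / (Y + 1) ≤ X := by linarith
  rwa [div_le_iff₀ hY1] at h3

end refPair

theorem memLp_refSquare {E : Type*} [NormedAddCommGroup E] {f : Plane → E} (hf : Continuous f) :
    MemLp f 2 (volume.restrict refSquare) := by
  have hfin : IsFiniteMeasure (volume.restrict refSquare) :=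
    ⟨by
      rw [Measure.restrict_apply_univ]
      exact (measure_mono refSquare_subset_closedSquare).trans_lt
        isCompact_closedSquare.measure_lt_top⟩
  obtain ⟨C, hC⟩ := isCompact_closedSquare.exists_bound_of_continuousOn hf.continuousOn
  refine MemLp.of_bound (integrableOn_refSquare hf).aestronglyMeasurable C ?_
  filter_upwards [ae_restrict_mem isOpen_refSquare.measurableSet] with x hx
  exact hC x (refSquare_subset_closedSquare hx)

/-- The functional tested by a polynomial field and its divergence. -/
def polyPair (Q : MvPolynomial (Fin 2) ℝ × MvPolynomial (Fin 2) ℝ) :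
    MvPolynomial (Fin 2) ℝ × (MvPolynomial (Fin 2) ℝ × MvPolynomial (Fin 2) ℝ) →ₗ[ℝ] ℝ :=
  refPair (memLp_refSquare (continuous_polyVec Q)) (memLp_refSquare (continuous_polyVal (polyDiv Q)))

theorem polyPair_add (P Q : MvPolynomial (Fin 2) ℝ × MvPolynomial (Fin 2) ℝ) :
    polyPair (P + Q) = polyPair P + polyPair Q := by
  refine LinearMap.ext fun e => ?_
  simp only [polyPair, LinearMap.add_apply, refPair_apply]
  rw [← integral_add (integrableOn_refPair (memLp_refSquare (continuous_polyVec P))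
      (memLp_refSquare (continuous_polyVal (polyDiv P))) e)
    (integrableOn_refPair (memLp_refSquare (continuous_polyVec Q))
      (memLp_refSquare (continuous_polyVal (polyDiv Q))) e)]
  refine integral_congr_ae (Filter.Eventually.of_forall fun x => ?_)
  simp only [polyVec_add, map_add, polyVal_add, inner_add_right]
  ring

theorem polyPair_smul (c : ℝ) (P : MvPolynomial (Fin 2) ℝ × MvPolynomial (Fin 2) ℝ) :
    polyPair (c • P) = c • polyPair P := by
  refine LinearMap.ext fun e => ?_
  simp only [polyPair, LinearMap.smul_apply, refPair_apply, smul_eq_mul]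
  rw [← integral_const_mul]
  refine integral_congr_ae (Filter.Eventually.of_forall fun x => ?_)
  simp only [polyVec_smul, map_smul, polyVal_smul, real_inner_smul_right]
  ring

/-- `polyPair` as a map from the Raviart-Thomas space to the dual of the test space. -/
def rtPair (p : ℕ) : polyRT (p + 1) →ₗ[ℝ] Module.Dual ℝ (testSpace p) where
  toFun Q := (polyPair Q.1).comp (testSpace p).subtype
  map_add' P Q := by simp [polyPair_add, LinearMap.add_comp]
  map_smul' c P := by simp [polyPair_smul, LinearMap.smul_comp]

/-- Fields with one zero component decouple the coordinates, and the degrees just fit: `ζᵢ - ∂ᵢ v`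
has degree `p` in `xᵢ` and `v` has degree `p + 1`, while the `i`-th component of the Raviart-Thomas
field may have degree `p + 2` in `xᵢ` and `p + 1` in the other variable. -/
theorem testSpace_annihilator {p : ℕ}
    {e : MvPolynomial (Fin 2) ℝ × (MvPolynomial (Fin 2) ℝ × MvPolynomial (Fin 2) ℝ)}
    (he : e ∈ testSpace p) (h : ∀ Q ∈ polyRT (p + 1), polyPair Q e = 0) :
    (∀ᵐ x ∂(volume.restrict refSquare), ∀ u,
      inner ℝ (polyVec e.2 x) u = fderiv ℝ (polyVal e.1) x u) ∧ bdSq (polyVal e.1) = 0 := by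
  obtain ⟨v, ζ0, ζ1⟩ := e
  obtain ⟨hv, hζ0, hζ1⟩ := he
  simp only [SetLike.mem_coe] at hv hζ0 hζ1
  have hs0 : (1 - MvPolynomial.X 0 : MvPolynomial (Fin 2) ℝ) ∈ polyP 1 0 :=
    sub_mem (one_mem_polyP _ _) X_zero_mem_polyP
  have hs1 : (1 - MvPolynomial.X 1 : MvPolynomial (Fin 2) ℝ) ∈ polyP 0 1 :=
    sub_mem (one_mem_polyP _ _) X_one_mem_polyP
  obtain ⟨a0, b0⟩ := eq_pderiv_of_annihilates (i := 0) (Z := ζ0) (v := v) fun R hR => by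
    have hmem : R ∈ polyP (p + 1 + 1) (p + 1) := by
      rcases hR with rfl | rfl | rfl
      · exact mul_mem_polyP' (mul_mem_polyP X_zero_mem_polyP hs0)
          (sub_mem hζ0 (pderiv_zero_mem_polyP hv))
      · exact mul_mem_polyP' X_zero_mem_polyP hv
      · exact mul_mem_polyP' hs0 hv
    have := h (R, 0) ⟨hmem, zero_mem _⟩
    rw [polyPair, refPair_apply] at this
    simp only [inner_polyVec] at this
    simpa [polyVec, polyDiv_apply] using this
  obtain ⟨a1, b1⟩ := eq_pderiv_of_annihilates (i := 1) (Z := ζ1) (v := v) fun R hR => by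
    have hmem : R ∈ polyP (p + 1) (p + 1 + 1) := by
      rcases hR with rfl | rfl | rfl
      · exact mul_mem_polyP' (mul_mem_polyP X_one_mem_polyP hs1)
          (sub_mem hζ1 (pderiv_one_mem_polyP hv))
      · exact mul_mem_polyP' X_one_mem_polyP hv
      · exact mul_mem_polyP' hs1 hv
    have := h (0, R) ⟨zero_mem _, hmem⟩
    rw [polyPair, refPair_apply] at this
    simp only [inner_polyVec] at this
    simpa [polyVec, polyDiv_apply] using this
  refine ⟨?_, by rw [bdSq, b0, b1, add_zero]⟩
  filter_upwards [a0, a1] with x h0 h1 u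
  rw [inner_polyVec, fderiv_polyVal, h0, h1]

/-- The compatibility condition of the interpolation system: a pair invisible to all Raviart-Thomas
fields is `(v, ∇v)` with `v` zero on the boundary, and Green's formula applies to it. -/
theorem RefHDiv.refPair_eq_zero {q : Plane → Plane} {d : Plane → ℝ} (h : RefHDiv q d) {p : ℕ}
    {e : MvPolynomial (Fin 2) ℝ × (MvPolynomial (Fin 2) ℝ × MvPolynomial (Fin 2) ℝ)}
    (he : e ∈ testSpace p) (hann : ∀ Q ∈ polyRT (p + 1), polyPair Q e = 0) :
    refPair h.memLp h.memLp_div e = 0 := by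
  obtain ⟨h1, h2⟩ := testSpace_annihilator he hann
  rw [refPair_apply, ← h.green_eq_zero (contDiff_polyVal e.1) h2]
  refine integral_congr_ae ?_
  filter_upwards [h1] with x hx
  rw [hx]

/-- A right inverse on the range is extended arbitrarily to `W`. Being linear everywhere, it makes
the interpolant linear in the data although `f` may fail to be injective or surjective. -/
theorem exists_rightInverse_on_range {V W : Type*} [AddCommGroup V] [Module ℝ V] [AddCommGroup W]
    [Module ℝ W] (f : V →ₗ[ℝ] W) : ∃ B : W →ₗ[ℝ] V, ∀ w ∈ LinearMap.range f, f (B w) = w := by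
  obtain ⟨B₀, hB₀⟩ := f.rangeRestrict.exists_rightInverse_of_surjective
    (LinearMap.range_rangeRestrict _)
  obtain ⟨B, hB⟩ := B₀.exists_extend
  refine ⟨B, fun w hw => ?_⟩
  have h1 : B w = B₀ ⟨w, hw⟩ := by rw [← hB]; rfl
  rw [h1]
  exact congrArg Subtype.val (LinearMap.congr_fun hB₀ ⟨w, hw⟩)

/-- In finite dimensions the range of `rtPair` is the annihilator of its coannihilator, so `ℓ` is
attained once it vanishes on the test pairs that all Raviart-Thomas fields annihilate. The choice of
`B` involves no element `K`. -/
theorem exists_interpolation (p : ℕ) :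
    ∃ B : Module.Dual ℝ (testSpace p) →ₗ[ℝ] polyRT (p + 1),
      ∀ ℓ : Module.Dual ℝ (testSpace p),
        (∀ e : testSpace p, (∀ Q ∈ polyRT (p + 1), polyPair Q e.1 = 0) → ℓ e = 0) →
        rtPair p (B ℓ) = ℓ := by
  obtain ⟨B, hB⟩ := exists_rightInverse_on_range (rtPair p)
  refine ⟨B, fun ℓ hℓ => hB ℓ ?_⟩
  rw [← Subspace.dualCoannihilator_dualAnnihilator_eq (W := LinearMap.range (rtPair p)),
    Submodule.mem_dualAnnihilator]
  intro e he
  rw [Submodule.mem_dualCoannihilator] at he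
  exact hℓ e fun Q hQ => he _ ⟨⟨Q, hQ⟩, rfl⟩

/-- In the dual basis the interpolant is a combination of the fixed fields `R j`, with coefficients
controlled by Cauchy-Schwarz; hence the constant depends on `B` alone. -/
theorem exists_interpolation_bound {p : ℕ} (B : Module.Dual ℝ (testSpace p) →ₗ[ℝ] polyRT (p + 1)) :
    ∃ C : ℝ, 0 ≤ C ∧ ∀ (q : Plane → Plane) (d : Plane → ℝ)
      (hq : MemLp q 2 (volume.restrict refSquare)) (hd : MemLp d 2 (volume.restrict refSquare)),
      ∫ x in refSquare, ‖polyVec (B ((refPair hq hd).comp (testSpace p).subtype)).1 x‖ ^ 2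
        ≤ C * ∫ x in refSquare, (‖q x‖ ^ 2 + d x ^ 2) := by
  let b := Module.finBasis ℝ (testSpace p)
  let n := Module.finrank ℝ (testSpace p)
  let R : Fin n → MvPolynomial (Fin 2) ℝ × MvPolynomial (Fin 2) ℝ := fun j => (B (b.coord j)).1
  let N : Fin n → ℝ := fun j => ∫ x in refSquare, ‖polyVec (R j) x‖ ^ 2
  let Y : Fin n → ℝ := fun j =>
    (∫ x in refSquare, (‖polyVec (b j).1.2 x‖ ^ 2 + polyVal (b j).1.1 x ^ 2)) + 1
  have hN : ∀ j, 0 ≤ N j := fun j => integral_nonneg fun x => by positivity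
  have hY : ∀ j, 0 ≤ Y j := fun j =>
    add_nonneg (integral_nonneg fun x => by positivity) zero_le_one
  refine ⟨n * ∑ j, Y j * N j, mul_nonneg (Nat.cast_nonneg _)
    (Finset.sum_nonneg fun j _ => mul_nonneg (hY j) (hN j)), fun q d hq hd => ?_⟩
  set ℓ : Module.Dual ℝ (testSpace p) := (refPair hq hd).comp (testSpace p).subtype
  set X := ∫ x in refSquare, (‖q x‖ ^ 2 + d x ^ 2)
  have hℓ : ℓ = ∑ j, ℓ (b j) • b.coord j := by
    refine b.ext fun k => ?_
    simp
  have hvec : ∀ x, polyVec (B ℓ).1 x = ∑ j, ℓ (b j) • polyVec (R j) x := by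
    intro x
    have hB : (B ℓ).1 = ∑ j, ℓ (b j) • R j := by
      conv_lhs => rw [hℓ]
      rw [map_sum, Submodule.coe_sum]
      simp only [map_smul, Submodule.coe_smul, R]
    rw [hB]
    let ev : (MvPolynomial (Fin 2) ℝ × MvPolynomial (Fin 2) ℝ) →ₗ[ℝ] Plane :=
      { toFun := fun Q => polyVec Q x
        map_add' := fun P Q => polyVec_add P Q x
        map_smul' := fun c P => polyVec_smul c P x }
    change ev _ = ∑ j, ℓ (b j) • ev (R j)
    simp only [map_sum, map_smul]
  have hcont : ∀ j, Continuous fun x => polyVec (R j) x := fun j => continuous_polyVec _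
  have hpt : ∀ x, ‖polyVec (B ℓ).1 x‖ ^ 2 ≤ n * ∑ j, ℓ (b j) ^ 2 * ‖polyVec (R j) x‖ ^ 2 := by
    intro x
    rw [hvec]
    calc _ ≤ (∑ j, ‖ℓ (b j) • polyVec (R j) x‖) ^ 2 :=
          pow_le_pow_left₀ (norm_nonneg _) (norm_sum_le _ _) 2
      _ ≤ (Finset.univ : Finset (Fin n)).card * ∑ j, ‖ℓ (b j) • polyVec (R j) x‖ ^ 2 :=
          sq_sum_le_card_mul_sum_sq
      _ = _ := by
          simp [norm_smul, mul_pow]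
  have hint : ∀ j, IntegrableOn (fun x => ℓ (b j) ^ 2 * ‖polyVec (R j) x‖ ^ 2) refSquare :=
    fun j => integrableOn_refSquare (((hcont j).norm.pow 2).const_mul _)
  have hlhs : IntegrableOn (fun x => ‖polyVec (B ℓ).1 x‖ ^ 2) refSquare :=
    integrableOn_refSquare ((continuous_polyVec _).norm.pow 2)
  calc _ ≤ ∫ x in refSquare, n * ∑ j, ℓ (b j) ^ 2 * ‖polyVec (R j) x‖ ^ 2 :=
        integral_mono hlhs ((integrable_finsetSum _ fun j _ => hint j).const_mul _) hpt
    _ = n * ∑ j, ℓ (b j) ^ 2 * N j := by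
        rw [integral_const_mul, integral_finsetSum _ fun j _ => hint j]
        simp only [integral_const_mul, N]
    _ ≤ n * ∑ j, X * Y j * N j := by
        refine mul_le_mul_of_nonneg_left (Finset.sum_le_sum fun j _ => ?_) (Nat.cast_nonneg _)
        exact mul_le_mul_of_nonneg_right (sq_refPair_le hq hd (b j).1) (hN j)
    _ = _ := by
        rw [mul_assoc, Finset.sum_mul]
        congr 1
        exact Finset.sum_congr rfl fun j _ => by ring

/-- The divergence of an interpolant is an `L²` projection of the given divergence. -/
theorem integral_sq_polyDiv_le {p : ℕ} {q : Plane → Plane} {d : Plane → ℝ}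
    (hq : MemLp q 2 (volume.restrict refSquare)) (hd : MemLp d 2 (volume.restrict refSquare))
    {Q : MvPolynomial (Fin 2) ℝ × MvPolynomial (Fin 2) ℝ} (hQ : Q ∈ polyRT (p + 1))
    (h : ∀ e ∈ testSpace p, polyPair Q e = refPair hq hd e) :
    ∫ x in refSquare, polyVal (polyDiv Q) x ^ 2 ≤ ∫ x in refSquare, d x ^ 2 := by
  -- The divergence of a field in RT_{p+1} lies in Q_{p+1}, so it is itself an admissible test
  -- function.
  have h1 := h (polyDiv Q, 0) ⟨polyDiv_mem hQ, zero_mem _⟩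
  have hc := continuous_polyVal (polyDiv Q)
  rw [polyPair, refPair_apply, refPair_apply] at h1
  simp only [polyVec_zero, inner_zero_left, zero_add] at h1
  have i1 : IntegrableOn (fun x => polyVal (polyDiv Q) x ^ 2) refSquare :=
    integrableOn_refSquare (by fun_prop)
  have i2 : IntegrableOn (fun x => d x ^ 2) refSquare := hd.integrable_sq
  have i3 : IntegrableOn (fun x => d x * polyVal (polyDiv Q) x) refSquare :=
    hd.integrable_mul (memLp_refSquare hc)
  have h2 : ∫ x in refSquare, d x * polyVal (polyDiv Q) x
      ≤ ∫ x in refSquare, (d x ^ 2 + polyVal (polyDiv Q) x ^ 2) / 2 :=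
    integral_mono i3 ((i2.add i1).div_const 2) fun x => by
      simp only; nlinarith [sq_nonneg (d x - polyVal (polyDiv Q) x)]
  rw [integral_div, integral_add i2 i1, ← h1] at h2
  simp only [← pow_two] at h2
  linarith

/-! ### Geometry of convex quadrilaterals -/

theorem sq_cross (a b : Plane) : cross a b ^ 2 = ‖a‖ ^ 2 * ‖b‖ ^ 2 - inner ℝ a b ^ 2 := by
  rw [EuclideanSpace.norm_sq_eq, EuclideanSpace.norm_sq_eq]
  simp only [cross, PiLp.inner_apply, Fin.sum_univ_two, Real.norm_eq_abs, sq_abs,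
    RCLike.inner_apply, conj_trivial]
  ring

theorem abs_cross_le (a b : Plane) : |cross a b| ≤ ‖a‖ * ‖b‖ := by
  refine abs_le_of_sq_le_sq ?_ (by positivity)
  rw [sq_cross, mul_pow]
  linarith [sq_nonneg (inner ℝ a b)]

theorem continuous_cross {X : Type*} [TopologicalSpace X] {f g : X → Plane} (hf : Continuous f)
    (hg : Continuous g) : Continuous fun x => cross (f x) (g x) := by
  unfold cross
  fun_prop

/-- The sine is at least `sin θ` on `[θ, π - θ]`, and a positive cross product of consecutive edges
equals the sine of the interior angle times both lengths. -/
theorem sin_angle_mul_le_cross {a b c : Plane} {θ : ℝ} (hθ : 0 < θ)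
    (h : EuclideanGeometry.angle a b c ∈ Set.Icc θ (Real.pi - θ))
    (hpos : 0 < cross (b - a) (c - b)) :
    Real.sin θ * (dist a b * dist b c) ≤ cross (b - a) (c - b) := by
  have hsin : Real.sin θ ≤ Real.sin (EuclideanGeometry.angle a b c) := by
    rcases le_total (EuclideanGeometry.angle a b c) (Real.pi / 2) with h1 | h1
    · exact Real.sin_le_sin_of_le_of_le_pi_div_two (by linarith [Real.pi_pos]) h1 h.1
    · rw [← Real.sin_pi_sub (EuclideanGeometry.angle a b c)]
      exact Real.sin_le_sin_of_le_of_le_pi_div_two (by linarith [Real.pi_pos])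
        (by linarith) (by linarith [h.2])
  have h2 := InnerProductGeometry.sin_angle_mul_norm_mul_norm (a - b) (c - b)
  have h3 : inner ℝ (a - b) (a - b) * inner ℝ (c - b) (c - b)
      - inner ℝ (a - b) (c - b) * inner ℝ (a - b) (c - b) = cross (b - a) (c - b) ^ 2 := by
    have e : cross (b - a) (c - b) ^ 2 = cross (a - b) (c - b) ^ 2 := by
      simp only [cross, PiLp.sub_apply]; ring
    rw [e, sq_cross, real_inner_self_eq_norm_sq, real_inner_self_eq_norm_sq]
    ring
  rw [h3, Real.sqrt_sq hpos.le] at h2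
  rw [← h2, dist_eq_norm, dist_comm, dist_eq_norm]
  refine mul_le_mul_of_nonneg_right ?_ (by positivity)
  simpa [EuclideanGeometry.angle] using hsin

theorem closedSquare_subset_closure : closedSquare ⊆ closure refSquare := by
  intro x hx
  let c : Plane := WithLp.toLp 2 fun _ => 1 / 2
  have ht : Filter.Tendsto (fun t : ℝ => (1 - t) • x + t • c) (nhdsWithin 0 (Set.Ioi 0)) (nhds x) := by
    have h : Continuous fun t : ℝ => (1 - t) • x + t • c := by fun_prop
    have h0 := h.tendsto 0
    simp only [sub_zero, one_smul, zero_smul, add_zero] at h0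
    exact h0.mono_left nhdsWithin_le_nhds
  refine mem_closure_of_tendsto ht ?_
  filter_upwards [Ioo_mem_nhdsGT (zero_lt_one (α := ℝ))] with t ht i
  have hi := hx i
  have h1 : ((1 - t) • x + t • c) i = (1 - t) * x i + t * (1 / 2) := by simp [c]
  rw [h1]
  have := mul_nonneg (sub_nonneg.2 ht.2.le) hi.1
  have := mul_nonneg (sub_nonneg.2 ht.2.le) (sub_nonneg.2 hi.2)
  constructor <;> nlinarith [ht.1, ht.2]

namespace ConvexQuad

variable (K : ConvexQuad)

/-- The first column of the Jacobian matrix of `F_K`. -/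
def col0 (x : Plane) : Plane :=
  (1 - x 1) • (K.vertex 1 - K.vertex 0) + x 1 • (K.vertex 2 - K.vertex 3)

/-- The second column of the Jacobian matrix of `F_K`. -/
def col1 (x : Plane) : Plane :=
  (1 - x 0) • (K.vertex 3 - K.vertex 0) + x 0 • (K.vertex 2 - K.vertex 1)

/-- The Jacobian determinant of `F_K`. -/
def jac (x : Plane) : ℝ := cross (K.col0 x) (K.col1 x)

theorem continuous_col0 : Continuous K.col0 := by unfold col0; fun_prop

theorem continuous_col1 : Continuous K.col1 := by unfold col1; fun_prop

theorem continuous_jac : Continuous K.jac := continuous_cross K.continuous_col0 K.continuous_col1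

theorem contDiff_map {n : WithTop ℕ∞} : ContDiff ℝ n K.map := by unfold map; fun_prop

theorem hasFDerivAt_map (x : Plane) :
    HasFDerivAt K.map ((EuclideanSpace.proj (𝕜 := ℝ) (0 : Fin 2)).smulRight (K.col0 x)
      + (EuclideanSpace.proj (𝕜 := ℝ) (1 : Fin 2)).smulRight (K.col1 x)) x := by
  have h0 : HasFDerivAt (fun x : Plane => x 0) (EuclideanSpace.proj (𝕜 := ℝ) (0 : Fin 2)) x :=
    (EuclideanSpace.proj (𝕜 := ℝ) (0 : Fin 2)).hasFDerivAt
  have h1 : HasFDerivAt (fun x : Plane => x 1) (EuclideanSpace.proj (𝕜 := ℝ) (1 : Fin 2)) x :=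
    (EuclideanSpace.proj (𝕜 := ℝ) (1 : Fin 2)).hasFDerivAt
  refine ((((((h0.const_sub 1).mul (h1.const_sub 1)).smul_const (K.vertex 0)).add
    ((h0.mul (h1.const_sub 1)).smul_const (K.vertex 1))).add
    ((h0.mul h1).smul_const (K.vertex 2))).add
    (((h0.const_sub 1).mul h1).smul_const (K.vertex 3))).congr_fderiv ?_
  ext u i
  simp [col0, col1]
  ring

theorem fderiv_map (x u : Plane) : fderiv ℝ K.map x u = u 0 • K.col0 x + u 1 • K.col1 x := by
  rw [(K.hasFDerivAt_map x).fderiv]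
  simp

theorem det_fderiv_map (x : Plane) : (fderiv ℝ K.map x).det = K.jac x := by
  have h := LinearMap.det_toMatrix (EuclideanSpace.basisFun (Fin 2) ℝ).toBasis
    (fderiv ℝ K.map x : Plane →ₗ[ℝ] Plane)
  rw [ContinuousLinearMap.det, ← h, Matrix.det_fin_two]
  simp only [LinearMap.toMatrix_apply, OrthonormalBasis.coe_toBasis, EuclideanSpace.basisFun_apply,
    ContinuousLinearMap.coe_coe, fderiv_map, OrthonormalBasis.coe_toBasis_repr_apply,
    EuclideanSpace.basisFun_repr, jac, cross]
  simp
  ring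

/-- For a bilinear map the midpoint rule is exact: the increment is the derivative at the midpoint
applied to `x - y`. With convexity of the square, injectivity reduces to positivity of the Jacobian.
-/
theorem map_sub_map (x y : Plane) :
    K.map x - K.map y = (x 0 - y 0) • K.col0 ((1 / 2 : ℝ) • (x + y))
      + (x 1 - y 1) • K.col1 ((1 / 2 : ℝ) • (x + y)) := by
  ext i
  simp [map, col0, col1]
  ring

/-- The mixed terms of the determinant cancel, so it is affine and interpolates its corner values,
the cross products of the edges meeting there. A lower bound at the corners is thus a lower bound on
the square. -/
theorem jac_eq (x : Plane) : K.jac x =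
    (1 - x 0) * (1 - x 1) * cross (K.vertex 0 - K.vertex 3) (K.vertex 1 - K.vertex 0)
      + x 0 * (1 - x 1) * cross (K.vertex 1 - K.vertex 0) (K.vertex 2 - K.vertex 1)
      + x 0 * x 1 * cross (K.vertex 2 - K.vertex 1) (K.vertex 3 - K.vertex 2)
      + (1 - x 0) * x 1 * cross (K.vertex 3 - K.vertex 2) (K.vertex 0 - K.vertex 3) := by
  simp [jac, cross, col0, col1]
  ring

theorem le_jac {m : ℝ} (hm : ∀ i, m ≤ cross (K.vertex (i + 1) - K.vertex i)
    (K.vertex (i + 2) - K.vertex (i + 1))) {x : Plane} (hx : x ∈ closedSquare) : m ≤ K.jac x := by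
  have h0 : m ≤ cross (K.vertex 1 - K.vertex 0) (K.vertex 2 - K.vertex 1) := hm 0
  have h1 : m ≤ cross (K.vertex 2 - K.vertex 1) (K.vertex 3 - K.vertex 2) := hm 1
  have h2 : m ≤ cross (K.vertex 3 - K.vertex 2) (K.vertex 0 - K.vertex 3) := hm 2
  have h3 : m ≤ cross (K.vertex 0 - K.vertex 3) (K.vertex 1 - K.vertex 0) := hm 3
  have a0 := (hx 0).1
  have a1 := (hx 1).1
  have b0 := sub_nonneg.2 (hx 0).2
  have b1 := sub_nonneg.2 (hx 1).2
  rw [jac_eq]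
  have := mul_le_mul_of_nonneg_left h3 (mul_nonneg b0 b1)
  have := mul_le_mul_of_nonneg_left h0 (mul_nonneg a0 b1)
  have := mul_le_mul_of_nonneg_left h1 (mul_nonneg a0 a1)
  have := mul_le_mul_of_nonneg_left h2 (mul_nonneg b0 a1)
  linarith

theorem exists_jac_lower : ∃ m : ℝ, 0 < m ∧ ∀ x ∈ closedSquare, m ≤ K.jac x := by
  obtain ⟨i, hi⟩ := Finite.exists_min fun i => cross (K.vertex (i + 1) - K.vertex i)
    (K.vertex (i + 2) - K.vertex (i + 1))
  exact ⟨_, K.left_turn i, fun x hx => K.le_jac hi hx⟩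

theorem jac_pos {x : Plane} (hx : x ∈ closedSquare) : 0 < K.jac x := by
  obtain ⟨m, hm, h⟩ := K.exists_jac_lower
  exact hm.trans_le (h x hx)

theorem injOn_map : Set.InjOn K.map closedSquare := by
  intro x hx y hy hxy
  have h := K.map_sub_map x y
  rw [hxy, sub_self] at h
  have hmid : (1 / 2 : ℝ) • (x + y) ∈ closedSquare := by
    intro i
    have h1 := hx i
    have h2 := hy i
    have e : ((1 / 2 : ℝ) • (x + y)) i = 1 / 2 * (x i + y i) := by simp; ring
    rw [e]
    constructor <;> linarith
  have hj := K.jac_pos hmid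
  rw [jac] at hj
  set a := K.col0 ((1 / 2 : ℝ) • (x + y))
  set b := K.col1 ((1 / 2 : ℝ) • (x + y))
  have e0 : 0 = (x 0 - y 0) * a 0 + (x 1 - y 1) * b 0 := by
    simpa using congrArg (fun z : Plane => z 0) h
  have e1 : 0 = (x 0 - y 0) * a 1 + (x 1 - y 1) * b 1 := by
    simpa using congrArg (fun z : Plane => z 1) h
  have f0 : (x 0 - y 0) * cross a b = 0 := by
    simp only [cross]; linear_combination b 0 * e1 - b 1 * e0
  have f1 : (x 1 - y 1) * cross a b = 0 := by
    simp only [cross]; linear_combination a 1 * e0 - a 0 * e1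
  have g0 := (mul_eq_zero.1 f0).resolve_right hj.ne'
  have g1 := (mul_eq_zero.1 f1).resolve_right hj.ne'
  ext i
  fin_cases i
  exacts [sub_eq_zero.1 g0, sub_eq_zero.1 g1]

theorem injOn_map_refSquare : Set.InjOn K.map refSquare :=
  K.injOn_map.mono refSquare_subset_closedSquare

theorem invMap_map {x : Plane} (hx : x ∈ refSquare) : K.invMap (K.map x) = x :=
  K.injOn_map_refSquare.leftInvOn_invFunOn hx

theorem continuous_map : Continuous K.map := (K.contDiff_map (n := 0)).continuous

/-- The derivative of `F_K` as a linear equivalence. -/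
def fderivEquiv {x : Plane} (hx : x ∈ closedSquare) : Plane ≃L[ℝ] Plane :=
  (fderiv ℝ K.map x).toContinuousLinearEquivOfDetNeZero
    (by rw [det_fderiv_map]; exact (K.jac_pos hx).ne')

theorem hasStrictFDerivAt_map {x : Plane} (hx : x ∈ closedSquare) :
    HasStrictFDerivAt K.map (K.fderivEquiv hx : Plane →L[ℝ] Plane) x := by
  have h := (K.contDiff_map (n := 1)).contDiffAt.hasStrictFDerivAt (x := x) one_ne_zero
  exact h

theorem isOpen_carrier : IsOpen K.carrier := by
  rw [isOpen_iff_mem_nhds]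
  rintro _ ⟨x, hx, rfl⟩
  rw [← (K.hasStrictFDerivAt_map (refSquare_subset_closedSquare hx)).map_nhds_eq_of_equiv]
  exact Filter.image_mem_map (isOpen_refSquare.mem_nhds hx)

theorem contDiffAt_invMap {n : WithTop ℕ∞} (hn : n ≠ 0) {x : Plane} (hx : x ∈ refSquare) :
    ContDiffAt ℝ n K.invMap (K.map x) := by
  have hs := K.hasStrictFDerivAt_map (refSquare_subset_closedSquare hx)
  have hc : ContDiffAt ℝ n K.map x := K.contDiff_map.contDiffAt
  have h := hc.to_localInverse hs.hasFDerivAt hn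
  refine h.congr_of_eventuallyEq ?_
  have h1 := h.continuousAt
  have h2 := hs.eventually_right_inverse
  have h3 : hc.localInverse hs.hasFDerivAt hn (K.map x)
      = x := hs.localInverse_apply_image
  have h4 : ∀ᶠ y in nhds (K.map x),
      hc.localInverse hs.hasFDerivAt hn y
        ∈ refSquare := by
    refine h1.eventually_mem ?_
    rw [h3]
    exact isOpen_refSquare.mem_nhds hx
  filter_upwards [h2, h4] with y hy hy'
  have := K.invMap_map hy'
  rw [← this]
  congr 1
  exact hy.symm

theorem invMap_mem {y : Plane} (hy : y ∈ K.carrier) : K.invMap y ∈ refSquare := by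
  obtain ⟨x, hx, rfl⟩ := hy
  rwa [K.invMap_map hx]

theorem continuousOn_invMap : ContinuousOn K.invMap K.carrier := by
  rintro _ ⟨x, hx, rfl⟩
  exact (K.contDiffAt_invMap one_ne_zero hx).continuousAt.continuousWithinAt

theorem measurableSet_carrier : MeasurableSet K.carrier := K.isOpen_carrier.measurableSet

theorem carrier_subset : K.carrier ⊆ K.map '' closedSquare :=
  Set.image_mono refSquare_subset_closedSquare

theorem isCompact_image_closedSquare : IsCompact (K.map '' closedSquare) :=
  isCompact_closedSquare.image K.continuous_map

instance isFiniteMeasure_carrier : IsFiniteMeasure (volume.restrict K.carrier) :=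
  ⟨by
    rw [Measure.restrict_apply_univ]
    exact (measure_mono K.carrier_subset).trans_lt K.isCompact_image_closedSquare.measure_lt_top⟩

theorem dist_vertex_le_diam : dist (K.vertex 0) (K.vertex 1) ≤ K.diam := by
  have hb : Bornology.IsBounded K.carrier :=
    K.isCompact_image_closedSquare.isBounded.subset K.carrier_subset
  have hmem : ∀ x ∈ closedSquare, K.map x ∈ closure K.carrier := fun x hx =>
    image_closure_subset_closure_image K.continuous_map
      (Set.mem_image_of_mem _ (closedSquare_subset_closure hx))
  have h0 : K.vertex 0 = K.map (pt 0 0 0) := by simp [map, pt]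
  have h1 : K.vertex 1 = K.map (pt 0 1 0) := by simp [map, pt]
  rw [diam, ← Metric.diam_closure, h0, h1]
  refine Metric.dist_le_diam_of_mem hb.closure (hmem _ fun i => ?_) (hmem _ fun i => ?_)
  · fin_cases i <;> simp [pt]
  · fin_cases i <;> simp [pt]

/-- The scaled bounds for the Jacobian of `F_K` on a shape regular family. -/
theorem ShapeRegular.exists_scale {K : ConvexQuad} {θ σ L : ℝ} (hθ : 0 < θ)
    (h : K.ShapeRegular θ σ) (hL : K.diam ≤ L) :
    0 < Real.sin θ ∧ ∃ ℓ m : ℝ, 0 < ℓ ∧ 0 < m ∧ (∀ x ∈ closedSquare, ‖K.col0 x‖ ≤ ℓ ∧ ‖K.col1 x‖ ≤ ℓ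
      ∧ m ≤ K.jac x) ∧ ℓ ^ 2 ≤ σ ^ 4 / Real.sin θ * m ∧ ℓ ^ 2 ≤ (σ * L) ^ 2 := by
  -- The existence of an admissible element makes the angle interval nonempty, which gives `θ ≤ π /
  -- 2`.
  have hπ : θ ≤ Real.pi - θ := (h.1 0).1.trans (h.1 0).2
  have hsin : 0 < Real.sin θ := Real.sin_pos_of_pos_of_lt_pi hθ (by linarith [Real.pi_pos])
  refine ⟨hsin, ?_⟩
  set d := dist (K.vertex 0) (K.vertex 1)
  have hd : 0 < d := by
    rw [dist_pos]
    intro heq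
    have h0 : 0 < cross (K.vertex 1 - K.vertex 0) (K.vertex 2 - K.vertex 1) := K.left_turn 0
    rw [heq] at h0
    simp [cross] at h0
  have hσ : 1 ≤ σ := by
    have h00 := h.2 0 0
    change d ≤ σ * d at h00
    by_contra! hlt
    nlinarith
  have hup : ∀ i, dist (K.vertex i) (K.vertex (i + 1)) ≤ σ * d := fun i => h.2 i 0
  have hlow : ∀ i, d / σ ≤ dist (K.vertex i) (K.vertex (i + 1)) := fun i => by
    rw [div_le_iff₀ (by linarith), mul_comm]
    exact h.2 0 i
  have hcomb : ∀ (s : ℝ) (a b : Plane), 0 ≤ s → s ≤ 1 → ‖a‖ ≤ σ * d → ‖b‖ ≤ σ * d →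
      ‖(1 - s) • a + s • b‖ ≤ σ * d := by
    intro s a b hs hs' ha hb
    refine (norm_add_le _ _).trans ?_
    rw [norm_smul, norm_smul, Real.norm_of_nonneg hs, Real.norm_of_nonneg (sub_nonneg.2 hs')]
    nlinarith [mul_le_mul_of_nonneg_left ha (sub_nonneg.2 hs'), mul_le_mul_of_nonneg_left hb hs]
  have n0 : ‖K.vertex 1 - K.vertex 0‖ ≤ σ * d := by
    rw [← dist_eq_norm, dist_comm]; exact hup 0
  have n1 : ‖K.vertex 2 - K.vertex 1‖ ≤ σ * d := by
    rw [← dist_eq_norm, dist_comm]; exact hup 1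
  have n2 : ‖K.vertex 2 - K.vertex 3‖ ≤ σ * d := by rw [← dist_eq_norm]; exact hup 2
  have n3 : ‖K.vertex 3 - K.vertex 0‖ ≤ σ * d := by rw [← dist_eq_norm]; exact hup 3
  -- All sides have length between `d / σ` and `σ * d`. The Jacobian columns are convex combinations
  -- of opposite sides, and each corner Jacobian is at least `sin θ` times a product of two sides.
  refine ⟨σ * d, Real.sin θ * (d / σ) ^ 2, by positivity, by positivity,
    fun x hx => ⟨?_, ?_, ?_⟩, ?_, ?_⟩
  · exact hcomb _ _ _ (hx 1).1 (hx 1).2 n0 n2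
  · exact hcomb _ _ _ (hx 0).1 (hx 0).2 n3 n1
  · refine K.le_jac (fun i => ?_) hx
    refine le_trans ?_ (sin_angle_mul_le_cross hθ (h.1 i) (K.left_turn i))
    have e : i + 2 = i + 1 + 1 := by rw [add_assoc]; rfl
    rw [pow_two, e]
    exact mul_le_mul_of_nonneg_left (mul_le_mul (hlow i) (hlow (i + 1)) (by positivity)
      dist_nonneg) hsin.le
  · have : σ ^ 4 / Real.sin θ * (Real.sin θ * (d / σ) ^ 2) = (σ * d) ^ 2 := by
      field_simp
    rw [this]
  · have hdL : d ≤ L := K.dist_vertex_le_diam.trans hL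
    have : σ * d ≤ σ * L := mul_le_mul_of_nonneg_left hdL (by linarith)
    exact pow_le_pow_left₀ (by positivity) this 2

/-! ### Change of variables -/

theorem integral_carrier (f : Plane → ℝ) :
    ∫ y in K.carrier, f y = ∫ x in refSquare, K.jac x * f (K.map x) := by
  rw [carrier, integral_image_eq_integral_abs_det_fderiv_smul volume isOpen_refSquare.measurableSet
    (fun x _ => (K.contDiff_map.differentiable one_ne_zero x).hasFDerivAt.hasFDerivWithinAt)
    K.injOn_map_refSquare]
  refine setIntegral_congr_fun isOpen_refSquare.measurableSet fun x hx => ?_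
  simp only [det_fderiv_map, smul_eq_mul]
  rw [abs_of_pos (K.jac_pos (refSquare_subset_closedSquare hx))]

theorem integrableOn_carrier_iff (f : Plane → ℝ) :
    IntegrableOn f K.carrier ↔ IntegrableOn (fun x => K.jac x * f (K.map x)) refSquare := by
  rw [carrier, integrableOn_image_iff_integrableOn_abs_det_fderiv_smul volume
    isOpen_refSquare.measurableSet
    (fun x _ => (K.contDiff_map.differentiable one_ne_zero x).hasFDerivAt.hasFDerivWithinAt)
    K.injOn_map_refSquare]
  refine integrableOn_congr_fun (fun x hx => ?_) isOpen_refSquare.measurableSet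
  simp only [det_fderiv_map, smul_eq_mul]
  rw [abs_of_pos (K.jac_pos (refSquare_subset_closedSquare hx))]

/-- Carries almost everywhere identities on `K`, such as those between `Lp` representatives, back to
the square. It holds because the Jacobian does not vanish. -/
theorem quasiMeasurePreserving_map :
    Measure.QuasiMeasurePreserving K.map (volume.restrict refSquare)
      (volume.restrict K.carrier) := by
  refine ⟨K.continuous_map.measurable, ?_⟩
  have h := map_withDensity_abs_det_fderiv_eq_addHaar (volume : Measure Plane)
    isOpen_refSquare.measurableSet.nullMeasurableSet
    (fun x _ => (K.contDiff_map.differentiable one_ne_zero x).hasFDerivAt.hasFDerivWithinAt)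
    K.injOn_map_refSquare
  rw [carrier, ← h]
  refine Measure.AbsolutelyContinuous.map ?_ K.continuous_map.measurable
  refine withDensity_absolutelyContinuous' ?_ ?_
  · simp only [det_fderiv_map]
    exact K.continuous_jac.abs.measurable.ennreal_ofReal.aemeasurable
  · filter_upwards [ae_restrict_mem isOpen_refSquare.measurableSet] with x hx
    rw [det_fderiv_map, ne_eq, ENNReal.ofReal_eq_zero, not_le, abs_pos]
    exact (K.jac_pos (refSquare_subset_closedSquare hx)).ne'

end ConvexQuad

/-! ### Mollification of test functions -/

-- Convolution with a bump whose radius is limited by the room around the support of `ψ` and by the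
-- uniform continuity of `ψ` and its derivative. It makes `C¹` functions admissible in the weak
-- divergence.
open Convolution in
theorem exists_isTest_close {U : Set Plane} (hU : IsOpen U) {ψ : Plane → ℝ} (hψ : ContDiff ℝ 1 ψ)
    (hc : HasCompactSupport ψ) (hs : tsupport ψ ⊆ U) {ε : ℝ} (hε : 0 < ε) :
    ∃ φ : Plane → ℝ, IsTest U φ ∧ ∀ x, |φ x - ψ x| ≤ ε ∧ ‖fderiv ℝ φ x - fderiv ℝ ψ x‖ ≤ ε := by
  obtain ⟨δ₀, hδ₀, hδU⟩ := IsCompact.exists_cthickening_subset_open hc hU hs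
  have hD : Continuous (fderiv ℝ ψ) := hψ.continuous_fderiv one_ne_zero
  have u1 := hc.uniformContinuous_of_continuous hψ.continuous
  have u2 := (hc.fderiv (𝕜 := ℝ)).uniformContinuous_of_continuous hD
  obtain ⟨δ₁, hδ₁, h1⟩ := Metric.uniformContinuous_iff.1 u1 ε hε
  obtain ⟨δ₂, hδ₂, h2⟩ := Metric.uniformContinuous_iff.1 u2 ε hε
  let δ := min δ₀ (min δ₁ δ₂)
  have hδ : 0 < δ := lt_min hδ₀ (lt_min hδ₁ hδ₂)
  let b : ContDiffBump (0 : Plane) := ⟨δ / 2, δ, half_pos hδ, half_lt_self hδ⟩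
  let η : Plane → ℝ := b.normed volume
  let L := ContinuousLinearMap.lsmul ℝ ℝ (E := ℝ)
  have hη : LocallyIntegrable η volume :=
    b.continuous_normed.locallyIntegrable
  have hderiv : ∀ x, HasFDerivAt (η ⋆[L, volume] ψ)
      ((η ⋆[ContinuousLinearMap.lsmul ℝ ℝ (E := Plane →L[ℝ] ℝ), volume] fderiv ℝ ψ) x) x := by
    intro x
    have h := hc.hasFDerivAt_convolution_right L hη hψ x
    have e : L.precompR Plane = ContinuousLinearMap.lsmul ℝ ℝ (E := Plane →L[ℝ] ℝ) := by
      ext c A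
      simp [L, ContinuousLinearMap.precompR]
    rwa [e] at h
  refine ⟨η ⋆[L, volume] ψ, ⟨?_, ?_, ?_⟩, fun x => ⟨?_, ?_⟩⟩
  · exact b.hasCompactSupport_normed.contDiff_convolution_left L b.contDiff_normed
      hψ.continuous.locallyIntegrable
  · exact b.hasCompactSupport_normed.convolution L hc
  · refine (closure_minimal ?_ Metric.isClosed_cthickening).trans hδU
    refine (support_convolution_subset L).trans ?_
    rintro _ ⟨y, hy, z, hz, rfl⟩
    rw [b.support_normed_eq, mem_ball_zero_iff] at hy
    refine Metric.mem_cthickening_of_dist_le _ z _ _ (subset_tsupport ψ hz) ?_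
    rw [dist_eq_norm, add_sub_cancel_right]
    exact hy.le.trans (min_le_left _ _)
  · refine b.dist_normed_convolution_le hψ.continuous.aestronglyMeasurable fun y hy => ?_
    exact (h1 (lt_of_lt_of_le hy ((min_le_right _ _).trans (min_le_left _ _)))).le
  · rw [(hderiv x).fderiv, ← dist_eq_norm]
    refine b.dist_normed_convolution_le hD.aestronglyMeasurable fun y hy => ?_
    exact (h2 (lt_of_lt_of_le hy ((min_le_right _ _).trans (min_le_right _ _)))).le

theorem inner_gradient (φ : Plane → ℝ) (x u : Plane) :
    inner ℝ u (gradient φ x) = fderiv ℝ φ x u := by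
  rw [real_inner_comm, gradient, InnerProductSpace.toDual_symm_apply]

namespace ConvexQuad

variable (K : ConvexQuad)

theorem integrable_clm_apply {A : Plane → Plane →L[ℝ] ℝ} (hA : Continuous A)
    (hAb : ∃ C, ∀ x, ‖A x‖ ≤ C) {w : Plane → ℝ} (hw : Continuous w) (hwb : ∃ C, ∀ x, |w x| ≤ C)
    (q : HDiv K.carrier) :
    IntegrableOn (fun y => A y (vecField q y) + divField q y * w y) K.carrier := by
  have hq := (Lp.memLp (vecField q)).integrable one_le_two
  have hd := (Lp.memLp (divField q)).integrable one_le_two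
  obtain ⟨C, hC⟩ := hAb
  obtain ⟨C', hC'⟩ := hwb
  refine ((hq.norm.const_mul C).add (hd.norm.const_mul C')).mono'
    ((aestronglyMeasurable_clm_apply hA (Lp.memLp (vecField q)).1).add
      ((Lp.memLp (divField q)).1.mul hw.aestronglyMeasurable))
    (Filter.Eventually.of_forall fun x => ?_)
  refine (norm_add_le _ _).trans (add_le_add ?_ ?_)
  · exact ((A x).le_opNorm _).trans (mul_le_mul_of_nonneg_right (hC x) (norm_nonneg _))
  · rw [norm_mul, mul_comm]
    exact mul_le_mul_of_nonneg_right (hC' x) (norm_nonneg _)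

/-- The weak divergence may be tested against continuously differentiable functions. -/
theorem integral_fderiv_add_div_eq_zero (q : HDiv K.carrier) {ψ : Plane → ℝ}
    (hψ : ContDiff ℝ 1 ψ) (hc : HasCompactSupport ψ) (hs : tsupport ψ ⊆ K.carrier) :
    ∫ y in K.carrier, (fderiv ℝ ψ y (vecField q y) + divField q y * ψ y) = 0 := by
  have hq := (Lp.memLp (vecField q)).integrable one_le_two
  have hd := (Lp.memLp (divField q)).integrable one_le_two
  have hint : ∀ {w : Plane → ℝ}, ContDiff ℝ 1 w → HasCompactSupport w →
      IntegrableOn (fun y => fderiv ℝ w y (vecField q y) + divField q y * w y) K.carrier := by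
    intro w hw hwc
    have hD : Continuous (fderiv ℝ w) := hw.continuous_fderiv one_ne_zero
    exact K.integrable_clm_apply hD ((hwc.fderiv (𝕜 := ℝ)).exists_bound_of_continuous hD)
      hw.continuous (hwc.exists_bound_of_continuous hw.continuous) q
  set M := ∫ y in K.carrier, (‖vecField q y‖ + ‖divField q y‖)
  have hM : 0 ≤ M := integral_nonneg fun y => by positivity
  refine abs_eq_zero.1 (le_antisymm (le_of_forall_pos_le_add fun ε hε => ?_) (abs_nonneg _))
  obtain ⟨φ, hφ, hclose⟩ := exists_isTest_close K.isOpen_carrier hψ hc hs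
    (ε := ε / (M + 1)) (by positivity)
  have hφ1 : ContDiff ℝ 1 φ := hφ.1.of_le (by exact_mod_cast le_top)
  have hzero : ∫ y in K.carrier, (fderiv ℝ φ y (vecField q y) + divField q y * φ y) = 0 := by
    have h := q.2 φ hφ
    have i1 : IntegrableOn (fun y => inner ℝ (vecField q y) (gradient φ y)) K.carrier :=
      integrable_inner_memLp (Lp.memLp _) hφ.memLp_gradient
    have i2 : IntegrableOn (fun y => divField q y * φ y) K.carrier :=
      (Lp.memLp (divField q)).integrable_mul hφ.memLp
    simp only [← inner_gradient]
    rw [integral_add i1 i2]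
    exact add_eq_zero_iff_eq_neg.2 h
  rw [zero_add, ← sub_zero (∫ y in K.carrier, (fderiv ℝ ψ y (vecField q y) + divField q y * ψ y)),
    ← hzero, ← integral_sub (hint hψ hc) (hint hφ1 hφ.2.1), ← Real.norm_eq_abs]
  have hle : ∀ y, ‖fderiv ℝ ψ y (vecField q y) + divField q y * ψ y
      - (fderiv ℝ φ y (vecField q y) + divField q y * φ y)‖
      ≤ ε / (M + 1) * (‖vecField q y‖ + ‖divField q y‖) := by
    intro y
    have e : fderiv ℝ ψ y (vecField q y) + divField q y * ψ y
      - (fderiv ℝ φ y (vecField q y) + divField q y * φ y)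
      = -((fderiv ℝ φ y - fderiv ℝ ψ y) (vecField q y) + (φ y - ψ y) * divField q y) := by
      rw [sub_apply]; ring
    rw [e, norm_neg, mul_add]
    refine (norm_add_le _ _).trans (add_le_add ?_ ?_)
    · exact ((fderiv ℝ φ y - fderiv ℝ ψ y).le_opNorm _).trans
        (mul_le_mul_of_nonneg_right (hclose y).2 (norm_nonneg _))
    · rw [norm_mul]
      exact mul_le_mul_of_nonneg_right (hclose y).1 (norm_nonneg _)
  refine (norm_integral_le_of_norm_le ((hq.norm.add hd.norm).const_mul _)
    (Filter.Eventually.of_forall hle)).trans ?_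
  rw [integral_const_mul]
  change ε / (M + 1) * M ≤ ε
  rw [div_mul_eq_mul_div, div_le_iff₀ (by linarith)]
  nlinarith

/-! ### Pulling fields back to the reference square -/

/-- The adjugate of the Jacobian matrix of `F_K`. -/
def adj (x u : Plane) : Plane := !₂[cross u (K.col1 x), cross (K.col0 x) u]

/-- Cramer's rule: the adjugate is the Jacobian determinant times the inverse matrix, available
without division. -/
theorem fderiv_map_adj (x u : Plane) : fderiv ℝ K.map x (K.adj x u) = K.jac x • u := by
  rw [fderiv_map]
  ext i
  fin_cases i <;> simp [adj, jac, cross] <;> ring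

theorem continuous_adj : Continuous fun z : Plane × Plane => K.adj z.1 z.2 := by
  refine (PiLp.continuous_toLp 2 _).comp (continuous_pi fun i => ?_)
  have h0 := K.continuous_col0.comp (continuous_fst (X := Plane) (Y := Plane))
  have h1 := K.continuous_col1.comp (continuous_fst (X := Plane) (Y := Plane))
  fin_cases i
  exacts [continuous_cross continuous_snd h1, continuous_cross h0 continuous_snd]

theorem sq_norm_adj_le {x u : Plane} {ℓ : ℝ} (h0 : ‖K.col0 x‖ ≤ ℓ) (h1 : ‖K.col1 x‖ ≤ ℓ) :
    ‖K.adj x u‖ ^ 2 ≤ 2 * ℓ ^ 2 * ‖u‖ ^ 2 := by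
  have e : ‖K.adj x u‖ ^ 2 = cross u (K.col1 x) ^ 2 + cross (K.col0 x) u ^ 2 := by
    rw [EuclideanSpace.norm_sq_eq]; simp [adj]
  have c : ∀ a b : Plane, cross a b ^ 2 ≤ ‖a‖ ^ 2 * ‖b‖ ^ 2 := fun a b => by
    rw [sq_cross]; linarith [sq_nonneg (inner ℝ a b)]
  have h0' := pow_le_pow_left₀ (norm_nonneg _) h0 2
  have h1' := pow_le_pow_left₀ (norm_nonneg _) h1 2
  have := mul_le_mul_of_nonneg_left h1' (sq_nonneg ‖u‖)
  have := mul_le_mul_of_nonneg_right h0' (sq_nonneg ‖u‖)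
  rw [e]
  linarith [c u (K.col1 x), c (K.col0 x) u]

theorem memLp_comp_map {E : Type*} [NormedAddCommGroup E] {f : Plane → E}
    (hf : MemLp f 2 (volume.restrict K.carrier)) :
    MemLp (fun x => f (K.map x)) 2 (volume.restrict refSquare) := by
  have hm : AEStronglyMeasurable (fun x => f (K.map x)) (volume.restrict refSquare) :=
    hf.1.comp_quasiMeasurePreserving K.quasiMeasurePreserving_map
  rw [memLp_two_iff_integrable_sq_norm hm]
  obtain ⟨m, hm0, hmj⟩ := K.exists_jac_lower
  have hi : IntegrableOn (fun x => K.jac x * ‖f (K.map x)‖ ^ 2) refSquare :=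
    (K.integrableOn_carrier_iff fun y => ‖f y‖ ^ 2).1 (hf.integrable_norm_pow two_ne_zero)
  refine (hi.const_mul m⁻¹).mono' (hm.norm.pow 2) ?_
  filter_upwards [ae_restrict_mem isOpen_refSquare.measurableSet] with x hx
  have h := hmj x (refSquare_subset_closedSquare hx)
  rw [Real.norm_of_nonneg (by positivity), ← mul_assoc]
  refine le_mul_of_one_le_left (by positivity) ?_
  rwa [← div_eq_inv_mul, one_le_div hm0]

/-- The inverse Piola transform of a vector field on `K`. -/
def pullVec (q : Plane → Plane) (x : Plane) : Plane := K.adj x (q (K.map x))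

/-- The divergence of the inverse Piola transform. -/
def pullDiv (d : Plane → ℝ) (x : Plane) : ℝ := K.jac x * d (K.map x)

theorem memLp_pullVec {q : Plane → Plane} (hq : MemLp q 2 (volume.restrict K.carrier)) :
    MemLp (K.pullVec q) 2 (volume.restrict refSquare) := by
  have h := K.memLp_comp_map hq
  have hm : AEStronglyMeasurable (K.pullVec q) (volume.restrict refSquare) :=
    K.continuous_adj.comp_aestronglyMeasurable
      ((continuous_id.aestronglyMeasurable (μ := volume.restrict refSquare)).prodMk h.1)
  obtain ⟨C0, hC0⟩ :=
    isCompact_closedSquare.exists_bound_of_continuousOn K.continuous_col0.continuousOn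
  obtain ⟨C1, hC1⟩ :=
    isCompact_closedSquare.exists_bound_of_continuousOn K.continuous_col1.continuousOn
  rw [memLp_two_iff_integrable_sq_norm hm]
  have hi : IntegrableOn (fun x => ‖q (K.map x)‖ ^ 2) refSquare :=
    h.integrable_norm_pow two_ne_zero
  refine (hi.const_mul (2 * max C0 C1 ^ 2)).mono' (hm.norm.pow 2) ?_
  filter_upwards [ae_restrict_mem isOpen_refSquare.measurableSet] with x hx
  have hx' := refSquare_subset_closedSquare hx
  rw [Real.norm_of_nonneg (by positivity)]
  exact K.sq_norm_adj_le ((hC0 x hx').trans (le_max_left _ _))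
    ((hC1 x hx').trans (le_max_right _ _))

theorem memLp_pullDiv {d : Plane → ℝ} (hd : MemLp d 2 (volume.restrict K.carrier)) :
    MemLp (K.pullDiv d) 2 (volume.restrict refSquare) := by
  have h := K.memLp_comp_map hd
  have hm : AEStronglyMeasurable (K.pullDiv d) (volume.restrict refSquare) :=
    K.continuous_jac.aestronglyMeasurable.mul h.1
  obtain ⟨C, hC⟩ := isCompact_closedSquare.exists_bound_of_continuousOn K.continuous_jac.continuousOn
  refine h.of_le_mul (c := C) hm ?_
  filter_upwards [ae_restrict_mem isOpen_refSquare.measurableSet] with x hx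
  rw [pullDiv, norm_mul]
  exact mul_le_mul_of_nonneg_right (hC x (refSquare_subset_closedSquare hx)) (norm_nonneg _)

/-- Test functions on the square give rise to test functions on `K`. -/
theorem exists_push {ψ : Plane → ℝ} (hψ : ContDiff ℝ 1 ψ) (hc : HasCompactSupport ψ)
    (hs : tsupport ψ ⊆ refSquare) :
    ∃ Ψ : Plane → ℝ, ContDiff ℝ 1 Ψ ∧ HasCompactSupport Ψ ∧ tsupport Ψ ⊆ K.carrier ∧
      ∀ x ∈ refSquare, Ψ (K.map x) = ψ x := by
  classical
  -- Extension by zero. It vanishes off the compact image of `tsupport ψ`, so it is `C¹` across the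
  -- boundary of `K` too.
  let Ψ : Plane → ℝ := K.carrier.indicator fun y => ψ (K.invMap y)
  have hK : IsCompact (K.map '' tsupport ψ) := IsCompact.image hc K.continuous_map
  have hval : ∀ x ∈ refSquare, Ψ (K.map x) = ψ x := fun x hx => by
    simp only [Ψ]
    rw [Set.indicator_of_mem (show K.map x ∈ K.carrier from ⟨x, hx, rfl⟩), K.invMap_map hx]
  have hzero : ∀ y ∉ K.map '' tsupport ψ, Ψ y = 0 := by
    intro y hy
    by_cases hyK : y ∈ K.carrier
    · obtain ⟨x, hx, rfl⟩ := hyK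
      rw [hval x hx]
      by_contra hne
      exact hy ⟨x, subset_tsupport ψ hne, rfl⟩
    · exact Set.indicator_of_notMem hyK _
  have hsub : tsupport Ψ ⊆ K.map '' tsupport ψ :=
    closure_minimal (fun y hy => by_contra fun h => hy (hzero y h)) hK.isClosed
  refine ⟨Ψ, contDiff_iff_contDiffAt.2 fun y => ?_, hK.of_isClosed_subset (isClosed_tsupport _) hsub,
    hsub.trans (Set.image_mono hs), hval⟩
  by_cases hyK : y ∈ K.carrier
  · have heq : Ψ =ᶠ[nhds y] fun y => ψ (K.invMap y) := by
      filter_upwards [K.isOpen_carrier.mem_nhds hyK] with z hz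
      exact Set.indicator_of_mem hz _
    refine ContDiffAt.congr_of_eventuallyEq ?_ heq
    obtain ⟨x, hx, rfl⟩ := hyK
    exact hψ.contDiffAt.comp _ (K.contDiffAt_invMap one_ne_zero hx)
  · have hy : y ∈ (K.map '' tsupport ψ)ᶜ := fun h => hyK (Set.image_mono hs h)
    have heq : Ψ =ᶠ[nhds y] fun _ => 0 := by
      filter_upwards [hK.isClosed.isOpen_compl.mem_nhds hy] with z hz
      exact hzero z hz
    exact contDiffAt_const.congr_of_eventuallyEq heq

/-- The pullback of a field in `H(div, K)` to the reference square. -/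
theorem refHDiv_pull (q : HDiv K.carrier) :
    RefHDiv (K.pullVec (vecField q)) (K.pullDiv (divField q)) where
  memLp := K.memLp_pullVec (Lp.memLp _)
  memLp_div := K.memLp_pullDiv (Lp.memLp _)
  weakDiv ψ hψ hc hs := by
    obtain ⟨Ψ, h1, h2, h3, h4⟩ := K.exists_push hψ hc hs
    rw [← K.integral_fderiv_add_div_eq_zero q h1 h2 h3, integral_carrier]
    refine setIntegral_congr_fun isOpen_refSquare.measurableSet fun x hx => ?_
    have heq : (fun x => Ψ (K.map x)) =ᶠ[nhds x] ψ := by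
      filter_upwards [isOpen_refSquare.mem_nhds hx] with z hz
      exact h4 z hz
    have hcomp : fderiv ℝ ψ x = (fderiv ℝ Ψ (K.map x)).comp (fderiv ℝ K.map x) := by
      rw [← heq.fderiv_eq]
      exact fderiv_fun_comp x (h1.differentiable one_ne_zero _)
        ((K.contDiff_map (n := 1)).differentiable one_ne_zero _)
    simp only [pullVec, pullDiv]
    rw [hcomp, ContinuousLinearMap.comp_apply, fderiv_map_adj, map_smul, h4 x hx, smul_eq_mul]
    ring

end ConvexQuad

theorem IsWeakDiv.congr {U : Set Plane} {q q' : Plane → Plane} {f f' : Plane → ℝ}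
    (h : IsWeakDiv U q f) (hq : q' =ᵐ[volume.restrict U] q) (hf : f' =ᵐ[volume.restrict U] f) :
    IsWeakDiv U q' f' := by
  intro φ hφ
  have h1 : ∫ x in U, inner ℝ (q' x) (gradient φ x) = ∫ x in U, inner ℝ (q x) (gradient φ x) := by
    refine integral_congr_ae ?_
    filter_upwards [hq] with x hx
    rw [hx]
  have h2 : ∫ x in U, f' x * φ x = ∫ x in U, f x * φ x := by
    refine integral_congr_ae ?_
    filter_upwards [hf] with x hx
    rw [hx]
  rw [h1, h2, h φ hφ]

theorem HDiv.ext_ae {U : Set Plane} {a b : HDiv U}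
    (h1 : vecField a =ᵐ[volume.restrict U] vecField b)
    (h2 : divField a =ᵐ[volume.restrict U] divField b) : a = b := by
  apply Subtype.ext
  have h1' : a.1.fst = b.1.fst := Lp.ext h1
  have h2' : a.1.snd = b.1.snd := Lp.ext h2
  exact (WithLp.equiv 2 _).injective (Prod.ext h1' h2')

theorem polyRT_mono {r s : ℕ} (h : r ≤ s) : polyRT r ≤ polyRT s := fun _ hQ =>
  ⟨polyP_mono (by omega) h hQ.1, polyP_mono h (by omega) hQ.2⟩

namespace ConvexQuad

variable (K : ConvexQuad)

/-! ### The Piola transform of polynomial fields -/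

theorem piola_map (q : Plane → Plane) {x : Plane} (hx : x ∈ refSquare) :
    K.piola q (K.map x) = (K.jac x)⁻¹ • fderiv ℝ K.map x (q x) := by
  rw [piola, K.invMap_map hx, det_fderiv_map]

/-- The divergence of the Piola transform of a polynomial field. -/
def piolaDiv (Q : MvPolynomial (Fin 2) ℝ × MvPolynomial (Fin 2) ℝ) (y : Plane) : ℝ :=
  (K.jac (K.invMap y))⁻¹ * polyVal (polyDiv Q) (K.invMap y)

theorem piolaDiv_map (Q : MvPolynomial (Fin 2) ℝ × MvPolynomial (Fin 2) ℝ) {x : Plane}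
    (hx : x ∈ refSquare) : K.piolaDiv Q (K.map x) = (K.jac x)⁻¹ * polyVal (polyDiv Q) x := by
  rw [piolaDiv, K.invMap_map hx]

theorem memLp_comp_invMap {E : Type*} [NormedAddCommGroup E] {f : Plane → E}
    (hf : ContinuousOn f closedSquare) :
    MemLp (fun y => f (K.invMap y)) 2 (volume.restrict K.carrier) := by
  obtain ⟨C, hC⟩ := isCompact_closedSquare.exists_bound_of_continuousOn hf
  have hmaps : Set.MapsTo K.invMap K.carrier closedSquare := fun y hy =>
    refSquare_subset_closedSquare (K.invMap_mem hy)
  refine MemLp.of_bound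
    ((hf.comp K.continuousOn_invMap hmaps).aestronglyMeasurable
      K.measurableSet_carrier) C ?_
  filter_upwards [ae_restrict_mem K.measurableSet_carrier] with y hy
  exact hC _ (hmaps hy)

theorem continuousOn_inv_jac : ContinuousOn (fun x => (K.jac x)⁻¹) closedSquare :=
  K.continuous_jac.continuousOn.inv₀ fun _ hx => (K.jac_pos hx).ne'

theorem memLp_piola (Q : MvPolynomial (Fin 2) ℝ × MvPolynomial (Fin 2) ℝ) :
    MemLp (K.piola (polyVec Q)) 2 (volume.restrict K.carrier) := by
  have e : K.piola (polyVec Q) = fun y => (fun x => (K.jac x)⁻¹ • (polyVec Q x 0 • K.col0 x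
      + polyVec Q x 1 • K.col1 x)) (K.invMap y) := by
    ext1 y
    rw [piola, det_fderiv_map, fderiv_map]
  rw [e]
  have hi : ∀ i, Continuous fun x => polyVec Q x i := fun i =>
    (EuclideanSpace.proj (𝕜 := ℝ) i).continuous.comp (continuous_polyVec Q)
  have hc : Continuous fun x => polyVec Q x 0 • K.col0 x + polyVec Q x 1 • K.col1 x :=
    ((hi 0).smul K.continuous_col0).add ((hi 1).smul K.continuous_col1)
  exact K.memLp_comp_invMap (f := fun x => (K.jac x)⁻¹ • (polyVec Q x 0 • K.col0 x
    + polyVec Q x 1 • K.col1 x)) (K.continuousOn_inv_jac.smul hc.continuousOn)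

theorem memLp_piolaDiv (Q : MvPolynomial (Fin 2) ℝ × MvPolynomial (Fin 2) ℝ) :
    MemLp (K.piolaDiv Q) 2 (volume.restrict K.carrier) :=
  K.memLp_comp_invMap (f := fun x => (K.jac x)⁻¹ * polyVal (polyDiv Q) x)
    (K.continuousOn_inv_jac.mul (continuous_polyVal _).continuousOn)

/-- Injectivity on the closed square keeps the boundary of the square from being mapped into the
open element. -/
theorem comp_map_eq_zero {φ : Plane → ℝ} (hφ : tsupport φ ⊆ K.carrier) {x : Plane}
    (hx : x ∈ closedSquare) (hx' : x ∉ refSquare) : φ (K.map x) = 0 := by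
  by_contra hne
  obtain ⟨y, hy, hyx⟩ := hφ (subset_tsupport φ hne)
  exact hx' (K.injOn_map (refSquare_subset_closedSquare hy) hx hyx ▸ hy)

theorem integral_partialD_eq_zero {f : Plane → ℝ} (hf : ContDiff ℝ 1 f)
    (h : ∀ x ∈ closedSquare, x ∉ refSquare → f x = 0) (i : Fin 2) :
    ∫ x in refSquare, partialD i f x = 0 := by
  rw [integral_partialD hf i]
  have hz : ∀ s : ℝ, (s = 0 ∨ s = 1) → ∀ t ∈ Set.uIcc (0 : ℝ) 1, f (pt i s t) = 0 := by
    intro s hs t ht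
    rw [Set.uIcc_of_le zero_le_one] at ht
    refine h _ (fun j => ?_) fun hcon => ?_
    · by_cases hj : j = i
      · subst hj; rcases hs with rfl | rfl <;> simp
      · rw [pt_of_ne hj]; exact ht
    · have := hcon i
      rw [pt_self] at this
      rcases hs with rfl | rfl <;> linarith
  rw [intervalIntegral.integral_congr (g := fun _ => (0 : ℝ)) fun t ht => ?_]
  · simp
  · simp only
    rw [hz 1 (Or.inr rfl) t ht, hz 0 (Or.inl rfl) t ht, sub_zero]

theorem isWeakDiv_piola (Q : MvPolynomial (Fin 2) ℝ × MvPolynomial (Fin 2) ℝ) :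
    IsWeakDiv K.carrier (K.piola (polyVec Q)) (K.piolaDiv Q) := by
  intro φ hφ
  have hφ1 : ContDiff ℝ 1 φ := hφ.1.of_le (by exact_mod_cast le_top)
  have hw : ContDiff ℝ 1 fun x => φ (K.map x) := hφ1.comp K.contDiff_map
  have hzero : ∀ R : MvPolynomial (Fin 2) ℝ, ∀ i,
      ∫ x in refSquare, partialD i (fun x => φ (K.map x) * polyVal R x) x = 0 := fun R i =>
    integral_partialD_eq_zero (hw.mul (contDiff_polyVal R))
      (fun x hx hx' => by rw [K.comp_map_eq_zero hφ.2.2 hx hx', zero_mul]) i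
  have hint : ∀ R : MvPolynomial (Fin 2) ℝ, ∀ i, IntegrableOn
      (fun x => partialD i (fun x => φ (K.map x) * polyVal R x) x) refSquare := fun R i =>
    integrableOn_refSquare (continuous_partialD (hw.mul (contDiff_polyVal R)) i)
  -- On the square the Jacobian factors cancel, and the integrand becomes the sum of the `∂ᵢ (φ ∘
  -- F_K · Qᵢ)`, each of integral zero.
  rw [integral_carrier, integral_carrier, ← add_eq_zero_iff_eq_neg, ← integral_add]
  · have hsum := integral_add (hint Q.1 0) (hint Q.2 1)
    rw [hzero, hzero, add_zero] at hsum
    rw [← hsum]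
    refine setIntegral_congr_fun isOpen_refSquare.measurableSet fun x hx => ?_
    have hj := (K.jac_pos (refSquare_subset_closedSquare hx)).ne'
    have hcomp : fderiv ℝ (fun x => φ (K.map x)) x
        = (fderiv ℝ φ (K.map x)).comp (fderiv ℝ K.map x) :=
      fderiv_fun_comp x (hφ1.differentiable one_ne_zero _)
        ((K.contDiff_map (n := 1)).differentiable one_ne_zero _)
    have hpair : fderiv ℝ φ (K.map x) (fderiv ℝ K.map x (polyVec Q x))
        = partialD 0 (fun x => φ (K.map x)) x * polyVal Q.1 x
          + partialD 1 (fun x => φ (K.map x)) x * polyVal Q.2 x := by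
      rw [← ContinuousLinearMap.comp_apply, ← hcomp, fderiv_eq_partialD]
      simp [polyVec]
    simp only [inner_gradient]
    rw [K.piola_map _ hx, K.piolaDiv_map _ hx, partialD_mul hw (contDiff_polyVal _),
      partialD_mul hw (contDiff_polyVal _), map_smul, hpair, partialD_polyVal, partialD_polyVal,
      polyDiv_apply, polyVal_add, smul_eq_mul]
    field_simp
    ring
  · exact (K.integrableOn_carrier_iff _).1
      (integrable_inner_memLp (K.memLp_piola Q) hφ.memLp_gradient)
  · exact (K.integrableOn_carrier_iff fun y => K.piolaDiv Q y * φ y).1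
      ((K.memLp_piolaDiv Q).integrable_mul hφ.memLp)

/-- The Piola transform of a polynomial field, as an element of `H(div, K)`. -/
def piolaHDiv (Q : MvPolynomial (Fin 2) ℝ × MvPolynomial (Fin 2) ℝ) : HDiv K.carrier :=
  ⟨WithLp.toLp 2 ((K.memLp_piola Q).toLp _, (K.memLp_piolaDiv Q).toLp _),
    (K.isWeakDiv_piola Q).congr (K.memLp_piola Q).coeFn_toLp (K.memLp_piolaDiv Q).coeFn_toLp⟩

theorem vecField_piolaHDiv (Q : MvPolynomial (Fin 2) ℝ × MvPolynomial (Fin 2) ℝ) :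
    vecField (K.piolaHDiv Q) =ᵐ[volume.restrict K.carrier] K.piola (polyVec Q) :=
  (K.memLp_piola Q).coeFn_toLp

theorem divField_piolaHDiv (Q : MvPolynomial (Fin 2) ℝ × MvPolynomial (Fin 2) ℝ) :
    divField (K.piolaHDiv Q) =ᵐ[volume.restrict K.carrier] K.piolaDiv Q :=
  (K.memLp_piolaDiv Q).coeFn_toLp

/-- The Piola transform as a linear map between the Raviart-Thomas spaces. -/
def piolaRT {r s : ℕ} (h : r ≤ s) : polyRT r →ₗ[ℝ] K.rtSpace s where
  toFun Q := ⟨K.piolaHDiv Q.1, Q.1, polyRT_mono h Q.2, K.vecField_piolaHDiv Q.1⟩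
  map_add' P Q := by
    refine Subtype.ext (HDiv.ext_ae ?_ ?_)
    · have e : vecField (K.piolaHDiv P.1 + K.piolaHDiv Q.1)
          = vecField (K.piolaHDiv P.1) + vecField (K.piolaHDiv Q.1) := rfl
      change vecField (K.piolaHDiv (P.1 + Q.1)) =ᵐ[_] vecField (K.piolaHDiv P.1 + K.piolaHDiv Q.1)
      rw [e]
      filter_upwards [K.vecField_piolaHDiv (P.1 + Q.1), K.vecField_piolaHDiv P.1,
        K.vecField_piolaHDiv Q.1, Lp.coeFn_add (vecField (K.piolaHDiv P.1))
          (vecField (K.piolaHDiv Q.1))] with y h0 h1 h2 h3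
      rw [h0, h3, Pi.add_apply, h1, h2]
      simp only [piola, polyVec_add, map_add, smul_add]
    · have e : divField (K.piolaHDiv P.1 + K.piolaHDiv Q.1)
          = divField (K.piolaHDiv P.1) + divField (K.piolaHDiv Q.1) := rfl
      change divField (K.piolaHDiv (P.1 + Q.1)) =ᵐ[_] divField (K.piolaHDiv P.1 + K.piolaHDiv Q.1)
      rw [e]
      filter_upwards [K.divField_piolaHDiv (P.1 + Q.1), K.divField_piolaHDiv P.1,
        K.divField_piolaHDiv Q.1, Lp.coeFn_add (divField (K.piolaHDiv P.1))
          (divField (K.piolaHDiv Q.1))] with y h0 h1 h2 h3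
      rw [h0, h3, Pi.add_apply, h1, h2]
      simp only [piolaDiv, map_add, polyVal_add, mul_add]
  map_smul' c P := by
    refine Subtype.ext (HDiv.ext_ae ?_ ?_)
    · have e : vecField (c • K.piolaHDiv P.1) = c • vecField (K.piolaHDiv P.1) := rfl
      change vecField (K.piolaHDiv (c • P.1)) =ᵐ[_] vecField (c • K.piolaHDiv P.1)
      rw [e]
      filter_upwards [K.vecField_piolaHDiv (c • P.1), K.vecField_piolaHDiv P.1,
        Lp.coeFn_smul c (vecField (K.piolaHDiv P.1))] with y h0 h1 h3
      rw [h0, h3, Pi.smul_apply, h1]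
      simp only [piola, polyVec_smul, map_smul]
      exact smul_comm _ _ _
    · have e : divField (c • K.piolaHDiv P.1) = c • divField (K.piolaHDiv P.1) := rfl
      change divField (K.piolaHDiv (c • P.1)) =ᵐ[_] divField (c • K.piolaHDiv P.1)
      rw [e]
      filter_upwards [K.divField_piolaHDiv (c • P.1), K.divField_piolaHDiv P.1,
        Lp.coeFn_smul c (divField (K.piolaHDiv P.1))] with y h0 h1 h3
      rw [h0, h3, Pi.smul_apply, h1]
      simp only [piolaDiv, map_smul, polyVal_smul, smul_eq_mul]
      ring

/-! ### Reference functionals of fields on K -/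

/-- The functional on reference polynomials induced by a field in `H(div, K)`. -/
def pullPair (q : HDiv K.carrier) :
    MvPolynomial (Fin 2) ℝ × (MvPolynomial (Fin 2) ℝ × MvPolynomial (Fin 2) ℝ) →ₗ[ℝ] ℝ :=
  refPair (K.memLp_pullVec (Lp.memLp (vecField q))) (K.memLp_pullDiv (Lp.memLp (divField q)))

theorem adj_add (x u v : Plane) : K.adj x (u + v) = K.adj x u + K.adj x v := by
  ext i; fin_cases i <;> simp [adj, cross] <;> ring

theorem adj_smul (c : ℝ) (x u : Plane) : K.adj x (c • u) = c • K.adj x u := by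
  ext i; fin_cases i <;> simp [adj, cross] <;> ring

theorem adj_fderiv_map (x u : Plane) : K.adj x (fderiv ℝ K.map x u) = K.jac x • u := by
  rw [fderiv_map]
  ext i; fin_cases i <;> simp [adj, cross, jac] <;> ring

theorem pullPair_add (a b : HDiv K.carrier) :
    K.pullPair (a + b) = K.pullPair a + K.pullPair b := by
  refine LinearMap.ext fun e => ?_
  simp only [pullPair, LinearMap.add_apply, refPair_apply]
  rw [← integral_add (integrableOn_refPair (K.memLp_pullVec (Lp.memLp (vecField a)))
      (K.memLp_pullDiv (Lp.memLp (divField a))) e)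
    (integrableOn_refPair (K.memLp_pullVec (Lp.memLp (vecField b)))
      (K.memLp_pullDiv (Lp.memLp (divField b))) e)]
  refine integral_congr_ae ?_
  filter_upwards [K.quasiMeasurePreserving_map.ae (Lp.coeFn_add (vecField a) (vecField b)),
    K.quasiMeasurePreserving_map.ae (Lp.coeFn_add (divField a) (divField b))] with x h1 h2
  have e1 : vecField (a + b) = vecField a + vecField b := rfl
  have e2 : divField (a + b) = divField a + divField b := rfl
  simp only [pullVec, pullDiv]
  rw [e1, e2, h1, h2, Pi.add_apply, Pi.add_apply, adj_add, inner_add_right]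
  ring

theorem pullPair_smul (c : ℝ) (a : HDiv K.carrier) : K.pullPair (c • a) = c • K.pullPair a := by
  refine LinearMap.ext fun e => ?_
  simp only [pullPair, LinearMap.smul_apply, refPair_apply, smul_eq_mul]
  rw [← integral_const_mul]
  refine integral_congr_ae ?_
  filter_upwards [K.quasiMeasurePreserving_map.ae (Lp.coeFn_smul c (vecField a)),
    K.quasiMeasurePreserving_map.ae (Lp.coeFn_smul c (divField a))] with x h1 h2
  have e1 : vecField (c • a) = c • vecField a := rfl
  have e2 : divField (c • a) = c • divField a := rfl
  simp only [pullVec, pullDiv]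
  rw [e1, e2, h1, h2, Pi.smul_apply, Pi.smul_apply, adj_smul, real_inner_smul_right, smul_eq_mul]
  ring

/-- `pullPair` as a linear map into the dual of the test space. -/
def pullDual (p : ℕ) : HDiv K.carrier →ₗ[ℝ] Module.Dual ℝ (testSpace p) where
  toFun q := (K.pullPair q).comp (testSpace p).subtype
  map_add' a b := by rw [pullPair_add, LinearMap.add_comp]
  map_smul' c a := by rw [pullPair_smul, LinearMap.smul_comp]; rfl

/-- The adjugate undoes the Piola transform and `jac` undoes the factor in its divergence, so
interpolation on `K` is interpolation on the square. -/
theorem pullPair_piolaHDiv (Q : MvPolynomial (Fin 2) ℝ × MvPolynomial (Fin 2) ℝ) :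
    K.pullPair (K.piolaHDiv Q) = polyPair Q := by
  refine LinearMap.ext fun e => ?_
  simp only [pullPair, polyPair, refPair_apply]
  refine integral_congr_ae ?_
  filter_upwards [K.quasiMeasurePreserving_map.ae (K.vecField_piolaHDiv Q),
    K.quasiMeasurePreserving_map.ae (K.divField_piolaHDiv Q),
    ae_restrict_mem isOpen_refSquare.measurableSet] with x h1 h2 hx
  have hj := (K.jac_pos (refSquare_subset_closedSquare hx)).ne'
  simp only [pullVec, pullDiv]
  rw [h1, h2, K.piola_map _ hx, K.piolaDiv_map _ hx, adj_smul, adj_fderiv_map, smul_smul,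
    inv_mul_cancel₀ hj, one_smul, mul_inv_cancel_left₀ hj]

end ConvexQuad

/-! ### Convergence in `L²` -/

section L2

variable {α E : Type*} [MeasurableSpace α] {μ : Measure α} [NormedAddCommGroup E]
  [InnerProductSpace ℝ E]

theorem integral_inner_toLp {f g : α → E} (hf : MemLp f 2 μ) (hg : MemLp g 2 μ) :
    inner ℝ (hf.toLp f) (hg.toLp g) = ∫ a, inner ℝ (f a) (g a) ∂μ := by
  rw [L2.inner_def]
  refine integral_congr_ae ?_
  filter_upwards [hf.coeFn_toLp, hg.coeFn_toLp] with a h1 h2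
  rw [h1, h2]

theorem sq_norm_toLp {f : α → E} (hf : MemLp f 2 μ) : ‖hf.toLp f‖ ^ 2 = ∫ a, ‖f a‖ ^ 2 ∂μ := by
  rw [← real_inner_self_eq_norm_sq, integral_inner_toLp]
  simp only [real_inner_self_eq_norm_sq]

theorem sq_norm_Lp (f : Lp E 2 μ) : ‖f‖ ^ 2 = ∫ a, ‖f a‖ ^ 2 ∂μ := by
  rw [← sq_norm_toLp (Lp.memLp f), Lp.toLp_coeFn]

omit [InnerProductSpace ℝ E] in
theorem tendsto_toLp {f : ℕ → α → E} {F : α → E} (hf : ∀ n, MemLp (f n) 2 μ) (hF : MemLp F 2 μ)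
    (h : Filter.Tendsto (fun n => eLpNorm (fun a => f n a - F a) 2 μ) Filter.atTop (nhds 0)) :
    Filter.Tendsto (fun n => (hf n).toLp (f n)) Filter.atTop (nhds (hF.toLp F)) :=
  (Lp.tendsto_Lp_iff_tendsto_eLpNorm'' f hf F hF).2 h

theorem tendsto_integral_inner {f : ℕ → α → E} {F H : α → E} (hf : ∀ n, MemLp (f n) 2 μ)
    (hF : MemLp F 2 μ) (hH : MemLp H 2 μ)
    (h : Filter.Tendsto (fun n => eLpNorm (fun a => f n a - F a) 2 μ) Filter.atTop (nhds 0)) :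
    Filter.Tendsto (fun n => ∫ a, inner ℝ (H a) (f n a) ∂μ) Filter.atTop
      (nhds (∫ a, inner ℝ (H a) (F a) ∂μ)) := by
  simp only [← integral_inner_toLp hH (hf _)]
  rw [← integral_inner_toLp hH hF]
  exact (tendsto_const_nhds (x := hH.toLp H)).inner (tendsto_toLp hf hF h)

theorem tendsto_integral_norm_sq {f : ℕ → α → E} {F : α → E} (hf : ∀ n, MemLp (f n) 2 μ)
    (hF : MemLp F 2 μ)
    (h : Filter.Tendsto (fun n => eLpNorm (fun a => f n a - F a) 2 μ) Filter.atTop (nhds 0)) :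
    Filter.Tendsto (fun n => ∫ a, ‖f n a‖ ^ 2 ∂μ) Filter.atTop (nhds (∫ a, ‖F a‖ ^ 2 ∂μ)) := by
  rw [← sq_norm_toLp hF]
  simp only [← sq_norm_toLp (hf _)]
  exact (tendsto_toLp hf hF h).norm.pow 2

end L2

theorem norm_gradient (φ : Plane → ℝ) (x : Plane) : ‖gradient φ x‖ = ‖fderiv ℝ φ x‖ := by
  rw [gradient, LinearIsometryEquiv.norm_map]

theorem continuous_gradient {φ : Plane → ℝ} (hφ : ContDiff ℝ 1 φ) : Continuous (gradient φ) :=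
  (InnerProductSpace.toDual ℝ Plane).symm.continuous.comp (hφ.continuous_fderiv one_ne_zero)

theorem HDiv.sq_norm {U : Set Plane} (q : HDiv U) :
    ‖q‖ ^ 2 = (∫ y in U, ‖vecField q y‖ ^ 2) + ∫ y in U, divField q y ^ 2 := by
  have h : ‖q‖ ^ 2 = ‖vecField q‖ ^ 2 + ‖divField q‖ ^ 2 :=
    WithLp.prod_norm_sq_eq_of_L2 (q : L2Pair U)
  rw [h, sq_norm_Lp, sq_norm_Lp]
  simp only [Real.norm_eq_abs, sq_abs]

/-! ### Interpolation of boundary values -/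

/-- The Coons patch: a polynomial with prescribed compatible values on the edges of the square. -/
theorem exists_coons {r : ℕ} (hr : 1 ≤ r) {P : Fin 4 → Polynomial ℝ} (hP : ∀ i, (P i).natDegree ≤ r)
    (h01 : (P 0).eval 1 = (P 1).eval 0) (h12 : (P 1).eval 1 = (P 2).eval 0)
    (h23 : (P 2).eval 1 = (P 3).eval 0) (h30 : (P 3).eval 1 = (P 0).eval 0) :
    ∃ V ∈ polyP r r, ∀ t : ℝ, polyVal V (pt 1 0 t) = (P 0).eval t ∧
      polyVal V (pt 0 1 t) = (P 1).eval t ∧ polyVal V (pt 1 1 t) = (P 2).eval (1 - t) ∧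
      polyVal V (pt 0 0 t) = (P 3).eval (1 - t) := by
  let x : MvPolynomial (Fin 2) ℝ := MvPolynomial.X 0
  let y : MvPolynomial (Fin 2) ℝ := MvPolynomial.X 1
  have hx : x ∈ polyP 1 0 := X_zero_mem_polyP
  have hy : y ∈ polyP 0 1 := X_one_mem_polyP
  have hx' : 1 - x ∈ polyP 1 0 := sub_mem (one_mem_polyP _ _) hx
  have hy' : 1 - y ∈ polyP 0 1 := sub_mem (one_mem_polyP _ _) hy
  have hC : ∀ {a b : MvPolynomial (Fin 2) ℝ} (c : ℝ), a ∈ polyP 1 0 → b ∈ polyP 0 1 →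
      a * b * MvPolynomial.C c ∈ polyP r r := fun c ha hb =>
    mul_mem_polyP' (mul_mem_polyP ha hb) (C_mem_polyP c 0 0)
  -- Two ruled surfaces between opposite edges, minus the bilinear interpolant of the corners, which
  -- they count twice. Edges 2 and 3 run against the coordinate axes, hence `1 - x` and `1 - y`; the
  -- linear blending factors need `1 ≤ r`.
  refine ⟨(1 - y) * Polynomial.aeval x (P 0) + y * Polynomial.aeval (1 - x) (P 2)
      + (1 - x) * Polynomial.aeval (1 - y) (P 3) + x * Polynomial.aeval y (P 1)
      - ((1 - x) * (1 - y) * MvPolynomial.C ((P 0).eval 0)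
        + x * (1 - y) * MvPolynomial.C ((P 1).eval 0) + x * y * MvPolynomial.C ((P 2).eval 0)
        + (1 - x) * y * MvPolynomial.C ((P 3).eval 0)), ?_, fun t => ?_⟩
  · refine sub_mem (add_mem (add_mem (add_mem ?_ ?_) ?_) ?_)
      (add_mem (add_mem (add_mem (hC _ hx' hy') (hC _ hx hy')) (hC _ hx hy)) (hC _ hx' hy))
    · exact mul_mem_polyP' hy' (aeval_mem_polyP_zero hx (hP 0))
    · exact mul_mem_polyP' hy (aeval_mem_polyP_zero hx' (hP 2))
    · exact mul_mem_polyP' hx' (aeval_mem_polyP_one hy' (hP 3))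
    · exact mul_mem_polyP' hx (aeval_mem_polyP_one hy (hP 1))
  · simp only [polyVal_sub, polyVal_add, polyVal_mul, polyVal_aeval, polyVal_C, polyVal_one,
      polyVal_X, x, y, pt_self, pt_of_ne (show (0 : Fin 2) ≠ 1 by decide),
      pt_of_ne (show (1 : Fin 2) ≠ 0 by decide), sub_self, sub_zero, zero_mul, mul_zero, one_mul,
      mul_one, add_zero, zero_add]
    refine ⟨?_, ?_, ?_, ?_⟩
    · rw [h30]; ring
    · rw [h01]; ring
    · rw [← h12]; ring
    · rw [← h30]; linear_combination t * h23

namespace ConvexQuad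

variable (K : ConvexQuad)

theorem edge_eq_map (t : ℝ) : K.edge 0 t = K.map (pt 1 0 t) ∧ K.edge 1 t = K.map (pt 0 1 t) ∧
    K.edge 2 t = K.map (pt 1 1 (1 - t)) ∧ K.edge 3 t = K.map (pt 0 0 (1 - t)) := by
  have h3 : (2 : Fin 4) + 1 = 3 := rfl
  have h4 : (3 : Fin 4) + 1 = 0 := rfl
  have h2 : (1 : Fin 4) + 1 = 2 := rfl
  refine ⟨?_, ?_, ?_, ?_⟩ <;> ext i <;>
    simp [edge, map, AffineMap.lineMap_apply, pt, h2, h3, h4] <;> ring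

theorem exists_boundary_extension {r : ℕ} (hr : 1 ≤ r) {γ : Plane → ℝ}
    (hγ : γ ∈ K.contBoundaryPoly r) : ∃ V ∈ polyP r r, ∀ t ∈ Set.Icc (0 : ℝ) 1,
      polyVal V (pt 1 0 t) = γ (K.edge 0 t) ∧ polyVal V (pt 0 1 t) = γ (K.edge 1 t) ∧
      polyVal V (pt 1 1 (1 - t)) = γ (K.edge 2 t) ∧ polyVal V (pt 0 0 (1 - t)) = γ (K.edge 3 t) := by
  choose P hP hPγ using hγ.2
  have z0 : (0 : ℝ) ∈ Set.Icc (0 : ℝ) 1 := ⟨le_rfl, zero_le_one⟩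
  have z1 : (1 : ℝ) ∈ Set.Icc (0 : ℝ) 1 := ⟨zero_le_one, le_rfl⟩
  have hcomp : ∀ i, (P i).eval 1 = (P (i + 1)).eval 0 := fun i => by
    rw [← hPγ i 1 z1, ← hPγ (i + 1) 0 z0]
    simp [edge]
  obtain ⟨V, hV, h⟩ := exists_coons hr hP (hcomp 0) (hcomp 1) (hcomp 2) (hcomp 3)
  refine ⟨V, hV, fun t ht => ?_⟩
  rw [hPγ 0 t ht, hPγ 1 t ht, hPγ 2 t ht, hPγ 3 t ht]
  obtain ⟨a0, a1, -, -⟩ := h t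
  obtain ⟨-, -, a2, a3⟩ := h (1 - t)
  rw [sub_sub_cancel] at a2 a3
  exact ⟨a0, a1, a2, a3⟩

theorem memLp_carrier_of_continuous {E : Type*} [NormedAddCommGroup E] {f : Plane → E}
    (hf : Continuous f) : MemLp f 2 (volume.restrict K.carrier) := by
  obtain ⟨C, hC⟩ := K.isCompact_image_closedSquare.exists_bound_of_continuousOn hf.continuousOn
  refine MemLp.of_bound hf.aestronglyMeasurable C ?_
  filter_upwards [ae_restrict_mem K.measurableSet_carrier] with y hy
  exact hC y (K.carrier_subset hy)

end ConvexQuad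

/-! ### Vanishing of the moments on K -/

theorem h1Sq_sub_le {a b : Plane → ℝ} (ha : ContDiff ℝ 1 a) (hb : ContDiff ℝ 1 b) :
    h1Sq (fun x => a x - b x) ≤ 2 * h1Sq a + 2 * h1Sq b := by
  have hint : ∀ {w : Plane → ℝ}, ContDiff ℝ 1 w →
      IntegrableOn (fun x => w x ^ 2 + ‖fderiv ℝ w x‖ ^ 2) refSquare := fun {w} hw => by
    have h1 := hw.continuous
    have h2 : Continuous (fderiv ℝ w) := hw.continuous_fderiv one_ne_zero
    exact integrableOn_refSquare (by fun_prop)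
  rw [h1Sq, h1Sq, h1Sq, ← integral_const_mul, ← integral_const_mul,
    ← integral_add ((hint ha).const_mul 2) ((hint hb).const_mul 2)]
  refine integral_mono (hint (ha.sub hb)) (((hint ha).const_mul 2).add ((hint hb).const_mul 2))
    fun x => ?_
  simp only
  rw [fderiv_fun_sub (ha.differentiable one_ne_zero x) (hb.differentiable one_ne_zero x)]
  have h1 := norm_sub_le (fderiv ℝ a x) (fderiv ℝ b x)
  have h2 := pow_le_pow_left₀ (norm_nonneg _) h1 2
  nlinarith [sq_nonneg (a x + b x), sq_nonneg (‖fderiv ℝ a x‖ - ‖fderiv ℝ b x‖)]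

namespace ConvexQuad

variable (K : ConvexQuad)

theorem fderiv_comp_map {φ : Plane → ℝ} (hφ : ContDiff ℝ 1 φ) (x : Plane) :
    fderiv ℝ (fun x => φ (K.map x)) x = (fderiv ℝ φ (K.map x)).comp (fderiv ℝ K.map x) :=
  fderiv_fun_comp x (hφ.differentiable one_ne_zero _)
    ((K.contDiff_map (n := 1)).differentiable one_ne_zero _)

/-- The constant may depend on `K`: it only serves to bound an approximating sequence on one fixed
element. -/
theorem exists_h1Sq_comp_map_le : ∃ C : ℝ, ∀ φ : Plane → ℝ, ContDiff ℝ 1 φ →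
    h1Sq (fun x => φ (K.map x))
      ≤ C * ((∫ y in K.carrier, ‖φ y‖ ^ 2) + ∫ y in K.carrier, ‖gradient φ y‖ ^ 2) := by
  obtain ⟨m, hm0, hm⟩ := K.exists_jac_lower
  have hD : Continuous (fderiv ℝ K.map) := (K.contDiff_map (n := 1)).continuous_fderiv one_ne_zero
  obtain ⟨M, hM⟩ := isCompact_closedSquare.exists_bound_of_continuousOn hD.continuousOn
  refine ⟨m⁻¹ * (1 + M ^ 2), fun φ hφ => ?_⟩
  have hφc := hφ.continuous
  have hg := continuous_gradient hφ
  have i1 : IntegrableOn (fun y => ‖φ y‖ ^ 2) K.carrier :=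
    (K.memLp_carrier_of_continuous hφc).integrable_norm_pow two_ne_zero
  have i2 : IntegrableOn (fun y => ‖gradient φ y‖ ^ 2) K.carrier :=
    (K.memLp_carrier_of_continuous hg).integrable_norm_pow two_ne_zero
  have i3 : IntegrableOn (fun y => ‖φ y‖ ^ 2 + ‖gradient φ y‖ ^ 2) K.carrier := i1.add i2
  rw [← integral_add i1 i2, integral_carrier, ← integral_const_mul]
  have hc : ContDiff ℝ 1 fun x => φ (K.map x) := hφ.comp K.contDiff_map
  have hc1 := hc.continuous
  have hc2 : Continuous (fderiv ℝ fun x => φ (K.map x)) := hc.continuous_fderiv one_ne_zero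
  refine setIntegral_mono_on (integrableOn_refSquare ((hc1.pow 2).add (hc2.norm.pow 2)))
    (((K.integrableOn_carrier_iff _).1 i3).const_mul _) isOpen_refSquare.measurableSet
    fun x hx => ?_
  have hx' := refSquare_subset_closedSquare hx
  have h1 : ‖fderiv ℝ (fun x => φ (K.map x)) x‖ ≤ ‖gradient φ (K.map x)‖ * M := by
    rw [K.fderiv_comp_map hφ, norm_gradient]
    exact (ContinuousLinearMap.opNorm_comp_le _ _).trans
      (mul_le_mul_of_nonneg_left (hM x hx') (norm_nonneg _))
  have h2 := pow_le_pow_left₀ (norm_nonneg _) h1 2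
  rw [mul_pow] at h2
  have h3 : 1 ≤ m⁻¹ * K.jac x := by
    rw [← div_eq_inv_mul, one_le_div hm0]; exact hm x hx'
  rw [Real.norm_eq_abs, sq_abs]
  set A := φ (K.map x) ^ 2
  set G := ‖gradient φ (K.map x)‖ ^ 2
  have hA : 0 ≤ A := sq_nonneg _
  have hG : 0 ≤ G := sq_nonneg _
  have h4 : A + ‖fderiv ℝ (fun x => φ (K.map x)) x‖ ^ 2 ≤ (1 + M ^ 2) * (A + G) := by
    nlinarith [mul_nonneg (sq_nonneg M) hA]
  calc _ ≤ (1 + M ^ 2) * (A + G) := h4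
    _ ≤ (m⁻¹ * K.jac x) * ((1 + M ^ 2) * (A + G)) :=
        le_mul_of_one_le_left (by positivity) h3
    _ = _ := by ring

/-- Change of variables in the boundary pairing. -/
theorem integral_pull_comp_map (q : HDiv K.carrier) {φ : Plane → ℝ} (hφ : ContDiff ℝ 1 φ) :
    ∫ x in refSquare, (fderiv ℝ (fun x => φ (K.map x)) x (K.pullVec (vecField q) x)
        + K.pullDiv (divField q) x * φ (K.map x))
      = ∫ y in K.carrier, (inner ℝ (vecField q y) (gradient φ y) + divField q y * φ y) := by
  rw [integral_carrier]
  refine integral_congr_ae (Filter.Eventually.of_forall fun x => ?_)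
  simp only [pullVec, pullDiv, inner_gradient]
  rw [K.fderiv_comp_map hφ, ContinuousLinearMap.comp_apply, fderiv_map_adj, map_smul, smul_eq_mul]
  ring

theorem tendsto_edge_integral {φ : ℕ → Plane → ℝ} (hφ : ∀ n, ContDiff ℝ 1 (φ n)) {γ : Plane → ℝ}
    {r : ℕ} (hγ : γ ∈ K.contBoundaryPoly r) (i : Fin 4)
    (h : Filter.Tendsto (fun n => eLpNorm (fun t => φ n (K.edge i t) - γ (K.edge i t)) 2
      (volume.restrict (Set.Icc (0 : ℝ) 1))) Filter.atTop (nhds 0)) :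
    Filter.Tendsto (fun n => ∫ t in (0 : ℝ)..1, (φ n (K.edge i t) - γ (K.edge i t)) ^ 2)
      Filter.atTop (nhds 0) := by
  obtain ⟨P, -, hP⟩ := hγ.2 i
  have hedge : Continuous (K.edge i) := AffineMap.lineMap_continuous
  have hf : ∀ n, MemLp (fun t => φ n (K.edge i t) - γ (K.edge i t)) 2
      (volume.restrict (Set.Icc (0 : ℝ) 1)) := fun n => by
    have hc : Continuous fun t => φ n (K.edge i t) - P.eval t :=
      ((hφ n).continuous.comp hedge).sub P.continuous
    obtain ⟨C, hC⟩ := (isCompact_Icc (a := (0 : ℝ)) (b := 1)).exists_bound_of_continuousOn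
      hc.continuousOn
    have hm : MemLp (fun t => φ n (K.edge i t) - P.eval t) 2
        (volume.restrict (Set.Icc (0 : ℝ) 1)) :=
      MemLp.of_bound hc.aestronglyMeasurable C
        ((ae_restrict_iff' measurableSet_Icc).2 (Filter.Eventually.of_forall hC))
    refine hm.ae_eq ?_
    filter_upwards [ae_restrict_mem measurableSet_Icc] with t ht
    rw [hP t ht]
  have key := tendsto_integral_norm_sq (F := fun _ => (0 : ℝ)) hf (MemLp.zero (p := 2))
    (by simpa using h)
  simp only [norm_zero, ne_eq, OfNat.ofNat_ne_zero, not_false_eq_true, zero_pow, integral_zero,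
    Real.norm_eq_abs, sq_abs] at key
  refine key.congr fun n => ?_
  rw [intervalIntegral.integral_of_le zero_le_one, integral_Icc_eq_integral_Ioc]

/-- A field whose reference functional vanishes has vanishing normal trace moments. -/
theorem normalTracePairing_eq_zero {p : ℕ} (q : HDiv K.carrier)
    (hq : ∀ e ∈ testSpace p, K.pullPair q e = 0) {γ : Plane → ℝ}
    (hγ : γ ∈ K.contBoundaryPoly (p + 1)) : K.NormalTracePairing q γ 0 := by
  rintro v g ⟨hv, hg, -⟩ ⟨φ, hφ, hφv, hφg, hedge⟩
  -- The pairing with `(V, ∇V)` vanishes by hypothesis, and the pairings with `φ n` converge to the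
  -- one with `v`. The differences `w n = φ n ∘ F_K - V` are bounded in `H¹` with boundary values
  -- tending to zero in `L²`, so `green_estimate` forces the limit to be zero.
  obtain ⟨V, hV, hVγ⟩ := K.exists_boundary_extension (by omega) hγ
  have href := K.refHDiv_pull q
  have hVc := contDiff_polyVal V
  have hφm : ∀ n, ContDiff ℝ 1 fun x => φ n (K.map x) := fun n => (hφ n).comp K.contDiff_map
  let w : ℕ → Plane → ℝ := fun n x => φ n (K.map x) - polyVal V x
  have hw : ∀ n, ContDiff ℝ 1 (w n) := fun n => (hφm n).sub hVc
  have memφ : ∀ n, MemLp (φ n) 2 (volume.restrict K.carrier) := fun n =>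
    K.memLp_carrier_of_continuous (hφ n).continuous
  have memg : ∀ n, MemLp (gradient (φ n)) 2 (volume.restrict K.carrier) := fun n =>
    K.memLp_carrier_of_continuous (continuous_gradient (hφ n))
  have hVzero : ∫ x in refSquare, (fderiv ℝ (polyVal V) x (K.pullVec (vecField q) x)
      + K.pullDiv (divField q) x * polyVal V x) = 0 := by
    have h := hq (V, (MvPolynomial.pderiv 0 V, MvPolynomial.pderiv 1 V))
      ⟨hV, pderiv_zero_mem_polyP hV, pderiv_one_mem_polyP hV⟩
    rw [pullPair, refPair_apply] at h
    rw [← h]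
    refine integral_congr_ae (Filter.Eventually.of_forall fun x => ?_)
    simp only [inner_polyVec, fderiv_polyVal]
  have hI : ∀ n, ∫ x in refSquare, (fderiv ℝ (w n) x (K.pullVec (vecField q) x)
        + K.pullDiv (divField q) x * w n x)
      = ∫ y in K.carrier, (inner ℝ (vecField q y) (gradient (φ n) y) + divField q y * φ n y) := by
    intro n
    have i1 := integrableOn_clm_apply_add href.memLp href.memLp_div
      ((hφm n).continuous_fderiv one_ne_zero) (hφm n).continuous
    have i2 := integrableOn_clm_apply_add href.memLp href.memLp_div
      (hVc.continuous_fderiv one_ne_zero) hVc.continuous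
    rw [← K.integral_pull_comp_map q (hφ n), ← sub_zero (∫ x in refSquare,
      (fderiv ℝ (fun x => φ n (K.map x)) x (K.pullVec (vecField q) x)
        + K.pullDiv (divField q) x * φ n (K.map x))), ← hVzero, ← integral_sub i1 i2]
    refine integral_congr_ae (Filter.Eventually.of_forall fun x => ?_)
    simp only [w]
    rw [fderiv_fun_sub ((hφm n).differentiable one_ne_zero x) (hVc.differentiable one_ne_zero x),
      sub_apply]
    ring
  have hlim : Filter.Tendsto (fun n => ∫ x in refSquare,
      (fderiv ℝ (w n) x (K.pullVec (vecField q) x) + K.pullDiv (divField q) x * w n x))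
      Filter.atTop (nhds (∫ y in K.carrier,
        (inner ℝ (vecField q y) (g y) + divField q y * v y))) := by
    have hmul : ∀ a b : ℝ, a * b = inner ℝ a b := fun a b => by simp [mul_comm]
    have a1 := tendsto_integral_inner memg hg (Lp.memLp (vecField q)) hφg
    have a2 := tendsto_integral_inner memφ hv (Lp.memLp (divField q)) hφv
    have a3 := a1.add a2
    have himul : ∀ {u : Plane → ℝ}, MemLp u 2 (volume.restrict K.carrier) →
        IntegrableOn (fun y => divField q y * u y) K.carrier := fun hu =>
      (Lp.memLp (divField q)).integrable_mul hu
    simp only [hI]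
    simp only [← hmul] at a3
    rw [← integral_add (integrable_inner_memLp (Lp.memLp _) hg) (himul hv)] at a3
    refine a3.congr fun n => ?_
    rw [← integral_add (integrable_inner_memLp (Lp.memLp _) (memg n)) (himul (memφ n))]
  have hbd : Filter.Tendsto (fun n => bdSq (w n)) Filter.atTop (nhds 0) := by
    have hE : ∀ i, Filter.Tendsto (fun n => ∫ t in (0 : ℝ)..1,
        (φ n (K.edge i t) - γ (K.edge i t)) ^ 2) Filter.atTop (nhds 0) := fun i =>
      K.tendsto_edge_integral hφ hγ i (hedge i)
    -- The order is that of `bdSq`: left, right, bottom, top. Edges 2 and 3 are traversed backwards,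
    -- which `hflip` repairs.
    have hsum := ((hE 3).add (hE 1)).add ((hE 0).add (hE 2))
    simp only [add_zero] at hsum
    refine hsum.congr fun n => ?_
    have hcont : ∀ i s, Continuous fun t => w n (pt i s t) ^ 2 := fun i s =>
      ((hw n).continuous.comp
        ((continuous_pt i).comp (continuous_const.prodMk continuous_id))).pow 2
    have hflip : ∀ i s, ∫ t in (0 : ℝ)..1, w n (pt i s t) ^ 2
        = ∫ t in (0 : ℝ)..1, w n (pt i s (1 - t)) ^ 2 := fun i s => by
      rw [intervalIntegral.integral_comp_sub_left (fun t => w n (pt i s t) ^ 2) 1]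
      simp
    rw [bdSq, intervalIntegral.integral_add ((hcont _ _).intervalIntegrable _ _)
      ((hcont _ _).intervalIntegrable _ _), intervalIntegral.integral_add
      ((hcont _ _).intervalIntegrable _ _) ((hcont _ _).intervalIntegrable _ _), hflip 0 0,
      hflip 1 1]
    congr 2
    all_goals
      refine intervalIntegral.integral_congr fun t ht => ?_
      rw [Set.uIcc_of_le zero_le_one] at ht
      obtain ⟨e0, e1, e2, e3⟩ := K.edge_eq_map t
      obtain ⟨v0, v1, v2, v3⟩ := hVγ t ht
      simp only [w]
    · rw [v3, ← e3]
    · rw [v1, ← e1]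
    · rw [v0, ← e0]
    · rw [v2, ← e2]
  obtain ⟨B, hB⟩ : ∃ B : ℝ, ∀ n, h1Sq (w n) ≤ B := by
    obtain ⟨C, hC⟩ := K.exists_h1Sq_comp_map_le
    have hconv := (tendsto_integral_norm_sq memφ hv hφv).add (tendsto_integral_norm_sq memg hg hφg)
    obtain ⟨B, hB⟩ := (hconv.const_mul C).bddAbove_range
    refine ⟨2 * B + 2 * h1Sq (polyVal V), fun n => (h1Sq_sub_le (hφm n) hVc).trans ?_⟩
    have := (hC (φ n) (hφ n)).trans (hB ⟨n, rfl⟩)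
    linarith
  have hB0 : 0 ≤ 1 + B := by
    have : 0 ≤ h1Sq (w 0) := integral_nonneg fun x => by positivity
    linarith [hB 0]
  refine abs_eq_zero.1 (le_antisymm (le_of_forall_pos_le_add fun ε hε => ?_) (abs_nonneg _))
  obtain ⟨M, -, hM⟩ := href.green_estimate (ε := ε / (2 + B)) (div_pos hε (by linarith))
  have hle : ∀ n, |∫ x in refSquare, (fderiv ℝ (w n) x (K.pullVec (vecField q) x)
      + K.pullDiv (divField q) x * w n x)| ≤ ε + M * bdSq (w n) := fun n => by
    refine (hM (w n) (hw n)).trans (add_le_add ?_ le_rfl)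
    rw [div_mul_eq_mul_div, div_le_iff₀ (by linarith)]
    exact mul_le_mul_of_nonneg_left (by linarith [hB n]) hε.le
  have hlim2 : Filter.Tendsto (fun n => ε + M * bdSq (w n)) Filter.atTop (nhds (ε + M * 0)) :=
    (hbd.const_mul M).const_add ε
  have := le_of_tendsto_of_tendsto' hlim.abs hlim2 hle
  linarith

/-- A field whose reference functional vanishes is orthogonal to the mapped polynomials. -/
theorem integral_inner_eq_zero {p : ℕ} (q : HDiv K.carrier)
    (hq : ∀ e ∈ testSpace p, K.pullPair q e = 0) {η : Plane → Plane} (hη : η ∈ K.vectorSpace p) :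
    ∫ y in K.carrier, inner ℝ (vecField q y) (η y) = 0 := by
  choose P hP hPη using hη
  -- The entries of the Jacobian matrix as polynomials. The first column is affine in `x 1` alone
  -- and the second in `x 0` alone, so the transpose maps Q_p × Q_p into P_{p,p+1} × P_{p+1,p}.
  let c0 : Fin 2 → MvPolynomial (Fin 2) ℝ := fun i =>
    (1 - MvPolynomial.X 1) * MvPolynomial.C ((K.vertex 1 - K.vertex 0) i)
      + MvPolynomial.X 1 * MvPolynomial.C ((K.vertex 2 - K.vertex 3) i)
  let c1 : Fin 2 → MvPolynomial (Fin 2) ℝ := fun i =>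
    (1 - MvPolynomial.X 0) * MvPolynomial.C ((K.vertex 3 - K.vertex 0) i)
      + MvPolynomial.X 0 * MvPolynomial.C ((K.vertex 2 - K.vertex 1) i)
  have hc0 : ∀ i, c0 i ∈ polyP 0 1 := fun i =>
    add_mem (mul_mem_polyP' (sub_mem (one_mem_polyP _ _) X_one_mem_polyP) (C_mem_polyP _ 0 0))
      (mul_mem_polyP' X_one_mem_polyP (C_mem_polyP _ 0 0))
  have hc1 : ∀ i, c1 i ∈ polyP 1 0 := fun i =>
    add_mem (mul_mem_polyP' (sub_mem (one_mem_polyP _ _) X_zero_mem_polyP) (C_mem_polyP _ 0 0))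
      (mul_mem_polyP' X_zero_mem_polyP (C_mem_polyP _ 0 0))
  have hc0v : ∀ i x, polyVal (c0 i) x = K.col0 x i := fun i x => by simp [c0, col0]
  have hc1v : ∀ i x, polyVal (c1 i) x = K.col1 x i := fun i x => by simp [c1, col1]
  have h := hq (0, (c0 0 * P 0 + c0 1 * P 1, c1 0 * P 0 + c1 1 * P 1))
    ⟨zero_mem _, add_mem (mul_mem_polyP' (hc0 0) (hP 0)) (mul_mem_polyP' (hc0 1) (hP 1)),
      add_mem (mul_mem_polyP' (hc1 0) (hP 0)) (mul_mem_polyP' (hc1 1) (hP 1))⟩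
  rw [pullPair, refPair_apply] at h
  rw [integral_carrier, ← h]
  refine integral_congr_ae ?_
  filter_upwards [K.quasiMeasurePreserving_map.ae (hPη 0), K.quasiMeasurePreserving_map.ae (hPη 1),
    ae_restrict_mem isOpen_refSquare.measurableSet] with x h0 h1 hx
  rw [K.invMap_map hx] at h0 h1
  rw [inner_polyVec]
  simp only [polyVal_add, polyVal_mul, hc0v, hc1v, ← h0, ← h1, polyVal_zero, mul_zero, add_zero,
    pullVec, adj, PiLp.inner_apply, Fin.sum_univ_two, RCLike.inner_apply, conj_trivial, jac, cross]
  simp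
  ring

end ConvexQuad

namespace ConvexQuad

variable (K : ConvexQuad)

/-! ### Norm bounds and the interpolation operator -/

section bounds

variable {K} {ℓ m : ℝ} (hm : 0 < m)
  (h : ∀ x ∈ closedSquare, ‖K.col0 x‖ ≤ ℓ ∧ ‖K.col1 x‖ ≤ ℓ ∧ m ≤ K.jac x)

include hm h

theorem integral_sq_pullVec_le {q : Plane → Plane} (hq : MemLp q 2 (volume.restrict K.carrier)) :
    ∫ x in refSquare, ‖K.pullVec q x‖ ^ 2 ≤ 2 * ℓ ^ 2 / m * ∫ y in K.carrier, ‖q y‖ ^ 2 := by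
  have hq2 : IntegrableOn (fun y => ‖q y‖ ^ 2) K.carrier := hq.integrable_norm_pow two_ne_zero
  rw [integral_carrier, ← integral_const_mul]
  refine setIntegral_mono_on ((K.memLp_pullVec hq).integrable_norm_pow two_ne_zero)
    (((K.integrableOn_carrier_iff _).1 hq2).const_mul _) isOpen_refSquare.measurableSet fun x hx => ?_
  obtain ⟨h0, h1, h2⟩ := h x (refSquare_subset_closedSquare hx)
  refine (K.sq_norm_adj_le h0 h1).trans ?_
  have h3 : 1 ≤ K.jac x / m := by rwa [one_le_div hm]
  calc _ ≤ K.jac x / m * (2 * ℓ ^ 2 * ‖q (K.map x)‖ ^ 2) :=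
        le_mul_of_one_le_left (by positivity) h3
    _ = _ := by ring

/-- The change of variables consumes one of the two Jacobian factors, and the other is at most `ℓ ^
2`; no division by `m` occurs. -/
theorem integral_sq_pullDiv_le {d : Plane → ℝ} (hd : MemLp d 2 (volume.restrict K.carrier)) :
    ∫ x in refSquare, K.pullDiv d x ^ 2 ≤ ℓ ^ 2 * ∫ y in K.carrier, d y ^ 2 := by
  rw [integral_carrier, ← integral_const_mul]
  refine setIntegral_mono_on (K.memLp_pullDiv hd).integrable_sq
    (((K.integrableOn_carrier_iff fun y => d y ^ 2).1 hd.integrable_sq).const_mul _)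
    isOpen_refSquare.measurableSet fun x hx => ?_
  obtain ⟨h0, h1, h2⟩ := h x (refSquare_subset_closedSquare hx)
  have hj : 0 ≤ K.jac x := hm.le.trans h2
  have h3 : K.jac x ≤ ℓ ^ 2 := by
    refine ((le_abs_self _).trans (abs_cross_le _ _)).trans ?_
    rw [pow_two]
    exact mul_le_mul h0 h1 (norm_nonneg _) ((norm_nonneg _).trans h0)
  calc K.pullDiv d x ^ 2 = K.jac x * (K.jac x * d (K.map x) ^ 2) := by rw [pullDiv]; ring
    _ ≤ _ := mul_le_mul_of_nonneg_right h3 (by positivity)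

theorem sq_norm_piolaHDiv_le (Q : MvPolynomial (Fin 2) ℝ × MvPolynomial (Fin 2) ℝ) :
    ‖K.piolaHDiv Q‖ ^ 2 ≤ 2 * ℓ ^ 2 / m * (∫ x in refSquare, ‖polyVec Q x‖ ^ 2)
      + 1 / m * ∫ x in refSquare, polyVal (polyDiv Q) x ^ 2 := by
  rw [HDiv.sq_norm]
  have hv : ∫ y in K.carrier, ‖vecField (K.piolaHDiv Q) y‖ ^ 2
      = ∫ y in K.carrier, ‖K.piola (polyVec Q) y‖ ^ 2 :=
    integral_congr_ae ((K.vecField_piolaHDiv Q).mono fun y hy => by simp only [hy])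
  have hd : ∫ y in K.carrier, divField (K.piolaHDiv Q) y ^ 2
      = ∫ y in K.carrier, K.piolaDiv Q y ^ 2 :=
    integral_congr_ae ((K.divField_piolaHDiv Q).mono fun y hy => by simp only [hy])
  rw [hv, hd]
  refine add_le_add ?_ ?_
  · rw [integral_carrier, ← integral_const_mul]
    refine setIntegral_mono_on ((K.integrableOn_carrier_iff fun y => ‖K.piola (polyVec Q) y‖ ^ 2).1
      ((K.memLp_piola Q).integrable_norm_pow two_ne_zero))
      (integrableOn_refSquare (((continuous_polyVec Q).norm.pow 2).const_mul _))
      isOpen_refSquare.measurableSet fun x hx => ?_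
    obtain ⟨h0, h1, h2⟩ := h x (refSquare_subset_closedSquare hx)
    have hj : 0 < K.jac x := hm.trans_le h2
    have hℓ : 0 ≤ ℓ := (norm_nonneg _).trans h0
    rw [K.piola_map _ hx, norm_smul, mul_pow, Real.norm_of_nonneg (inv_nonneg.2 hj.le), fderiv_map]
    set u := polyVec Q x
    have hu : ‖u‖ ^ 2 = u 0 ^ 2 + u 1 ^ 2 := by rw [EuclideanSpace.norm_sq_eq]; simp
    have h3 : ‖u 0 • K.col0 x + u 1 • K.col1 x‖ ≤ (|u 0| + |u 1|) * ℓ := by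
      refine (norm_add_le _ _).trans ?_
      rw [norm_smul, norm_smul, add_mul]
      exact add_le_add (mul_le_mul_of_nonneg_left h0 (abs_nonneg _))
        (mul_le_mul_of_nonneg_left h1 (abs_nonneg _))
    have h4 : ‖u 0 • K.col0 x + u 1 • K.col1 x‖ ^ 2 ≤ 2 * ℓ ^ 2 * ‖u‖ ^ 2 := by
      refine (pow_le_pow_left₀ (norm_nonneg _) h3 2).trans ?_
      rw [hu, mul_pow, ← sq_abs (u 0), ← sq_abs (u 1)]
      nlinarith [mul_nonneg (sq_nonneg (|u 0| - |u 1|)) (sq_nonneg ℓ)]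
    have h5 : K.jac x * ((K.jac x)⁻¹ ^ 2) ≤ m⁻¹ := by
      rw [pow_two, mul_inv_cancel_left₀ hj.ne']
      exact inv_anti₀ hm h2
    calc _ = K.jac x * ((K.jac x)⁻¹ ^ 2) * ‖u 0 • K.col0 x + u 1 • K.col1 x‖ ^ 2 := by ring
      _ ≤ m⁻¹ * (2 * ℓ ^ 2 * ‖u‖ ^ 2) := mul_le_mul h5 h4 (by positivity) (by positivity)
      _ = _ := by ring
  · rw [integral_carrier, ← integral_const_mul]
    refine setIntegral_mono_on ((K.integrableOn_carrier_iff fun y => K.piolaDiv Q y ^ 2).1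
      (K.memLp_piolaDiv Q).integrable_sq)
      (integrableOn_refSquare (((continuous_polyVal (polyDiv Q)).pow 2).const_mul _))
      isOpen_refSquare.measurableSet fun x hx => ?_
    obtain ⟨-, -, h2⟩ := h x (refSquare_subset_closedSquare hx)
    have hj : 0 < K.jac x := hm.trans_le h2
    rw [K.piolaDiv_map _ hx]
    calc _ = (K.jac x)⁻¹ * polyVal (polyDiv Q) x ^ 2 := by field_simp
      _ ≤ 1 / m * polyVal (polyDiv Q) x ^ 2 := by
        rw [one_div]
        exact mul_le_mul_of_nonneg_right (inv_anti₀ hm h2) (sq_nonneg _)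

end bounds

set_option maxHeartbeats 2000000 in
/-- The interpolation operator, with a bound in terms of the Jacobian of `F_K`. -/
theorem exists_interpolation_operator (p : ℕ) : ∃ C₁ : ℝ, 0 ≤ C₁ ∧ ∀ (K : ConvexQuad) (ℓ m : ℝ),
    0 < m → (∀ x ∈ closedSquare, ‖K.col0 x‖ ≤ ℓ ∧ ‖K.col1 x‖ ≤ ℓ ∧ m ≤ K.jac x) →
    ∃ T : HDiv K.carrier →ₗ[ℝ] K.rtSpace (p + 2), ∀ q : HDiv K.carrier,
      (∀ η ∈ K.vectorSpace p,
        ∫ y in K.carrier, inner ℝ (vecField (q - (T q : HDiv K.carrier)) y) (η y) = 0) ∧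
      (∀ γ ∈ K.contBoundaryPoly (p + 1),
        K.NormalTracePairing (q - (T q : HDiv K.carrier)) γ 0) ∧
      ‖(T q : HDiv K.carrier)‖ ^ 2
        ≤ (2 * (ℓ ^ 2 / m) * C₁ * (2 * (ℓ ^ 2 / m) + ℓ ^ 2) + ℓ ^ 2 / m) * ‖q‖ ^ 2 := by
  obtain ⟨B, hB⟩ := exists_interpolation p
  obtain ⟨C₁, hC₁, hbound⟩ := exists_interpolation_bound B
  refine ⟨C₁, hC₁, fun K ℓ m hm h => ?_⟩
  -- The system is solved in index `p + 1`; the solution is then regarded as an element of the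
  -- larger space of index `p + 2`.
  refine ⟨(K.piolaRT (Nat.le_succ (p + 1))).comp (B.comp (K.pullDual p)), fun q => ?_⟩
  set Q := B (K.pullDual p q)
  have hT : (((K.piolaRT (Nat.le_succ (p + 1))).comp (B.comp (K.pullDual p)) q : K.rtSpace (p + 2)) :
      HDiv K.carrier) = K.piolaHDiv Q.1 := rfl
  rw [hT]
  have hQ : ∀ e ∈ testSpace p, polyPair Q.1 e = K.pullPair q e := fun e he =>
    LinearMap.congr_fun (hB (K.pullDual p q) fun e he =>
      (K.refHDiv_pull q).refPair_eq_zero e.2 he) ⟨e, he⟩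
  have hzero : ∀ e ∈ testSpace p, K.pullPair (q - K.piolaHDiv Q.1) e = 0 := fun e he => by
    rw [sub_eq_add_neg, ← neg_one_smul ℝ (K.piolaHDiv Q.1), pullPair_add, pullPair_smul,
      pullPair_piolaHDiv, LinearMap.add_apply, LinearMap.smul_apply, hQ e he, smul_eq_mul]
    ring
  refine ⟨fun η hη => K.integral_inner_eq_zero _ hzero hη,
    fun γ hγ => K.normalTracePairing_eq_zero _ hzero hγ, ?_⟩
  have hqm := Lp.memLp (vecField q)
  have hdm := Lp.memLp (divField q)
  have b1 := sq_norm_piolaHDiv_le hm h Q.1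
  have b2 := hbound _ _ (K.memLp_pullVec hqm) (K.memLp_pullDiv hdm)
  -- Bounding the divergence through the field by equivalence of norms would leave `ℓ ^ 2 / m ^ 2`,
  -- which is unbounded for small elements; the projection property uses `divField q` only.
  have b3 := integral_sq_polyDiv_le (K.memLp_pullVec hqm) (K.memLp_pullDiv hdm) Q.2 hQ
  have b4 := integral_sq_pullVec_le hm h hqm
  have b5 := integral_sq_pullDiv_le hm h hdm
  rw [integral_add ((K.memLp_pullVec hqm).integrable_norm_pow two_ne_zero)
    (K.memLp_pullDiv hdm).integrable_sq] at b2
  change ∫ x in refSquare, ‖polyVec Q.1 x‖ ^ 2 ≤ _ at b2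
  have hA : 0 ≤ ∫ y in K.carrier, ‖vecField q y‖ ^ 2 := integral_nonneg fun y => by positivity
  have hD : 0 ≤ ∫ y in K.carrier, divField q y ^ 2 := integral_nonneg fun y => by positivity
  rw [HDiv.sq_norm q]
  set A := ∫ y in K.carrier, ‖vecField q y‖ ^ 2
  set D := ∫ y in K.carrier, divField q y ^ 2
  have hm' : 0 ≤ 1 / m := by positivity
  have hκ : 0 ≤ ℓ ^ 2 / m := by positivity
  calc ‖K.piolaHDiv Q.1‖ ^ 2
      ≤ 2 * ℓ ^ 2 / m * (C₁ * (2 * ℓ ^ 2 / m * A + ℓ ^ 2 * D)) + 1 / m * (ℓ ^ 2 * D) := by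
        refine b1.trans (add_le_add (mul_le_mul_of_nonneg_left ?_ (by positivity))
          (mul_le_mul_of_nonneg_left (b3.trans b5) hm'))
        exact b2.trans (mul_le_mul_of_nonneg_left (add_le_add b4 b5) hC₁)
    _ = 2 * (ℓ ^ 2 / m) * C₁ * (2 * (ℓ ^ 2 / m) * A + ℓ ^ 2 * D) + ℓ ^ 2 / m * D := by ring
    _ ≤ 2 * (ℓ ^ 2 / m) * C₁ * ((2 * (ℓ ^ 2 / m) + ℓ ^ 2) * (A + D)) + ℓ ^ 2 / m * (A + D) := by
        refine add_le_add (mul_le_mul_of_nonneg_left ?_ (by positivity))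
          (mul_le_mul_of_nonneg_left (by linarith) hκ)
        nlinarith [mul_nonneg hκ hD, mul_nonneg (sq_nonneg ℓ) hA]
    _ = _ := by ring

end ConvexQuad

end QuadFE

end

set_option maxHeartbeats 2000000 in
theorem mainTheorem5 (p : ℕ) (θ σ L : ℝ) (hθ : 0 < θ) :
    ∃ C : ℝ, 0 < C ∧
      ∀ K : QuadFE.ConvexQuad, K.ShapeRegular θ σ → K.diam ≤ L →
        ∃ T : QuadFE.HDiv K.carrier →ₗ[ℝ] K.rtSpace (p + 2),
          ∀ q : QuadFE.HDiv K.carrier,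
            (∀ η ∈ K.vectorSpace p,
              ∫ y in K.carrier, inner ℝ (QuadFE.vecField (q - (T q : QuadFE.HDiv K.carrier)) y) (η y) = 0) ∧
            (∀ γ ∈ K.contBoundaryPoly (p + 1),
              K.NormalTracePairing (q - (T q : QuadFE.HDiv K.carrier)) γ 0) ∧
            ‖(T q : QuadFE.HDiv K.carrier)‖ ≤ C * ‖q‖ := by
  obtain ⟨C₁, hC₁, hop⟩ := QuadFE.ConvexQuad.exists_interpolation_operator p
  let κ := σ ^ 4 / Real.sin θ
  let M := 2 * κ * C₁ * (2 * κ + (σ * L) ^ 2) + κ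
  -- When no admissible element exists, `M` may be negative; `|M| + 1` gives a positive constant in
  -- every case.
  refine ⟨√(|M| + 1), by positivity, fun K hK hL => ?_⟩
  obtain ⟨hsin, ℓ, m, hℓ, hm, hbd, hκ, hℓL⟩ := hK.exists_scale hθ hL
  obtain ⟨T, hT⟩ := hop K ℓ m hm hbd
  refine ⟨T, fun q => ⟨(hT q).1, (hT q).2.1, ?_⟩⟩
  refine le_of_sq_le_sq ?_ (by positivity)
  have hκ' : ℓ ^ 2 / m ≤ κ := by rwa [div_le_iff₀ hm]
  have hκ0 : 0 ≤ ℓ ^ 2 / m := by positivity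
  rw [mul_pow, Real.sq_sqrt (by positivity)]
  refine (hT q).2.2.trans (mul_le_mul_of_nonneg_right ?_ (sq_nonneg _))
  have hle : 2 * (ℓ ^ 2 / m) * C₁ * (2 * (ℓ ^ 2 / m) + ℓ ^ 2) + ℓ ^ 2 / m ≤ M := by
    refine add_le_add ?_ hκ'
    refine mul_le_mul (mul_le_mul_of_nonneg_right ?_ hC₁) ?_ (by positivity)
      (mul_nonneg (mul_nonneg zero_le_two (hκ0.trans hκ')) hC₁) <;> linarith
  linarith [le_abs_self M]
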